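/- For $n\ge 1$, let $\mathcal{G}_n$ be the family of welded trees of height $n$: the graphs on $2^{n+2}-2$ nodes that consist of two balanced binary trees of height $n$, whose roots are labeled $\mathtt{source}$ and $\mathtt{target}$, connected by an arbitrary cycle through all the leaves that alternates between the leaves of the two trees. A classical distributed algorithm runs in synchronous rounds on such a network. Every node has a distinct identifier from a finite domain $I$, and the links of a node $u$ are numbered by an arbitrary bijection $p_u$ from $\{1,\dots,\deg(u)\}$ to its neighbours. Initially a node knows only its identifier, its degree, whether it is $\mathtt{source}$ or $\mathtt{target}$ (and, at $\mathtt{source}$, the data $x\in\{0,1\}^b$). All nodes run the same algorithm, which may depend on $n$ (so that the number of nodes is known), on $b$ and on $I$; each node has an infinite sequence of private random bits, and all the nodes share prior randomness. In each round a node chooses, as an arbitrary function of all it knows, for each of its ports a bit string to be sent through this port (the empty string meaning that nothing is sent). The algorithm stops as soon as some node decides to stop. It delivers $x$ if $\mathtt{target}$ stops with output $x$. It solves the point-to-point routing problem in $\mathcal{G}_n$ with probability at least $q$ if, for every graph in $\mathcal{G}_n$, all identifiers, all port numberings and all $x\in\{0,1\}^b$, it delivers $x$ with probability at least $q$ over the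 randomness. Its message complexity is the maximum, over the graphs in $\mathcal{G}_n$, the identifiers, the port numberings, $x$ and all values of the randomness, of the total number of bits sent before the algorithm stops. **Theorem.** There is a universal constant $c>0$ such that for all $n\ge 1$, all $b\ge 0$, all $q\in[2^{-b},1]$ and all finite domains $I$ of at least $2^{n+2}-2$ identifiers, every classical distributed algorithm (with private and shared randomness) that solves the point-to-point routing problem in $\mathcal{G}_n$ with probability at least $q$ has message complexity at least $$c\,\Bigl(q-\frac1{2^b}\Bigr)^{1/5}\cdot 2^{n/20}.$$ -/

import Mathlib

open MeasureTheory
open scoped ENNReal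

/-! ### Networks with port numbering -/

/-- The `b`-bit strings. -/
abbrev Bits (b : ℕ) : Type := Fin b → Bool

/-- Messages are finite bit strings; the empty string `[]` stands for "nothing is sent". -/
abbrev Msg : Type := List Bool

/-- A network on the node set `V` with identifiers in `I`: a graph, its two special nodes, the
degrees, a port numbering, and distinct identifiers. The bijection `port u` numbers the neighbours
of `u`, and forces `deg u` to be the degree of `u`. -/
structure Network (V I : Type*) where
  graph : SimpleGraph V
  source : V
  target : V
  deg : V → ℕ
  port : ∀ u, Fin (deg u) ≃ graph.neighborSet u
  ident : V ↪ I

/-- What a node knows about its role: the source knows that it is the source and holds the data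
`x`, the target knows that it is the target, all other nodes have no input. -/
inductive Role (b : ℕ) : Type
  | source (x : Bits b)
  | target
  | plain

namespace Network

variable {V I : Type*} {b : ℕ}

/-- The role of node `v` when the data to be routed is `x`. -/
def role [DecidableEq V] (N : Network V I) (x : Bits b) (v : V) : Role b :=
  if v = N.source then .source x else if v = N.target then .target else .plain

/-- The neighbour of `v` behind port `j` of `v`. -/
def nbr (N : Network V I) (v : V) (j : Fin (N.deg v)) : V := (N.port v j).1

theorem adj_nbr (N : Network V I) (v : V) (j : Fin (N.deg v)) :
    N.graph.Adj (N.nbr v j) v :=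
  (N.port v j).2.symm

/-- The port number, at the neighbour of `v` behind port `j`, of the link that leads back
to `v`. -/
def backPort (N : Network V I) (v : V) (j : Fin (N.deg v)) : Fin (N.deg (N.nbr v j)) :=
  (N.port (N.nbr v j)).symm ⟨v, N.adj_nbr v j⟩

end Network

/-! ### Classical randomized distributed algorithms -/

/-- A classical randomized synchronous distributed algorithm, the same at every node. `Ω` is the
space of the shared randomness.

`act i ρ d s c h` is what a node does in a round, given all it can know: its identifier `i`, its
role `ρ` (with the data, at the source), its degree `d`, the shared randomness `s`, its own
infinite sequence `c` of random bits, and the list `h` of the tuples of messages that it received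
through its `d` ports in the previous rounds (latest round first). The result is the tuple of
messages to be sent through the `d` ports, and a decision: `none` to go on, `some y` to stop the
whole algorithm, with output `y` (only the output of the target matters).

The local computation is arbitrary, except that it depends measurably on the randomness. -/
structure DistAlg (I : Type*) (b : ℕ) (Ω : Type*) [MeasurableSpace Ω] where
  act : I → Role b → (d : ℕ) → Ω → (ℕ → Bool) → List (Fin d → Msg) →
    (Fin d → Msg) × Option (Bits b)
  measurableSet_act : ∀ (i : I) (ρ : Role b) (d : ℕ) (h : List (Fin d → Msg))
    (a : (Fin d → Msg) × Option (Bits b)),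
    MeasurableSet {p : Ω × (ℕ → Bool) | act i ρ d p.1 p.2 h = a}

namespace DistAlg

variable {V I Ω : Type*} [DecidableEq V] [MeasurableSpace Ω] {b : ℕ}

/-- The messages received by each node in the first `r` rounds, latest round first. The algorithm
`A` runs on the network `N` with data `x`, shared randomness `ω.1`, and local random bits `ω.2 v`
at node `v`; stopping is disregarded here. -/
def received (A : DistAlg I b Ω) (N : Network V I) (x : Bits b) (ω : Ω × (V → ℕ → Bool)) :
    ℕ → (v : V) → List (Fin (N.deg v) → Msg)
  | 0, _ => []
  | r + 1, v =>
    (fun j =>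
      (A.act (N.ident (N.nbr v j)) (N.role x (N.nbr v j)) (N.deg (N.nbr v j)) ω.1
        (ω.2 (N.nbr v j)) (A.received N x ω r (N.nbr v j))).1 (N.backPort v j)) ::
      A.received N x ω r v

/-- What node `v` does in round `r` (rounds are numbered from `0`). -/
def step (A : DistAlg I b Ω) (N : Network V I) (x : Bits b) (ω : Ω × (V → ℕ → Bool))
    (r : ℕ) (v : V) : (Fin (N.deg v) → Msg) × Option (Bits b) :=
  A.act (N.ident v) (N.role x v) (N.deg v) ω.1 (ω.2 v) (A.received N x ω r v)

/-- No node has decided to stop in the rounds `0, …, r`. -/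
def Running (A : DistAlg I b Ω) (N : Network V I) (x : Bits b) (ω : Ω × (V → ℕ → Bool))
    (r : ℕ) : Prop :=
  ∀ k ≤ r, ∀ v, (A.step N x ω k v).2 = none

/-- The execution delivers the data: in some round the target stops with output `x`, and no node
has stopped the algorithm in an earlier round. -/
def Delivers (A : DistAlg I b Ω) (N : Network V I) (x : Bits b) (ω : Ω × (V → ℕ → Bool)) :
    Prop :=
  ∃ r, (∀ k < r, A.Running N x ω k) ∧ (A.step N x ω r N.target).2 = some x

variable [Fintype V]

/-- The number of bits sent in round `r`, summed over all nodes and all ports. -/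
def sentBits (A : DistAlg I b Ω) (N : Network V I) (x : Bits b) (ω : Ω × (V → ℕ → Bool))
    (r : ℕ) : ℕ :=
  ∑ v, ∑ j, ((A.step N x ω r v).1 j).length

/-- The message complexity of one execution: the number of bits sent in all the rounds before the
one in which the algorithm is stopped (infinite if infinitely many bits are sent). -/
noncomputable def cost (A : DistAlg I b Ω) (N : Network V I) (x : Bits b)
    (ω : Ω × (V → ℕ → Bool)) : ℝ≥0∞ :=
  ∑' r : {r : ℕ // A.Running N x ω r}, (A.sentBits N x ω r : ℝ≥0∞)

/-- The message complexity on a family of networks: the maximum over the networks of the family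
(with their identifiers and port numbers), the data, and all the randomness. -/
noncomputable def messageComplexity (A : DistAlg I b Ω) (𝒩 : Set (Network V I)) : ℝ≥0∞ :=
  ⨆ N ∈ 𝒩, ⨆ x : Bits b, ⨆ ω : Ω × (V → ℕ → Bool), A.cost N x ω

/-- The law of the local randomness: independent fair bits, an infinite sequence for each node. -/
noncomputable def coins (V : Type*) [Fintype V] : Measure (V → ℕ → Bool) :=
  Measure.pi fun _ => Measure.infinitePi fun _ => (PMF.uniformOfFintype Bool).toMeasure

/-- The algorithm solves point-to-point routing with probability at least `q` on a family of
networks, if the shared randomness has law `μ`: on every network of the family (with any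
identifiers and port numbers) and for all data, the data is delivered with probability at
least `q`. -/
def SolvesRouting (A : DistAlg I b Ω) (μ : Measure Ω) (𝒩 : Set (Network V I)) (q : ℝ) : Prop :=
  ∀ N ∈ 𝒩, ∀ x : Bits b, ENNReal.ofReal q ≤ (μ.prod (coins V)) {ω | A.Delivers N x ω}

end DistAlg

/-! ### Welded trees -/

namespace WeldedTrees

/-- The nodes of two balanced binary trees of height `n`: `(s, ⟨k, i⟩)` is the node of index `i`
(out of `2 ^ k`) at depth `k` in the left (`s = false`) or right (`s = true`) tree. -/
abbrev Vertex (n : ℕ) : Type := Bool × (k : Fin (n + 1)) × Fin (2 ^ (k : ℕ))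

/-- The root of a tree. -/
def root (n : ℕ) (s : Bool) : Vertex n := (s, ⟨0, ⟨0, by simp⟩⟩)

/-- The leaf of index `i` of a tree. -/
def leaf {n : ℕ} (s : Bool) (i : Fin (2 ^ n)) : Vertex n := (s, ⟨Fin.last n, i⟩)

/-- `v` is a child of `u` (the node of index `i` has children of indices `2 * i`
and `2 * i + 1`). -/
def Child {n : ℕ} (u v : Vertex n) : Prop :=
  u.1 = v.1 ∧ (v.2.1 : ℕ) = u.2.1 + 1 ∧ (v.2.2 : ℕ) / 2 = u.2.2

/-- `u` is a left leaf, `v` is a right leaf, and they are consecutive on the cycle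
`α 0, β 0, α 1, β 1, …, α (2 ^ n - 1), β (2 ^ n - 1), α 0`, which alternates between left leaves
`α i` and right leaves `β i` (the addition in `Fin (2 ^ n)` is cyclic). -/
def Weld {n : ℕ} (α β : Equiv.Perm (Fin (2 ^ n))) (u v : Vertex n) : Prop :=
  ∃ i, (u = leaf false (α i) ∨ u = leaf false (α (i + 1))) ∧ v = leaf true (β i)

/-- The two trees, connected by the alternating cycle given by `α` and `β`. -/
def graph {n : ℕ} (α β : Equiv.Perm (Fin (2 ^ n))) : SimpleGraph (Vertex n) :=
  SimpleGraph.fromRel fun u v => Child u v ∨ Weld α β u v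

/-- The family of welded trees of height `n`: the source and the target are the two roots; the
cycle through the leaves, the identifiers and the port numbers are arbitrary. -/
def family (n : ℕ) (I : Type*) : Set (Network (Vertex n) I) :=
  {N | N.source = root n false ∧ N.target = root n true ∧
    ∃ α β : Equiv.Perm (Fin (2 ^ n)), N.graph = graph α β}

end WeldedTrees

/-!
Close the welded trees by an edge between the two roots: the result is a cubic graph. The execution
of an algorithm on this graph is compared with an *ideal run* on a forest of infinite cubic trees,
its universal cover as seen from several places: the trees grow from the source, from the target and
from the (few) nodes that would start to send spontaneously. The vertices of the forest are woken by
messages, and carry independent labels: an identifier, the port number of the link to the parent,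
and a hidden bit, which decides which child is mapped to which neighbour in the real graph. In the
ideal run no information passes from the tree of the source to the tree of the target, so that the
target can only guess the data (`idealHistory_congr_root`).

As long as the vertices that have been woken are mapped to distinct nodes, the real run is the image
of the ideal run (`Rotation.history_eq_of_injOn`, `twist_history_eq`). Hence an algorithm can only
be better than guessing on networks where, while few messages are sent, two woken vertices are
mapped to the same node (`FirstCollision`, `eq_of_delivers`). Identifiers and port numbers are chosen
at random, and it remains to bound the probability of a collision, for fixed randomness of the
algorithm.

* The ideal run, hence the set of vertices that are woken while at most `M` of them are, does not
  depend on the hidden bits and on the positions of the spontaneous roots; so these can be varied for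
  a fixed pair of woken vertices. If the pair lies in different trees, one of which grows from a
  spontaneous root, then moving this root moves one of the two to nearly all nodes
  (`card_collision_mul_le_of_root`). Otherwise the pair collides only at distance about the girth
  `γ` from the roots, and varying the hidden bits of the last `h < γ / 2` ancestors moves the
  deeper one to `2 ^ h` distinct nodes (`card_collision_mul_le_of_girth`).
* Labels read off a random network are distributed nearly as independent labels up to the first
  collision: a given outcome prescribes a random permutation and random port numbers at `j ≤ 3 * M`
  distinct places, and `m ^ j * (m - j)! ≤ 2 * m!` if `2 * j ^ 2 ≤ m`
  (`card_firstCollision_le`).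
* Some weld has girth about `n / 2` (`exists_girthAtLeast`): as long as there is a shorter cycle,
  exchanging a leaf on a shortest cycle with a leaf far away destroys this cycle and creates no
  other one that is as short.

With `M` bits the probability of success is thus at most `2⁻ᵇ + O(M² * 2 ^ (-n / 4))`, and the bound
follows as `M ^ (2 / 5) ≤ M`.
-/

/-! ### Non-backtracking walks and girth -/

section Girth

variable {V : Type*}

/-- A closed walk of length `L`, unrolled to a periodic sequence, that nowhere backtracks. -/
def IsCyclicWalk (G : V → V → Prop) (L : ℕ) (w : ℕ → V) : Prop :=
  (∀ i, G (w i) (w (i + 1))) ∧ (∀ i, w i ≠ w (i + 2)) ∧ ∀ i, w (i + L) = w i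

/-- No walk of positive length less than `g` that never backtracks returns to its starting point
(it may backtrack at this point). For graphs, this says that the girth is at least `g`. -/
def GirthAtLeast (G : V → V → Prop) (g : ℕ) : Prop :=
  ∀ (w : ℕ → V) (L : ℕ), 0 < L → L < g → (∀ i < L, G (w i) (w (i + 1))) →
    (∀ i, i + 2 ≤ L → w i ≠ w (i + 2)) → w 0 ≠ w L

/-- A closed non-backtracking walk can be shortened at its base point until it does not backtrack
there either. -/
theorem girthAtLeast_of_forall_not_isCyclicWalk {G : V → V → Prop} {g : ℕ}
    (hirr : ∀ v, ¬ G v v) (h : ∀ L w, 0 < L → L < g → ¬ IsCyclicWalk G L w) :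
    GirthAtLeast G g := by
  intro w L
  induction L using Nat.strong_induction_on generalizing w with
  | _ L ih =>
    intro hL hLg hadj hnb h0
    rcases Nat.lt_or_ge L 3 with h3 | h3
    · have : L = 1 ∨ L = 2 := by omega
      rcases this with rfl | rfl
      · have := hadj 0 (by omega)
        rw [h0] at this
        exact hirr _ this
      · exact hnb 0 le_rfl h0
    by_cases h1 : w 1 = w (L - 1)
    · refine ih (L - 2) (by omega) (fun i => w (1 + i)) (by omega) (by omega) ?_ ?_ ?_
      · intro i hi
        exact hadj (1 + i) (by omega)
      · intro i hi
        exact hnb (1 + i) (by omega)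
      · have : 1 + (L - 2) = L - 1 := by omega
        simp only [this, add_zero]
        exact h1
    · refine h L (fun i => w (i % L)) hL hLg ⟨?_, ?_, ?_⟩
      · intro i
        have hi := Nat.mod_lt i hL
        simp only [Nat.add_mod i 1 L, Nat.mod_eq_of_lt (show 1 < L by omega)]
        rcases Nat.lt_or_ge (i % L + 1) L with h2 | h2
        · rw [Nat.mod_eq_of_lt h2]
          exact hadj _ hi
        · have h4 : i % L + 1 = L := by omega
          rw [h4, Nat.mod_self, h0]
          have := hadj _ hi
          rwa [h4] at this
      · intro i
        have hi := Nat.mod_lt i hL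
        simp only [Nat.add_mod i 2 L, Nat.mod_eq_of_lt (show 2 < L by omega)]
        rcases Nat.lt_or_ge (i % L + 2) L with h2 | h2
        · rw [Nat.mod_eq_of_lt h2]
          exact hnb _ (by omega)
        · rcases Nat.eq_or_lt_of_le h2 with h4 | h4
          · rw [← h4, Nat.mod_self, h0]
            have := hnb (i % L) (by omega)
            rwa [← h4] at this
          · have h5 : i % L = L - 1 := by omega
            have h6 : (L - 1 + 2) % L = 1 := by
              rw [show L - 1 + 2 = 1 + L by omega, Nat.add_mod_right, Nat.mod_eq_of_lt (by omega)]
            rw [h5, h6]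
            exact fun h => h1 h.symm
      · intro i
        simp

/-- The two edges `b p` and `b' p'` are replaced by `b p'` and `b' p`, where `b'` is far from `b`.
No closed non-backtracking walk of length at most `γ` uses one of the new edges, if the old graph
has girth at least `γ`. -/
theorem IsCyclicWalk.old_of_exchange {G G' : V → V → Prop} (hsymm : ∀ u v, G u v → G v u)
    (hirr : ∀ v, ¬ G v v) {b p b' p' : V} (hbp : G b p) (hbp' : G b' p')
    (hG' : ∀ u v, G' u v →
      (G u v ∧ ¬ (u = b ∧ v = p) ∧ ¬ (u = p ∧ v = b) ∧ ¬ (u = b' ∧ v = p') ∧ ¬ (u = p' ∧ v = b')) ∨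
      ((u = b ∧ v = p') ∨ (u = p' ∧ v = b) ∨ (u = b' ∧ v = p) ∨ (u = p ∧ v = b')))
    {γ : ℕ} (hγ : GirthAtLeast G γ) (B : ℕ → Set V) (hB0 : b ∈ B 0) (hBm : Monotone B)
    (hB : ∀ k u v, u ∈ B k → G u v → v ∈ B (k + 1)) (hfar : b' ∉ B (γ + 2))
    {L : ℕ} (hL : 0 < L) (hLγ : L ≤ γ) {w : ℕ → V} (hw : IsCyclicWalk G' L w) (i : ℕ) :
    G (w i) (w (i + 1)) ∧ ¬ (w i = b ∧ w (i + 1) = p) ∧ ¬ (w i = p ∧ w (i + 1) = b) := by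
  classical
  set New : V → V → Prop := fun u v =>
    ((u = b ∧ v = p') ∨ (u = p' ∧ v = b) ∨ (u = b' ∧ v = p) ∨ (u = p ∧ v = b')) with hNew
  set Old : V → V → Prop := fun u v =>
      (G u v ∧ ¬ (u = b ∧ v = p) ∧ ¬ (u = p ∧ v = b) ∧ ¬ (u = b' ∧ v = p') ∧
        ¬ (u = p' ∧ v = b')) with hOld
  have hON : ∀ j, Old (w j) (w (j + 1)) ∨ New (w j) (w (j + 1)) := fun j => hG' _ _ (hw.1 j)
  by_cases hnew : New (w i) (w (i + 1))
  swap
  · have := (hON i).resolve_right hnew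
    exact ⟨this.1, this.2.1, this.2.2.1⟩
  -- a new edge at step `i`; the next new edge, at step `i + d`, exists by periodicity
  exfalso
  have hex : ∃ d, 1 ≤ d ∧ New (w (i + d)) (w (i + d + 1)) := by
    refine ⟨L, hL, ?_⟩
    rw [hw.2.2 i, show i + L + 1 = i + 1 + L by omega, hw.2.2 (i + 1)]
    exact hnew
  obtain ⟨d, ⟨hd1, hdnew⟩, hdmin⟩ : ∃ d, (1 ≤ d ∧ New (w (i + d)) (w (i + d + 1))) ∧
      ∀ k, 1 ≤ k → k < d → ¬ New (w (i + k)) (w (i + k + 1)) :=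
    ⟨Nat.find hex, Nat.find_spec hex, fun k hk hkd h => Nat.find_min hex hkd ⟨hk, h⟩⟩
  have hdL : d ≤ L := by
    by_contra hlt
    refine hdmin L hL (by omega) ?_
    rw [hw.2.2 i, show i + L + 1 = i + 1 + L by omega, hw.2.2 (i + 1)]
    exact hnew
  have hold : ∀ k, 1 ≤ k → k < d → Old (w (i + k)) (w (i + k + 1)) := fun k hk hkd =>
    (hON (i + k)).resolve_right (hdmin k hk hkd)
  -- the four end points are distinct
  have hp1 : p ∈ B 1 := hB 0 _ _ hB0 hbp
  have hb1 : b ∈ B 1 := hBm (Nat.zero_le 1) hB0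
  have hb'far : ∀ k ≤ γ + 2, b' ∉ B k := fun k hk h => hfar (hBm hk h)
  have hp'far : ∀ k ≤ γ + 1, p' ∉ B k := fun k hk h =>
    hb'far (k + 1) (by omega) (hB k _ _ h (hsymm _ _ hbp'))
  have e1 : b ≠ p := fun h => hirr p (h ▸ hbp)
  have e2 : b' ≠ p' := fun h => hirr p' (h ▸ hbp')
  have e3 : b ≠ b' := fun h => hb'far 1 (by omega) (h ▸ hb1)
  have e4 : b ≠ p' := fun h => hp'far 1 (by omega) (h ▸ hb1)
  have e5 : p ≠ b' := fun h => hb'far 1 (by omega) (h ▸ hp1)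
  have e6 : p ≠ p' := fun h => hp'far 1 (by omega) (h ▸ hp1)
  -- old edges do not lead from `b` or `p` to `b'` or `p'`, as these are far away
  have hfwd : w (i + 1) ∈ B 1 → ∀ k, k + 1 ≤ d → w (i + (k + 1)) ∈ B (k + 1) := by
    intro h k
    induction k with
    | zero => intro _; exact h
    | succ k ih => intro hk; exact hB _ _ _ (ih (by omega)) (hold (k + 1) (by omega) (by omega)).1
  have hbwd : w (i + d) ∈ B 1 → ∀ k, k + 1 ≤ d → w (i + (d - k)) ∈ B (k + 1) := by
    intro h k
    induction k with
    | zero => intro _; exact h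
    | succ k ih =>
      intro hk
      refine hB _ _ _ (ih (by omega)) (hsymm _ _ ?_)
      have := (hold (d - (k + 1)) (by omega) (by omega)).1
      rwa [show i + (d - (k + 1)) + 1 = i + (d - k) by omega] at this
  have hgrp : (w (i + 1) = b ∨ w (i + 1) = p) ↔ (w (i + d) = b ∨ w (i + d) = p) := by
    constructor
    · intro h
      have h1 : w (i + 1) ∈ B 1 := by rcases h with h | h <;> rw [h] <;> assumption
      have h2 := hfwd h1 (d - 1) (by omega)
      rw [show d - 1 + 1 = d by omega] at h2
      rcases hdnew with h | h | h | h
      · exact Or.inl h.1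
      · rw [h.1] at h2; exact absurd h2 (hp'far d (by omega))
      · rw [h.1] at h2; exact absurd h2 (hb'far d (by omega))
      · exact Or.inr h.1
    · intro h
      have h1 : w (i + d) ∈ B 1 := by rcases h with h | h <;> rw [h] <;> assumption
      have h2 := hbwd h1 (d - 1) (by omega)
      rw [show d - 1 + 1 = d by omega, show d - (d - 1) = 1 by omega] at h2
      rcases hnew with h | h | h | h
      · rw [h.2] at h2; exact absurd h2 (hp'far d (by omega))
      · exact Or.inl h.2
      · exact Or.inr h.2
      · rw [h.2] at h2; exact absurd h2 (hb'far d (by omega))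
  -- the old walk between the two new edges closes up, by itself or with one of the removed edges,
  -- to a short closed walk of the old graph
  have hcase : (w (i + d) = w (i + 1) ∧ w (i + d + 1) = w i) ∨
      (w (i + d) ≠ w (i + 1) ∧ w (i + d) ≠ w i ∧ G (w (i + d)) (w (i + 1)) ∧
        ∀ u, Old u (w (i + d)) → u ≠ w (i + 1)) := by
    have hbp2 := hsymm _ _ hbp
    have hbp2' := hsymm _ _ hbp'
    rcases hnew with h | h | h | h <;> rcases hdnew with h' | h' | h' | h' <;>
      simp only [h.1, h.2, h'.1, h'.2] at hgrp ⊢ <;> grind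
  rcases hcase with ⟨h1, h2⟩ | ⟨h1, h2, h3, h4⟩
  · rcases Nat.eq_or_lt_of_le hd1 with hd | hd
    · subst hd
      exact hw.2.1 i h2.symm
    · refine hγ (fun k => w (i + 1 + k)) (d - 1) (by omega) (by omega) ?_ ?_ ?_
      · intro k hk
        have := (hold (k + 1) (by omega) (by omega)).1
        rwa [show i + (k + 1) = i + 1 + k by omega] at this
      · intro k _
        exact hw.2.1 _
      · rw [show i + 1 + (d - 1) = i + d by omega]
        exact h1.symm
  · have hd2 : 2 ≤ d := by
      by_contra hlt
      have : d = 1 := by omega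
      subst this
      exact h1 rfl
    have hdL' : d < γ := by
      refine lt_of_lt_of_le (lt_of_le_of_ne hdL ?_) hLγ
      rintro rfl
      exact h2 (hw.2.2 i)
    refine hγ (fun k => if k < d then w (i + 1 + k) else w (i + 1)) d (by omega) hdL' ?_ ?_ ?_
    · intro k hk
      simp only [hk, if_true]
      split_ifs with hk'
      · have := (hold (k + 1) (by omega) (by omega)).1
        rwa [show i + (k + 1) = i + 1 + k by omega] at this
      · rw [show i + 1 + k = i + d by omega]
        exact h3
    · intro k hk
      have hk2 : k < d := by omega
      simp only [hk2, if_true]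
      split_ifs with hk'
      · exact hw.2.1 _
      · have := hold (d - 1) (by omega) (by omega)
        rw [show i + (d - 1) + 1 = i + d by omega] at this
        rw [show i + 1 + k = i + (d - 1) by omega]
        exact h4 _ this
    · simp [show 0 < d by omega]

end Girth

/-! ### The structure of welded trees -/

namespace WeldedTrees

variable {n : ℕ}

/-- The depth of a node in its tree. -/
def depth (u : Vertex n) : ℕ := u.2.1

theorem depth_le (u : Vertex n) : depth u ≤ n := Nat.lt_succ_iff.1 u.2.1.2

theorem vertex_ext {u v : Vertex n} (h1 : u.1 = v.1) (h2 : depth u = depth v)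
    (h3 : (u.2.2 : ℕ) = v.2.2) : u = v := by
  obtain ⟨s, ⟨k, hk⟩, i⟩ := u
  obtain ⟨s', ⟨k', hk'⟩, i'⟩ := v
  simp only [depth] at h1 h2 h3
  subst h1
  subst h2
  have : i = i' := Fin.ext h3
  subst this
  rfl

/-- The node of index `i` at depth `k`. -/
def node (s : Bool) (k i : ℕ) (hk : k ≤ n) (hi : i < 2 ^ k) : Vertex n :=
  (s, ⟨⟨k, Nat.lt_succ_iff.2 hk⟩, ⟨i, hi⟩⟩)

theorem depth_root (s : Bool) : depth (root n s) = 0 := rfl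

theorem eq_root_of_depth {u : Vertex n} (h : depth u = 0) : u = root n u.1 := by
  refine vertex_ext rfl h ?_
  have h2 := u.2.2.2
  have h3 : (u.2.1 : ℕ) = 0 := h
  have h4 : 2 ^ (u.2.1 : ℕ) = 1 := by rw [h3, pow_zero]
  have : (u.2.2 : ℕ) = 0 := by omega
  rw [this]
  rfl

theorem eq_leaf_of_depth {u : Vertex n} (h : depth u = n) : ∃ i, u = leaf u.1 i := by
  have h3 : (u.2.1 : ℕ) = n := h
  have h4 : (u.2.2 : ℕ) < 2 ^ n := lt_of_lt_of_eq u.2.2.2 (by rw [h3])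
  exact ⟨⟨u.2.2, h4⟩, vertex_ext rfl h rfl⟩

theorem leaf_inj {s s' : Bool} {i i' : Fin (2 ^ n)} : leaf s i = leaf s' i' ↔ s = s' ∧ i = i' := by
  constructor
  · intro h
    exact ⟨congrArg Prod.fst h, Fin.ext (congrArg (fun u : Vertex n => (u.2.2 : ℕ)) h)⟩
  · rintro ⟨rfl, rfl⟩
    rfl

theorem root_inj {s s' : Bool} : root n s = root n s' ↔ s = s' :=
  ⟨fun h => congrArg Prod.fst h, fun h => h ▸ rfl⟩

theorem Child.depth_eq {u v : Vertex n} (h : Child u v) : depth v = depth u + 1 := h.2.1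

theorem Child.unique {u u' v : Vertex n} (h : Child u v) (h' : Child u' v) : u = u' := by
  refine vertex_ext (h.1.trans h'.1.symm) ?_ (h.2.2.symm.trans h'.2.2)
  have := h.depth_eq
  have := h'.depth_eq
  omega

theorem exists_parent {v : Vertex n} (h : depth v ≠ 0) : ∃ u, Child u v := by
  have h1 := depth_le v
  have h2 : (v.2.2 : ℕ) < 2 ^ depth v := v.2.2.2
  refine ⟨node v.1 (depth v - 1) (v.2.2 / 2) (by omega) ?_, rfl, ?_, rfl⟩
  · have : 2 ^ depth v = 2 * 2 ^ (depth v - 1) := by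
      rw [← pow_succ']
      congr 1
      omega
    omega
  · change depth v = depth v - 1 + 1
    omega

theorem exists_children {u : Vertex n} (h : depth u < n) :
    ∃ a b, a ≠ b ∧ ∀ v, Child u v ↔ v = a ∨ v = b := by
  have h2 : (u.2.2 : ℕ) < 2 ^ depth u := u.2.2.2
  have h3 : 2 ^ (depth u + 1) = 2 * 2 ^ depth u := pow_succ' _ _
  refine ⟨node u.1 (depth u + 1) (2 * u.2.2) h (by omega),
    node u.1 (depth u + 1) (2 * u.2.2 + 1) h (by omega), ?_, ?_⟩
  · intro h
    have : 2 * (u.2.2 : ℕ) = 2 * u.2.2 + 1 := congrArg (fun u : Vertex n => (u.2.2 : ℕ)) h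
    omega
  · intro v
    constructor
    · intro hv
      have h4 : (v.2.2 : ℕ) / 2 = u.2.2 := hv.2.2
      have : (v.2.2 : ℕ) = 2 * u.2.2 ∨ (v.2.2 : ℕ) = 2 * u.2.2 + 1 := by omega
      rcases this with h5 | h5
      · exact Or.inl (vertex_ext hv.1.symm hv.depth_eq h5)
      · exact Or.inr (vertex_ext hv.1.symm hv.depth_eq h5)
    · rintro (rfl | rfl)
      · exact ⟨rfl, rfl, by change 2 * (u.2.2 : ℕ) / 2 = u.2.2; omega⟩
      · exact ⟨rfl, rfl, by change (2 * (u.2.2 : ℕ) + 1) / 2 = u.2.2; omega⟩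

/-- The edges of the two trees, and an additional edge between the two roots. -/
def TreeAdj (u v : Vertex n) : Prop :=
  Child u v ∨ Child v u ∨ ∃ s, u = root n s ∧ v = root n (!s)

/-- The edges of the cycle through the leaves. -/
def WeldAdj (α β : Equiv.Perm (Fin (2 ^ n))) (u v : Vertex n) : Prop :=
  Weld α β u v ∨ Weld α β v u

/-- The welded trees with an additional edge between the two roots, which makes the graph
cubic. -/
def ClosedAdj (α β : Equiv.Perm (Fin (2 ^ n))) (u v : Vertex n) : Prop :=
  TreeAdj u v ∨ WeldAdj α β u v

theorem TreeAdj.symm {u v : Vertex n} (h : TreeAdj u v) : TreeAdj v u := by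
  rcases h with h | h | ⟨s, h, h'⟩
  · exact Or.inr (Or.inl h)
  · exact Or.inl h
  · exact Or.inr (Or.inr ⟨!s, h', by simpa using h⟩)

theorem TreeAdj.not_refl (v : Vertex n) : ¬ TreeAdj v v := by
  rintro (h | h | ⟨s, h, h'⟩)
  · have := h.depth_eq
    omega
  · have := h.depth_eq
    omega
  · rw [h, root_inj] at h'
    cases s <;> simp at h'

/-- Within the trees, a node has a single neighbour that is not deeper. -/
theorem TreeAdj.unique {u v v' : Vertex n} (h : TreeAdj u v) (h' : TreeAdj u v')
    (hv : depth v ≤ depth u) (hv' : depth v' ≤ depth u) : v = v' := by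
  have hr : ∀ s, depth (root n s) = 0 := fun s => rfl
  rcases h with h | h | ⟨s, rfl, rfl⟩
  · have := h.depth_eq
    omega
  · rcases h' with h' | h' | ⟨s, rfl, rfl⟩
    · have := h'.depth_eq
      omega
    · exact h.unique h'
    · have := h.depth_eq
      have := hr s
      omega
  · rcases h' with h' | h' | ⟨s', h1, rfl⟩
    · have := h'.depth_eq
      omega
    · have := h'.depth_eq
      have := hr s
      omega
    · rw [root_inj] at h1
      rw [h1]

theorem WeldAdj.symm {α β : Equiv.Perm (Fin (2 ^ n))} {u v : Vertex n} (h : WeldAdj α β u v) :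
    WeldAdj α β v u := Or.symm h

theorem Weld.leaves {α β : Equiv.Perm (Fin (2 ^ n))} {u v : Vertex n} (h : Weld α β u v) :
    depth u = n ∧ depth v = n ∧ u.1 = false ∧ v.1 = true := by
  obtain ⟨i, h1 | h1, h2⟩ := h <;> subst h1 <;> subst h2 <;> exact ⟨rfl, rfl, rfl, rfl⟩

theorem WeldAdj.depth_left {α β : Equiv.Perm (Fin (2 ^ n))} {u v : Vertex n}
    (h : WeldAdj α β u v) : depth u = n := by
  rcases h with h | h
  · exact h.leaves.1
  · exact h.leaves.2.1

theorem WeldAdj.side_ne {α β : Equiv.Perm (Fin (2 ^ n))} {u v : Vertex n}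
    (h : WeldAdj α β u v) : u.1 ≠ v.1 := by
  rcases h with h | h <;> simp [h.leaves.2.2.1, h.leaves.2.2.2]

theorem ClosedAdj.symm {α β : Equiv.Perm (Fin (2 ^ n))} {u v : Vertex n}
    (h : ClosedAdj α β u v) : ClosedAdj α β v u :=
  h.imp TreeAdj.symm WeldAdj.symm

theorem ClosedAdj.not_refl (α β : Equiv.Perm (Fin (2 ^ n))) (v : Vertex n) :
    ¬ ClosedAdj α β v v := by
  rintro (h | h)
  · exact TreeAdj.not_refl v h
  · exact h.side_ne rfl

theorem weldAdj_left_iff (α β : Equiv.Perm (Fin (2 ^ n))) (i : Fin (2 ^ n)) (v : Vertex n) :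
    WeldAdj α β (leaf false (α i)) v ↔ v = leaf true (β i) ∨ v = leaf true (β (i - 1)) := by
  constructor
  · rintro (⟨j, h | h, rfl⟩ | ⟨j, _, h⟩)
    · rw [leaf_inj] at h
      rw [α.injective h.2]
      exact Or.inl rfl
    · rw [leaf_inj] at h
      rw [α.injective h.2]
      simp
    · simp [leaf_inj] at h
  · rintro (rfl | rfl)
    · exact Or.inl ⟨i, Or.inl rfl, rfl⟩
    · exact Or.inl ⟨i - 1, Or.inr (by simp), rfl⟩

theorem weldAdj_right_iff (α β : Equiv.Perm (Fin (2 ^ n))) (i : Fin (2 ^ n)) (v : Vertex n) :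
    WeldAdj α β (leaf true (β i)) v ↔ v = leaf false (α i) ∨ v = leaf false (α (i + 1)) := by
  constructor
  · rintro (⟨j, h | h, _⟩ | ⟨j, h', h⟩)
    · simp [leaf_inj] at h
    · simp [leaf_inj] at h
    · rw [leaf_inj] at h
      rw [β.injective h.2]
      exact h'
  · intro h
    exact Or.inr ⟨i, h, rfl⟩

theorem one_ne_zero_fin (hn : 1 ≤ n) : (1 : Fin (2 ^ n)) ≠ 0 := by
  have h2 : 1 < 2 ^ n := Nat.one_lt_two_pow (by omega)
  intro h
  have := congrArg Fin.val h
  rw [Fin.val_one', Nat.mod_eq_of_lt h2] at this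
  simp at this

/-- The closed-up welded trees are cubic. -/
theorem exists_neighbours (hn : 1 ≤ n) (α β : Equiv.Perm (Fin (2 ^ n))) (u : Vertex n) :
    ∃ a b c, a ≠ b ∧ a ≠ c ∧ b ≠ c ∧ (∀ v, ClosedAdj α β u v ↔ v = a ∨ v = b ∨ v = c) ∧
      (∀ s, u = root n s → c = root n (!s)) := by
  rcases Nat.eq_or_lt_of_le (depth_le u) with hu | hu
  · obtain ⟨p, hp⟩ := exists_parent (v := u) (by omega)
    have hpd := hp.depth_eq
    have htree : ∀ v, TreeAdj u v ↔ v = p := by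
      intro v
      constructor
      · intro h
        exact h.unique (Or.inr (Or.inl hp)) (by have := depth_le v; omega) (by omega)
      · rintro rfl
        exact Or.inr (Or.inl hp)
    have hroot : ∀ s, u ≠ root n s := by
      rintro s rfl
      rw [depth_root] at hu
      omega
    obtain ⟨a, b, hab, hda, hdb, hw⟩ : ∃ a b, a ≠ b ∧ depth a = n ∧ depth b = n ∧
        ∀ v, WeldAdj α β u v ↔ v = a ∨ v = b := by
      obtain ⟨i, hi⟩ := eq_leaf_of_depth hu
      cases hs : u.1
      · rw [hs] at hi
        refine ⟨leaf true (β (α.symm i)), leaf true (β (α.symm i - 1)), ?_, rfl, rfl, ?_⟩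
        · rw [Ne, leaf_inj]
          rintro ⟨-, h⟩
          exact one_ne_zero_fin hn (sub_eq_self.1 (β.injective h).symm)
        · intro v
          have h := weldAdj_left_iff α β (α.symm i) v
          rw [Equiv.apply_symm_apply, ← hi] at h
          exact h
      · rw [hs] at hi
        refine ⟨leaf false (α (β.symm i)), leaf false (α (β.symm i + 1)), ?_, rfl, rfl, ?_⟩
        · rw [Ne, leaf_inj]
          rintro ⟨-, h⟩
          exact one_ne_zero_fin hn (left_eq_add.1 (α.injective h))
        · intro v
          have h := weldAdj_right_iff α β (β.symm i) v
          rw [Equiv.apply_symm_apply, ← hi] at h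
          exact h
    refine ⟨a, b, p, hab, ?_, ?_, ?_, fun s hs => absurd hs (hroot s)⟩
    · rintro rfl
      omega
    · rintro rfl
      omega
    · intro v
      rw [ClosedAdj, htree, hw]
      tauto
  · obtain ⟨a, b, hab, hc⟩ := exists_children hu
    have hda : depth a = depth u + 1 := ((hc a).2 (Or.inl rfl)).depth_eq
    have hdb : depth b = depth u + 1 := ((hc b).2 (Or.inr rfl)).depth_eq
    have hweld : ∀ v, ¬ WeldAdj α β u v := fun v h => by
      have := h.depth_left
      omega
    obtain ⟨p, hpt, hpd, hpr⟩ : ∃ p, TreeAdj u p ∧ depth p ≤ depth u ∧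
        (∀ s, u = root n s → p = root n (!s)) := by
      by_cases h0 : depth u = 0
      · obtain h1 := eq_root_of_depth h0
        refine ⟨root n (!u.1), Or.inr (Or.inr ⟨u.1, h1, rfl⟩), Nat.zero_le _, ?_⟩
        rintro s rfl
        rfl
      · obtain ⟨p, hp⟩ := exists_parent h0
        refine ⟨p, Or.inr (Or.inl hp), by have := hp.depth_eq; omega, ?_⟩
        rintro s rfl
        exact absurd (depth_root s) h0
    refine ⟨a, b, p, hab, ?_, ?_, ?_, hpr⟩
    · rintro rfl
      omega
    · rintro rfl
      omega
    · intro v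
      constructor
      · rintro (h | h)
        · by_cases hv : depth v ≤ depth u
          · exact Or.inr (Or.inr (h.unique hpt hv hpd))
          · rcases h with h | h | ⟨s, rfl, rfl⟩
            · rcases (hc v).1 h with h | h
              · exact Or.inl h
              · exact Or.inr (Or.inl h)
            · have := h.depth_eq
              omega
            · exact absurd (Nat.zero_le _) hv
        · exact absurd h (hweld v)
      · rintro (rfl | rfl | rfl)
        · exact Or.inl (Or.inl ((hc _).2 (Or.inl rfl)))
        · exact Or.inl (Or.inl ((hc _).2 (Or.inr rfl)))
        · exact Or.inl hpt

theorem graph_adj_iff (hn : 1 ≤ n) (α β : Equiv.Perm (Fin (2 ^ n))) (u v : Vertex n) :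
    (graph α β).Adj u v ↔ ClosedAdj α β u v ∧ ¬ ∃ s, u = root n s ∧ v = root n (!s) := by
  have hne : ClosedAdj α β u v → u ≠ v := by
    rintro h rfl
    exact ClosedAdj.not_refl α β u h
  have key : (Child u v ∨ Weld α β u v) ∨ (Child v u ∨ Weld α β v u) →
      ¬ ∃ s, u = root n s ∧ v = root n (!s) := by
    rintro h ⟨s, rfl, rfl⟩
    have h1 := depth_root (n := n) s
    have h2 := depth_root (n := n) (!s)
    rcases h with (h | h) | (h | h)
    · have := h.depth_eq
      omega
    · have := h.leaves.1
      omega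
    · have := h.depth_eq
      omega
    · have := h.leaves.1
      omega
  rw [graph, SimpleGraph.fromRel_adj]
  constructor
  · rintro ⟨-, h⟩
    refine ⟨?_, key h⟩
    rcases h with (h | h) | (h | h)
    · exact Or.inl (Or.inl h)
    · exact Or.inr (Or.inl h)
    · exact Or.inl (Or.inr (Or.inl h))
    · exact Or.inr (Or.inr h)
  · rintro ⟨h, h'⟩
    refine ⟨hne h, ?_⟩
    rcases h with (h | h | h) | (h | h)
    · exact Or.inl (Or.inl h)
    · exact Or.inr (Or.inl h)
    · exact absurd h h'
    · exact Or.inl (Or.inr h)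
    · exact Or.inr (Or.inr h)

open scoped Fin.CommRing Fin.NatCast in
/-- The weld cycle is long, and there are no cycles within the trees: every shorter closed
non-backtracking walk uses an edge between a leaf and its parent. -/
theorem exists_leaf_edge {α β : Equiv.Perm (Fin (2 ^ n))} {L : ℕ} {w : ℕ → Vertex n}
    (hL : 0 < L) (hLn : L < 2 ^ n) (hw : IsCyclicWalk (ClosedAdj α β) L w) :
    ∃ i, (depth (w i) = n ∧ Child (w (i + 1)) (w i)) ∨
      (depth (w (i + 1)) = n ∧ Child (w i) (w (i + 1))) := by
  by_contra hcon
  push Not at hcon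
  have hn : 1 ≤ n := by
    by_contra h
    have : n = 0 := by omega
    subst this
    simp at hLn
    omega
  have hstep : ∀ i, (depth (w i) = n → WeldAdj α β (w i) (w (i + 1))) ∧
      (depth (w i) < n → TreeAdj (w i) (w (i + 1)) ∧ depth (w (i + 1)) < n) := by
    intro i
    have h1 := hcon i
    constructor
    · intro hd
      rcases hw.1 i with (h | h | ⟨s, h, h'⟩) | h
      · have := h.depth_eq
        have := depth_le (w (i + 1))
        omega
      · exact absurd h (h1.1 hd)
      · rw [h, depth_root] at hd
        omega
      · exact h
    · intro hd
      rcases hw.1 i with h | h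
      · refine ⟨h, lt_of_le_of_ne (depth_le _) fun h2 => ?_⟩
        rcases h with h | h | ⟨s, h, h'⟩
        · exact h1.2 h2 h
        · have := h.depth_eq
          omega
        · rw [h', depth_root] at h2
          omega
      · have := h.depth_left
        omega
  rcases Nat.eq_or_lt_of_le (depth_le (w 0)) with h0 | h0
  · -- the walk stays on the weld cycle, and runs around it in one direction
    have hweld : ∀ i, WeldAdj α β (w i) (w (i + 1)) := by
      have : ∀ i, depth (w i) = n := by
        intro i
        induction i with
        | zero => exact h0
        | succ i ih => exact ((hstep i).1 ih).symm.depth_left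
      exact fun i => (hstep i).1 (this i)
    obtain ⟨k₀, hk₀⟩ : ∃ k₀ ≤ 1, (w k₀).1 = false := by
      cases h : (w 0).1
      · exact ⟨0, by omega, h⟩
      · refine ⟨1, le_rfl, ?_⟩
        have := (hweld 0).side_ne
        rw [h] at this
        simpa using this
    set w' : ℕ → Vertex n := fun i => w (k₀ + i) with hw'
    have hweld' : ∀ i, WeldAdj α β (w' i) (w' (i + 1)) := fun i => hweld (k₀ + i)
    have hnb' : ∀ i, w' (i + 2) ≠ w' i := fun i => (hw.2.1 (k₀ + i)).symm
    have hper' : w' L = w' 0 := by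
      have := hw.2.2 k₀
      simpa [hw'] using this
    obtain ⟨i₀, hi₀⟩ : ∃ i, w' 0 = leaf false (α i) := by
      obtain ⟨i, hi⟩ := eq_leaf_of_depth (hweld' 0).depth_left
      refine ⟨α.symm i, ?_⟩
      rw [hi]
      have : (w' 0).1 = false := hk₀.2
      simp [this]
    have hfin : ∀ k : ℕ, 0 < k → k < 2 ^ n → (k : Fin (2 ^ n)) ≠ 0 := by
      intro k hk hk2 h
      rw [Fin.natCast_eq_zero] at h
      exact absurd (Nat.le_of_dvd hk h) (by omega)
    have hclose : ∀ e : Fin (2 ^ n), (e = 1 ∨ e = -1) →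
        (∀ k : ℕ, w' (2 * k) = leaf false (α (i₀ + k * e)) ∧ ∃ j, w' (2 * k + 1) = leaf true j) →
        False := by
      intro e he h
      rcases Nat.even_or_odd' L with ⟨k, rfl | rfl⟩
      · have h1 := (h k).1
        rw [hper', hi₀, leaf_inj] at h1
        have h2 := α.injective h1.2
        have h3 : (k : Fin (2 ^ n)) * e = 0 := by
          have := congrArg (fun x => x - i₀) h2
          simpa using this.symm
        have h4 : (k : Fin (2 ^ n)) = 0 := by
          rcases he with rfl | rfl
          · simpa using h3
          · simpa using h3
        exact hfin k (by omega) (by omega) h4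
      · obtain ⟨j, hj⟩ := (h k).2
        rw [hper', hi₀, leaf_inj] at hj
        simp at hj
    rcases (weldAdj_left_iff α β i₀ _).1 (hi₀ ▸ hweld' 0) with h1 | h1
    · refine hclose 1 (Or.inl rfl) fun k => ?_
      suffices h : w' (2 * k) = leaf false (α (i₀ + k * 1)) ∧
          w' (2 * k + 1) = leaf true (β (i₀ + k * 1)) from ⟨h.1, _, h.2⟩
      induction k with
      | zero => simpa using ⟨hi₀, h1⟩
      | succ k ih =>
        have h2 : w' (2 * (k + 1)) = leaf false (α (i₀ + (k + 1 : ℕ) * 1)) := by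
          have h3 := hweld' (2 * k + 1)
          rw [ih.2, weldAdj_right_iff] at h3
          rcases h3 with h3 | h3
          · exact absurd (h3.trans ih.1.symm) (hnb' (2 * k))
          · rw [show 2 * (k + 1) = 2 * k + 1 + 1 by ring, h3]
            congr 2
            push_cast
            ring
        refine ⟨h2, ?_⟩
        have h3 := hweld' (2 * (k + 1))
        rw [h2, weldAdj_left_iff] at h3
        rcases h3 with h3 | h3
        · exact h3
        · refine absurd (h3.trans ?_) (hnb' (2 * k + 1))
          rw [ih.2]
          congr 2
          push_cast
          ring
    · refine hclose (-1) (Or.inr rfl) fun k => ?_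
      suffices h : w' (2 * k) = leaf false (α (i₀ + k * (-1))) ∧
          w' (2 * k + 1) = leaf true (β (i₀ + k * (-1) - 1)) from ⟨h.1, _, h.2⟩
      induction k with
      | zero => simpa using ⟨hi₀, h1⟩
      | succ k ih =>
        have h2 : w' (2 * (k + 1)) = leaf false (α (i₀ + (k + 1 : ℕ) * (-1))) := by
          have h3 := hweld' (2 * k + 1)
          rw [ih.2, weldAdj_right_iff] at h3
          rcases h3 with h3 | h3
          · rw [show 2 * (k + 1) = 2 * k + 1 + 1 by ring, h3]
            congr 2
            push_cast
            ring
          · rw [sub_add_cancel] at h3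
            exact absurd (h3.trans ih.1.symm) (hnb' (2 * k))
        refine ⟨h2, ?_⟩
        have h3 := hweld' (2 * (k + 1))
        rw [h2, weldAdj_left_iff] at h3
        rcases h3 with h3 | h3
        · refine absurd (h3.trans ?_) (hnb' (2 * k + 1))
          rw [ih.2]
          congr 2
          push_cast
          ring
        · exact h3
  · -- the walk stays within the trees, and backtracks where it is deepest
    have htree : ∀ i, TreeAdj (w i) (w (i + 1)) := by
      have : ∀ i, depth (w i) < n := by
        intro i
        induction i with
        | zero => exact h0
        | succ i ih => exact ((hstep i).2 ih).2
      exact fun i => ((hstep i).2 (this i)).1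
    obtain ⟨i, hi⟩ : ∃ i, ∀ j, depth (w j) ≤ depth (w i) := by
      have hfin : (Set.range fun j => depth (w j)).Finite :=
        (Set.finite_Iic n).subset (by rintro _ ⟨j, rfl⟩; exact depth_le _)
      obtain ⟨_, ⟨i, rfl⟩, hi⟩ := hfin.exists_maximal ⟨_, 0, rfl⟩
      refine ⟨i, fun j => ?_⟩
      by_contra hlt
      exact hlt (hi ⟨j, rfl⟩ (by simp only; omega))
    have h1 : w (i + L - 1 + 1) = w i := by
      rw [show i + L - 1 + 1 = i + L by omega]
      exact hw.2.2 i
    have h2 := htree (i + L - 1)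
    rw [h1] at h2
    have h3 : w (i + L - 1 + 2) = w (i + 1) := by
      rw [show i + L - 1 + 2 = i + 1 + L by omega]
      exact hw.2.2 (i + 1)
    refine hw.2.1 (i + L - 1) ?_
    rw [h3]
    exact h2.symm.unique (htree i) (hi _) (hi _)

end WeldedTrees

/-! ### Welded trees of large girth -/

theorem finite_isCyclicWalk {V : Type*} [Finite V] (G : V → V → Prop) {L : ℕ} (hL : 0 < L) :
    {w | IsCyclicWalk G L w}.Finite := by
  refine Set.Finite.of_injOn (f := fun (w : ℕ → V) (i : Fin L) => w i) (t := Set.univ)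
    (fun _ _ => trivial) ?_ Set.finite_univ
  intro w hw w' hw' h
  have hper : ∀ v : ℕ → V, IsCyclicWalk G L v → ∀ i, v i = v (i % L) := by
    intro v hv i
    induction i using Nat.strong_induction_on with
    | _ i ih =>
      rcases Nat.lt_or_ge i L with h | h
      · rw [Nat.mod_eq_of_lt h]
      · rw [← Nat.mod_eq_sub_mod h |>.symm, ← ih (i - L) (by omega), ← hv.2.2 (i - L),
          Nat.sub_add_cancel h]
  funext i
  rw [hper w hw i, hper w' hw' i]
  exact congrFun h ⟨i % L, Nat.mod_lt i hL⟩

namespace WeldedTrees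

variable {n : ℕ}

open Classical in
/-- The nodes at distance at most `k` from `b` in the closed-up welded trees. -/
noncomputable def ball (α β : Equiv.Perm (Fin (2 ^ n))) (b : Vertex n) : ℕ → Finset (Vertex n)
  | 0 => {b}
  | k + 1 => ball α β b k ∪
      (ball α β b k).biUnion fun u => Finset.univ.filter fun v => ClosedAdj α β u v

theorem ball_mono (α β : Equiv.Perm (Fin (2 ^ n))) (b : Vertex n) : Monotone (ball α β b) :=
  monotone_nat_of_le_succ fun _ => Finset.subset_union_left

theorem mem_ball_succ {α β : Equiv.Perm (Fin (2 ^ n))} {b u v : Vertex n} {k : ℕ}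
    (hu : u ∈ ball α β b k) (h : ClosedAdj α β u v) : v ∈ ball α β b (k + 1) := by
  classical
  refine Finset.mem_union_right _ (Finset.mem_biUnion.2 ⟨u, hu, ?_⟩)
  simpa using h

theorem card_ball_le (hn : 1 ≤ n) (α β : Equiv.Perm (Fin (2 ^ n))) (b : Vertex n) (k : ℕ) :
    (ball α β b k).card ≤ 4 ^ k := by
  classical
  induction k with
  | zero => simp [ball]
  | succ k ih =>
    have h3 : ∀ u ∈ ball α β b k, (Finset.univ.filter fun v => ClosedAdj α β u v).card ≤ 3 := by
      intro u _
      obtain ⟨a, b, c, -, -, -, h, -⟩ := exists_neighbours hn α β u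
      calc _ ≤ ({a, b, c} : Finset (Vertex n)).card := by
            refine Finset.card_le_card fun v hv => ?_
            simpa [h] using hv
        _ ≤ 3 := Finset.card_le_three
    calc _ ≤ (ball α β b k).card +
          ((ball α β b k).biUnion fun u => Finset.univ.filter fun v => ClosedAdj α β u v).card :=
          Finset.card_union_le _ _
      _ ≤ (ball α β b k).card + (ball α β b k).card * 3 :=
          Nat.add_le_add_left (Finset.card_biUnion_le_card_mul _ _ _ h3) _
      _ ≤ 4 ^ (k + 1) := by
          rw [pow_succ]
          omega

theorem exists_leaf_notMem_ball (α β : Equiv.Perm (Fin (2 ^ n))) (s : Bool) (b : Vertex n)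
    {k : ℕ} (hk : 2 * k < n) : ∃ i, leaf s i ∉ ball α β b k := by
  by_contra hcon
  push Not at hcon
  have h1 : (Finset.univ.image (leaf s : Fin (2 ^ n) → Vertex n)).card = 2 ^ n := by
    rw [Finset.card_image_of_injective _ fun i j h => (leaf_inj.1 h).2]
    simp
  have h2 : Finset.univ.image (leaf s : Fin (2 ^ n) → Vertex n) ⊆ ball α β b k := by
    intro v hv
    obtain ⟨i, -, rfl⟩ := Finset.mem_image.1 hv
    exact hcon i
  have h3 := (Finset.card_le_card h2).trans (card_ball_le (by omega) α β b k)
  rw [h1, show 4 = 2 ^ 2 by rfl, ← pow_mul] at h3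
  exact absurd ((Nat.pow_le_pow_iff_right (by norm_num)).1 h3) (by omega)

/-- Two leaves of the same tree exchange their places on the weld cycle. -/
theorem exists_exchange (α β : Equiv.Perm (Fin (2 ^ n))) (s : Bool) (i i' : Fin (2 ^ n)) :
    ∃ α' β' : Equiv.Perm (Fin (2 ^ n)), ∀ u v, WeldAdj α' β' u v ↔
      WeldAdj α β (Equiv.swap (leaf s i) (leaf s i') u) (Equiv.swap (leaf s i) (leaf s i') v) := by
  set τ := Equiv.swap (leaf s i) (leaf s i') with hτ
  have hττ : ∀ u, τ (τ u) = u := Equiv.swap_apply_self _ _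
  have hsame : ∀ j, τ (leaf s j) = leaf s (Equiv.swap i i' j) := by
    intro j
    simp only [hτ, Equiv.swap_apply_def, leaf_inj, true_and]
    split_ifs <;> rfl
  have hother : ∀ s' j, s' ≠ s → τ (leaf s' j) = leaf s' j := by
    intro s' j h
    refine Equiv.swap_apply_of_ne_of_ne ?_ ?_ <;> simp [leaf_inj, h]
  have hinv : ∀ u v, τ u = v ↔ u = τ v := fun u v =>
    ⟨fun h => by rw [← h, hττ], fun h => by rw [h, hττ]⟩
  cases s
  · refine ⟨α.trans (Equiv.swap i i'), β, ?_⟩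
    have : ∀ u v, Weld (α.trans (Equiv.swap i i')) β u v ↔ Weld α β (τ u) (τ v) := by
      intro u v
      simp only [Weld, hinv, hsame, hother true _ (by simp), Equiv.trans_apply]
    intro u v
    simp only [WeldAdj, this]
  · refine ⟨α, β.trans (Equiv.swap i i'), ?_⟩
    have : ∀ u v, Weld α (β.trans (Equiv.swap i i')) u v ↔ Weld α β (τ u) (τ v) := by
      intro u v
      simp only [Weld, hinv, hsame, hother false _ (by simp), Equiv.trans_apply]
    intro u v
    simp only [WeldAdj, this]

theorem Child.treeAdj {u v : Vertex n} (h : Child u v) : TreeAdj v u := Or.inr (Or.inl h)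

/-- A closed non-backtracking walk of length `γ` can be destroyed without creating others of
length at most `γ`. -/
theorem exists_fewer_isCyclicWalk {α β : Equiv.Perm (Fin (2 ^ n))} {γ : ℕ} (hγ : 0 < γ)
    (hγn : 2 * (γ + 2) < n) (hg : GirthAtLeast (ClosedAdj α β) γ) {w₀ : ℕ → Vertex n}
    (hw₀ : IsCyclicWalk (ClosedAdj α β) γ w₀) :
    ∃ α' β' : Equiv.Perm (Fin (2 ^ n)), GirthAtLeast (ClosedAdj α' β') γ ∧
      {w | IsCyclicWalk (ClosedAdj α' β') γ w}.ncard <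
        {w | IsCyclicWalk (ClosedAdj α β) γ w}.ncard := by
  have hlt : γ < 2 ^ n := lt_of_lt_of_le (by omega) Nat.lt_two_pow_self.le
  obtain ⟨b, p, hb, hp, i₀, hi₀⟩ : ∃ b p, depth b = n ∧ Child p b ∧
      ∃ i, (w₀ i = b ∧ w₀ (i + 1) = p) ∨ (w₀ i = p ∧ w₀ (i + 1) = b) := by
    obtain ⟨i, ⟨h1, h2⟩ | ⟨h1, h2⟩⟩ := exists_leaf_edge hγ hlt hw₀
    · exact ⟨_, _, h1, h2, i, Or.inl ⟨rfl, rfl⟩⟩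
    · exact ⟨_, _, h1, h2, i, Or.inr ⟨rfl, rfl⟩⟩
  obtain ⟨ib, hib⟩ := eq_leaf_of_depth hb
  set s := b.1 with hs
  obtain ⟨ib', hfar⟩ := exists_leaf_notMem_ball α β s b hγn
  set b' : Vertex n := leaf s ib' with hb'
  have hbd' : depth b' = n := rfl
  obtain ⟨p', hp'⟩ := exists_parent (v := b') (by omega)
  obtain ⟨α', β', hweld⟩ := exists_exchange α β s ib ib'
  rw [← hib, ← hb'] at hweld
  set τ := Equiv.swap b b' with hτ
  have hττ : ∀ u, τ (τ u) = u := Equiv.swap_apply_self _ _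
  have hpd := hp.depth_eq
  have hpd' := hp'.depth_eq
  have htree : ∀ u v q : Vertex n, depth u = n → Child q u → (TreeAdj u v ↔ v = q) := by
    intro u v q hu hq
    have := hq.depth_eq
    constructor
    · intro h
      exact h.unique hq.treeAdj (by have := depth_le v; omega) (by omega)
    · rintro rfl
      exact hq.treeAdj
  have hτn : ∀ u : Vertex n, depth u < n → τ u = u := by
    intro u hu
    refine Equiv.swap_apply_of_ne_of_ne ?_ ?_ <;> rintro rfl <;> omega
  have hτp := hτn p (by omega)
  have hτp' := hτn p' (by omega)
  have hinv : ∀ u v, τ u = v ↔ u = τ v := fun u v =>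
    ⟨fun h => by rw [← h, hττ], fun h => by rw [h, hττ]⟩
  -- the new graph after the leaves `b` and `b'` have been renamed; in this form it differs from the
  -- old one in the edges from these leaves to their parents only
  set G' : Vertex n → Vertex n → Prop := fun u v => ClosedAdj α' β' (τ u) (τ v) with hG'
  have hshape : ∀ u v, G' u v →
      (ClosedAdj α β u v ∧ ¬ (u = b ∧ v = p) ∧ ¬ (u = p ∧ v = b) ∧ ¬ (u = b' ∧ v = p') ∧
        ¬ (u = p' ∧ v = b')) ∨
      ((u = b ∧ v = p') ∨ (u = p' ∧ v = b) ∨ (u = b' ∧ v = p) ∨ (u = p ∧ v = b')) := by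
    rintro u v (h | h)
    · by_cases hu : u = b
      · subst hu
        rw [hτ, Equiv.swap_apply_left, ← hτ, htree b' _ p' rfl hp', hinv, hτp'] at h
        exact Or.inr (Or.inl ⟨rfl, h⟩)
      by_cases hu' : u = b'
      · subst hu'
        rw [hτ, Equiv.swap_apply_right, ← hτ, htree b _ p hb hp, hinv, hτp] at h
        exact Or.inr (Or.inr (Or.inr (Or.inl ⟨rfl, h⟩)))
      have hτu : τ u = u := Equiv.swap_apply_of_ne_of_ne hu hu'
      by_cases hv : v = b
      · subst hv
        replace h := h.symm
        rw [hτ, Equiv.swap_apply_left, ← hτ, htree b' _ p' rfl hp', hinv, hτp'] at h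
        exact Or.inr (Or.inr (Or.inl ⟨h, rfl⟩))
      by_cases hv' : v = b'
      · subst hv'
        replace h := h.symm
        rw [hτ, Equiv.swap_apply_right, ← hτ, htree b _ p hb hp, hinv, hτp] at h
        exact Or.inr (Or.inr (Or.inr (Or.inr ⟨h, rfl⟩)))
      have hτv : τ v = v := Equiv.swap_apply_of_ne_of_ne hv hv'
      rw [hτu, hτv] at h
      exact Or.inl ⟨Or.inl h, fun h => hu h.1, fun h => hv h.2, fun h => hu' h.1,
        fun h => hv' h.2⟩
    · rw [hweld, hττ, hττ] at h
      have h1 := h.depth_left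
      have h2 := h.symm.depth_left
      refine Or.inl ⟨Or.inr h, ?_, ?_, ?_, ?_⟩ <;> rintro ⟨rfl, rfl⟩ <;> omega
  have key : ∀ L w, 0 < L → L ≤ γ → IsCyclicWalk G' L w →
      IsCyclicWalk (ClosedAdj α β) L w ∧
        ∀ i, ¬ (w i = b ∧ w (i + 1) = p) ∧ ¬ (w i = p ∧ w (i + 1) = b) := by
    intro L w hL hLγ hw
    have h := IsCyclicWalk.old_of_exchange (fun u v h => h.symm) (ClosedAdj.not_refl α β)
      (Or.inl hp.treeAdj) (Or.inl hp'.treeAdj) hshape hg (fun k => (ball α β b k : Set (Vertex n)))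
      (by simp [ball]) (fun k l hkl => Finset.coe_subset.2 (ball_mono α β b hkl))
      (fun k u v hu h => mem_ball_succ hu h) hfar hL hLγ hw
    exact ⟨⟨fun i => (h i).1, hw.2.1, hw.2.2⟩, fun i => (h i).2⟩
  have hmap : ∀ L w, IsCyclicWalk (ClosedAdj α' β') L w → IsCyclicWalk G' L (fun i => τ (w i)) := by
    intro L w hw
    refine ⟨fun i => ?_, fun i h => hw.2.1 i (τ.injective h), fun i => congrArg τ (hw.2.2 i)⟩
    simp only [hG', hττ]
    exact hw.1 i
  refine ⟨α', β', ?_, ?_⟩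
  · refine girthAtLeast_of_forall_not_isCyclicWalk (ClosedAdj.not_refl α' β') ?_
    intro L w hL hLγ hw
    have h := (key L _ hL hLγ.le (hmap L w hw)).1
    refine hg _ L hL hLγ (fun i _ => h.1 i) (fun i _ => h.2.1 i) ?_
    simpa using (h.2.2 0).symm
  · have hfin := finite_isCyclicWalk (ClosedAdj α β) hγ
    calc _ = ((fun (w : ℕ → Vertex n) i => τ (w i)) ''
          {w | IsCyclicWalk (ClosedAdj α' β') γ w}).ncard := by
          refine (Set.ncard_image_of_injective _ fun w w' h => ?_).symm
          funext i
          exact τ.injective (congrFun h i)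
      _ < _ := by
          refine Set.ncard_lt_ncard ⟨?_, ?_⟩ hfin
          · rintro _ ⟨w, hw, rfl⟩
            exact (key γ _ hγ le_rfl (hmap γ w hw)).1
          · intro hsub
            obtain ⟨w, hw, rfl⟩ := hsub hw₀
            have := (key γ _ hγ le_rfl (hmap γ w hw)).2 i₀
            exact hi₀.elim this.1 this.2

/-- There are welded trees whose girth is a constant fraction of their height. -/
theorem exists_girthAtLeast {g : ℕ} (hg : g = 0 ∨ 2 * (g + 2) < n + 2) :
    ∃ α β : Equiv.Perm (Fin (2 ^ n)), GirthAtLeast (ClosedAdj α β) g := by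
  induction g with
  | zero => exact ⟨1, 1, fun w L _ h => absurd h (Nat.not_lt_zero _)⟩
  | succ γ ih =>
    rcases Nat.eq_zero_or_pos γ with rfl | hγ
    · exact ⟨1, 1, fun w L h h' => by omega⟩
    obtain ⟨α₀, β₀, h₀⟩ := ih (Or.inr (by omega))
    -- among the welds of girth at least `γ`, one with the fewest closed walks of length `γ`
    let T : Set (Equiv.Perm (Fin (2 ^ n)) × Equiv.Perm (Fin (2 ^ n))) :=
      {x | GirthAtLeast (ClosedAdj x.1 x.2) γ}
    obtain ⟨⟨α, β⟩, hT, hmin⟩ := Set.exists_min_image T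
      (fun x => {w | IsCyclicWalk (ClosedAdj x.1 x.2) γ w}.ncard) (Set.toFinite T) ⟨(α₀, β₀), h₀⟩
    refine ⟨α, β, girthAtLeast_of_forall_not_isCyclicWalk (ClosedAdj.not_refl α β) ?_⟩
    intro L w hL hLγ hw
    rcases Nat.lt_or_ge L γ with h | h
    · refine hT w L hL h (fun i _ => hw.1 i) (fun i _ => hw.2.1 i) ?_
      simpa using (hw.2.2 0).symm
    · obtain rfl : L = γ := by omega
      obtain ⟨α', β', h1, h2⟩ := exists_fewer_isCyclicWalk hL (by omega) hT hw
      exact absurd (hmin (α', β') h1) (by simpa using h2)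

end WeldedTrees

/-! ### Synchronous runs on cubic graphs -/

/-- A cubic graph with port numbers: `nbr v i` is the neighbour of `v` behind port `i`, and
`back v i` is the port of this neighbour that leads back to `v`. -/
structure Rotation (V : Type*) where
  nbr : V → Fin 3 → V
  back : V → Fin 3 → Fin 3
  nbr_back : ∀ v i, nbr (nbr v i) (back v i) = v
  back_back : ∀ v i, back (nbr v i) (back v i) = i

/-- The messages that a node sends, or receives, through its three ports in one round. -/
abbrev Row : Type := Fin 3 → Msg

/-- No messages. -/
def silence : Row := fun _ => []

namespace Rotation

variable {V X : Type*}

/-- The rows received by each node in the first `k` rounds, latest first, if node `v` sends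
`f v h` after having received the rows `h`. -/
def history (R : Rotation V) (f : V → List Row → Row) : ℕ → V → List Row
  | 0, _ => []
  | k + 1, v => (fun j => f (R.nbr v j) (R.history f k (R.nbr v j)) (R.back v j)) ::
      R.history f k v

/-- The ports are renumbered: the new port `j` of `v` is the old port `τ v j`. -/
def twist (R : Rotation V) (τ : V → Equiv.Perm (Fin 3)) : Rotation V where
  nbr v j := R.nbr v (τ v j)
  back v j := (τ (R.nbr v (τ v j))).symm (R.back v (τ v j))
  nbr_back v j := by simp [R.nbr_back]
  back_back v j := by simp [R.nbr_back, R.back_back]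

theorem history_succ_eq_replicate_iff (R : Rotation V) (f : V → List Row → Row) (k : ℕ) (v : V) :
    R.history f (k + 1) v = List.replicate (k + 1) silence ↔
      R.history f k v = List.replicate k silence ∧
        ∀ j, f (R.nbr v j) (R.history f k (R.nbr v j)) (R.back v j) = [] := by
  rw [history, List.replicate_succ, List.cons.injEq, and_comm]
  refine and_congr_right fun _ => ⟨fun h j => congrFun h j, fun h => funext h⟩

/-- If a set `E` of active nodes is embedded into a second graph, where the nodes act in the same
way, and the other nodes of both graphs are silent unless a message reaches them, then the two
runs agree. Edges of the second graph between nodes of `E` that are not adjacent in the first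
graph are not used. -/
theorem history_eq_of_injOn (F : Rotation X) (P : Rotation V) {f : X → List Row → Row}
    {b : V → List Row → Row} {φ : X → V} {E : ℕ → Set X} {r : ℕ} (hmono : Monotone E)
    (hsleep : ∀ k, ∀ u ∉ E k, F.history f k u = List.replicate k silence)
    (hsilent : ∀ k, ∀ u ∉ E k, f u (List.replicate k silence) = silence)
    (hwake : ∀ k u j, f u (F.history f k u) j ≠ [] → F.nbr u j ∈ E (k + 1))
    (hinj : Set.InjOn φ (E r))
    (hnbr : ∀ u ∈ E r, ∀ j, P.nbr (φ u) j = φ (F.nbr u j))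
    (hback : ∀ u ∈ E r, ∀ j, F.nbr u j ∈ E r → P.back (φ u) j = F.back u j)
    (hbeh : ∀ k < r, ∀ u ∈ E k, b (φ u) (F.history f k u) = f u (F.history f k u))
    (hb : ∀ k < r, ∀ v ∉ φ '' E k, b v (List.replicate k silence) = silence) :
    ∀ k ≤ r, (∀ u ∈ E k, P.history b k (φ u) = F.history f k u) ∧
      ∀ v ∉ φ '' E k, P.history b k v = List.replicate k silence := by
  intro k
  induction k with
  | zero => exact fun _ => ⟨fun _ _ => rfl, fun _ _ => rfl⟩
  | succ k ih =>
    intro hk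
    obtain ⟨ih1, ih2⟩ := ih (by omega)
    have hsub : E k ⊆ E r := hmono (by omega)
    have hsub' : E (k + 1) ⊆ E r := hmono hk
    have hquiet : ∀ u ∉ E k, f u (F.history f k u) = silence := fun u hu => by
      rw [hsleep k u hu, hsilent k u hu]
    -- a message that reaches `v` comes from an embedded node that has an edge to a preimage of `v`
    have hmsg : ∀ v j, b (P.nbr v j) (P.history b k (P.nbr v j)) (P.back v j) ≠ [] →
        ∃ w ∈ E k, φ w = P.nbr v j ∧ F.nbr w (P.back v j) ∈ E (k + 1) ∧
          φ (F.nbr w (P.back v j)) = v := by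
      intro v j h
      by_cases hv : P.nbr v j ∈ φ '' E k
      · obtain ⟨w, hw, hwv⟩ := hv
        rw [← hwv, ih1 w hw, hbeh k (by omega) w hw] at h
        refine ⟨w, hw, hwv, hwake k w _ h, ?_⟩
        rw [← hnbr w (hsub hw), hwv, P.nbr_back]
      · rw [ih2 _ hv, hb k (by omega) _ hv] at h
        exact absurd rfl h
    constructor
    · intro u hu
      have hu' := hsub' hu
      have hprev : P.history b k (φ u) = F.history f k u := by
        by_cases huk : u ∈ E k
        · exact ih1 u huk
        · rw [hsleep k u huk]
          refine ih2 _ ?_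
          rintro ⟨w, hw, hwu⟩
          exact huk (hinj (hsub hw) hu' hwu ▸ hw)
      rw [history, history, hprev]
      congr 1
      funext j
      by_cases hw : F.nbr u j ∈ E k
      · rw [hback u hu' j (hsub hw), hnbr u hu' j, ih1 _ hw, hbeh k (by omega) _ hw]
      · rw [hquiet _ hw]
        by_contra h
        obtain ⟨w, hwE, hwφ, hwk, hwu⟩ := hmsg _ _ h
        have hq : P.back (P.nbr (φ u) j) (P.back (φ u) j) = j := P.back_back _ _
        generalize P.back (φ u) j = q at hwk hwu hq
        have h1 : F.nbr w q = u := hinj (hsub' hwk) hu' hwu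
        have h2 : P.back (φ w) q = F.back w q := hback w (hsub hwE) _ (by rwa [h1])
        rw [hwφ, hq] at h2
        have h3 := F.nbr_back w q
        rw [h1, ← h2] at h3
        exact hw (h3 ▸ hwE)
    · intro v hv
      rw [history_succ_eq_replicate_iff]
      constructor
      · refine ih2 v fun h => hv ?_
        obtain ⟨w, hw, hwv⟩ := h
        exact ⟨w, hmono (Nat.le_succ k) hw, hwv⟩
      · intro j
        by_contra h
        obtain ⟨w, -, -, hwk, hwv⟩ := hmsg _ _ h
        exact hv ⟨_, hwk, hwv⟩

end Rotation

/-! ### The ideal forest -/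

/-- The nodes of the ideal forest that are not roots: `(r, j, l)` is reached from the root `r`
through its port `j` and the turns `l`, latest turn first. -/
abbrev Branch (ι : Type*) : Type _ := ι × Fin 3 × List Bool

/-- The nodes of the ideal forest with roots `ι`: the universal cover, seen from several places, of
a cubic graph. -/
abbrev Address (ι : Type*) : Type _ := ι ⊕ Branch ι

/-- A turn, as the difference between the port through which a node is left and the port through
which it was entered. -/
def turn (b : Bool) : Fin 3 := if b then 2 else 1

theorem turn_ne_zero (b : Bool) : turn b ≠ 0 := by cases b <;> decide

theorem turn_decide {δ : Fin 3} (h : δ ≠ 0) : turn (decide (δ = 2)) = δ := by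
  revert h
  revert δ
  decide

theorem decide_turn (b : Bool) : decide (turn b = 2) = b := by cases b <;> decide

namespace Branch

variable {ι : Type*}

/-- The node from which a branch was reached. -/
def parent : Branch ι → Address ι
  | (r, _, []) => Sum.inl r
  | (r, j, _ :: l) => Sum.inr (r, j, l)

/-- The port of the parent that leads to a branch, if `p z` is the port of `z` that leads to the
parent of `z`. -/
def exitPort (p : Branch ι → Fin 3) : Branch ι → Fin 3
  | (_, j, []) => j
  | (r, j, b :: l) => p (r, j, l) + turn b

end Branch

open Branch

/-- The ideal forest as a cubic graph, if `p z` is the port of `z` that leads to the parent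
of `z`. -/
def forest {ι : Type*} (p : Branch ι → Fin 3) : Rotation (Address ι) where
  nbr
    | .inl r, j => .inr (r, j, [])
    | .inr z, j => if j = p z then parent z else .inr (z.1, z.2.1, decide (j - p z = 2) :: z.2.2)
  back
    | .inl r, j => p (r, j, [])
    | .inr z, j => if j = p z then exitPort p z
        else p (z.1, z.2.1, decide (j - p z = 2) :: z.2.2)
  nbr_back := by
    rintro (r | ⟨r, j₀, l⟩) j
    · simp [parent]
    · by_cases h : j = p (r, j₀, l)
      · cases l with
        | nil => simp [h, parent, exitPort]
        | cons b l => simp [h, parent, exitPort, turn_ne_zero, decide_turn]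
      · simp [h, parent]
  back_back := by
    rintro (r | ⟨r, j₀, l⟩) j
    · simp [exitPort]
    · by_cases h : j = p (r, j₀, l)
      · cases l with
        | nil => simp [h, parent, exitPort]
        | cons b l => simp [h, parent, exitPort, turn_ne_zero, decide_turn]
      · have : j - p (r, j₀, l) ≠ 0 := sub_ne_zero.2 h
        simp [h, exitPort, turn_decide this]

theorem forest_nbr_parent {ι : Type*} (p : Branch ι → Fin 3) (z : Branch ι) :
    (forest p).nbr (parent z) (exitPort p z) = .inr z := by
  obtain ⟨r, j, _ | ⟨b, l⟩⟩ := z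
  · simp [forest, parent, exitPort]
  · simp [forest, parent, exitPort, turn_ne_zero, decide_turn]

/-- The neighbours of a branch are its parent and its two children. -/
theorem forest_nbr_inr {ι : Type*} (p : Branch ι → Fin 3) (z : Branch ι) (j : Fin 3) :
    (j = p z ∧ (forest p).nbr (.inr z) j = parent z ∧ (forest p).back (.inr z) j = exitPort p z) ∨
      ∃ z' : Branch ι, (forest p).nbr (.inr z) j = .inr z' ∧ parent z' = .inr z ∧
        (forest p).back (.inr z) j = p z' ∧ exitPort p z' = j := by
  by_cases h : j = p z
  · left
    simp [h, forest]
  · right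
    have : j - p z ≠ 0 := sub_ne_zero.2 h
    refine ⟨(z.1, z.2.1, decide (j - p z = 2) :: z.2.2), ?_, ?_, ?_, ?_⟩
    · simp [forest, h]
    · simp [parent]
    · simp [forest, h]
    · simp [exitPort, turn_decide this]

/-- What a branch of the ideal forest knows: its identifier, the port that leads to its parent, and
a bit that the algorithm does not see, which tells which of its two children is which neighbour
in the real network. -/
abbrev Label (U : Type*) : Type _ := U × Fin 3 × Bool

section IdealRun

variable {ι U : Type*} (f : ι → List Row → Row) (g : U → List Row → Row) (L : Branch ι → Label U)

open Classical in
/-- In the ideal run, the roots act according to `f`. A branch with identifier `i` acts according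
to `g i`, but not before a message has reached it. -/
noncomputable def idealAct : Address ι → List Row → Row
  | .inl r, h => f r h
  | .inr z, h => if h = List.replicate h.length silence then silence else g (L z).1 h

/-- The rows received in the ideal run. -/
noncomputable def idealHistory : ℕ → Address ι → List Row :=
  (forest fun z => (L z).2.1).history (idealAct f g L)

/-- The row sent in round `k` of the ideal run. -/
noncomputable def idealSend (k : ℕ) (u : Address ι) : Row :=
  idealAct f g L u (idealHistory f g L k u)

/-- The roots, and the nodes that have received a message in the rounds before round `k`. -/
def awake (k : ℕ) : Set (Address ι) :=
  {u | ∀ z, u = .inr z → idealHistory f g L k u ≠ List.replicate k silence}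

/-- The exit ports of the ideal forest. -/
def labelExitPort (z : Branch ι) : Fin 3 := exitPort (fun z => (L z).2.1) z

variable {f g L}

theorem inl_mem_awake (k : ℕ) (r : ι) : Sum.inl r ∈ awake f g L k := by simp [awake]

theorem inr_mem_awake {k : ℕ} {z : Branch ι} :
    Sum.inr z ∈ awake f g L k ↔ idealHistory f g L k (.inr z) ≠ List.replicate k silence :=
  ⟨fun h => h z rfl, fun h _ hz' => hz' ▸ h⟩

theorem inr_notMem_awake_zero (z : Branch ι) : Sum.inr z ∉ awake f g L 0 := by
  rw [inr_mem_awake]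
  exact fun h => h rfl

theorem idealHistory_of_notMem {k : ℕ} {u : Address ι} (h : u ∉ awake f g L k) :
    idealHistory f g L k u = List.replicate k silence := by
  rcases u with r | z
  · exact absurd (inl_mem_awake k r) h
  · rw [inr_mem_awake, not_not] at h
    exact h

theorem idealAct_replicate_of_notMem {k : ℕ} {u : Address ι} (h : u ∉ awake f g L k) (m : ℕ) :
    idealAct f g L u (List.replicate m silence) = silence := by
  rcases u with r | z
  · exact absurd (inl_mem_awake k r) h
  · simp [idealAct]

theorem mem_awake_of_idealSend_ne {k : ℕ} {u : Address ι} {j : Fin 3}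
    (h : idealSend f g L k u j ≠ []) : u ∈ awake f g L k := by
  by_contra hu
  rw [idealSend, idealHistory_of_notMem hu, idealAct_replicate_of_notMem hu] at h
  exact h rfl

theorem idealAct_inr_of_mem {k : ℕ} {z : Branch ι} (h : Sum.inr z ∈ awake f g L k) :
    idealAct f g L (.inr z) (idealHistory f g L k (.inr z)) =
      g (L z).1 (idealHistory f g L k (.inr z)) := by
  rw [inr_mem_awake] at h
  have hlen : ∀ m u, (idealHistory f g L m u).length = m := by
    intro m
    induction m with
    | zero => exact fun _ => rfl
    | succ m ih => exact fun u => by simpa [idealHistory, Rotation.history] using ih u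
  rw [idealAct, hlen, if_neg h]

theorem mem_awake_succ_iff_aux {k : ℕ} {z : Branch ι} :
    Sum.inr z ∈ awake f g L (k + 1) ↔ Sum.inr z ∈ awake f g L k ∨
      ∃ j, idealSend f g L k ((forest fun z => (L z).2.1).nbr (.inr z) j)
        ((forest fun z => (L z).2.1).back (.inr z) j) ≠ [] := by
  rw [inr_mem_awake, inr_mem_awake, idealHistory, Ne,
    Rotation.history_succ_eq_replicate_iff, not_and_or, not_forall]
  rfl

theorem awake_mono : Monotone (awake f g L) := by
  refine monotone_nat_of_le_succ fun k u hu => ?_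
  rcases u with r | z
  · exact inl_mem_awake _ r
  · exact mem_awake_succ_iff_aux.2 (Or.inl hu)

theorem nbr_mem_awake {k : ℕ} {u : Address ι} {j : Fin 3} (h : idealSend f g L k u j ≠ []) :
    (forest fun z => (L z).2.1).nbr u j ∈ awake f g L (k + 1) := by
  rcases hw : (forest fun z => (L z).2.1).nbr u j with r | z
  · exact inl_mem_awake _ r
  · refine mem_awake_succ_iff_aux.2 (Or.inr ⟨(forest fun z => (L z).2.1).back u j, ?_⟩)
    rw [← hw, Rotation.nbr_back, Rotation.back_back]
    exact h

theorem parent_mem_awake {k : ℕ} {z : Branch ι} (h : Sum.inr z ∈ awake f g L k) :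
    parent z ∈ awake f g L k := by
  induction k generalizing z with
  | zero => exact absurd h (inr_notMem_awake_zero z)
  | succ k ih =>
    rcases mem_awake_succ_iff_aux.1 h with h | ⟨j, h⟩
    · exact awake_mono (Nat.le_succ k) (ih h)
    · have h1 := mem_awake_of_idealSend_ne h
      refine awake_mono (Nat.le_succ k) ?_
      rcases forest_nbr_inr (fun z => (L z).2.1) z j with ⟨-, h2, -⟩ | ⟨z', h2, h3, -⟩
      · rwa [h2] at h1
      · rw [h2] at h1
        have h4 := ih h1
        rw [h3] at h4
        exact ih h4

/-- A branch is woken by its parent. -/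
theorem mem_awake_succ_iff {k : ℕ} {z : Branch ι} :
    Sum.inr z ∈ awake f g L (k + 1) ↔ Sum.inr z ∈ awake f g L k ∨
      idealSend f g L k (parent z) (labelExitPort L z) ≠ [] := by
  constructor
  · intro h
    rcases mem_awake_succ_iff_aux.1 h with h | ⟨j, h⟩
    · exact Or.inl h
    · rcases forest_nbr_inr (fun z => (L z).2.1) z j with ⟨-, h2, h3⟩ | ⟨z', h2, h3, -⟩
      · rw [h2, h3] at h
        exact Or.inr h
      · left
        have h1 := mem_awake_of_idealSend_ne h
        rw [h2] at h1
        exact h3 ▸ parent_mem_awake h1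
  · rintro (h | h)
    · exact awake_mono (Nat.le_succ k) h
    · have := nbr_mem_awake h
      rwa [labelExitPort, forest_nbr_parent] at this

theorem exists_idealSend_ne {k : ℕ} {z : Branch ι} (h : Sum.inr z ∈ awake f g L (k + 1)) :
    ∃ m ≤ k, idealSend f g L m (parent z) (labelExitPort L z) ≠ [] := by
  induction k with
  | zero =>
    rcases mem_awake_succ_iff.1 h with h | h
    · exact absurd h (inr_notMem_awake_zero z)
    · exact ⟨0, le_rfl, h⟩
  | succ k ih =>
    rcases mem_awake_succ_iff.1 h with h | h
    · obtain ⟨m, hm, h⟩ := ih h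
      exact ⟨m, by omega, h⟩
    · exact ⟨k + 1, le_rfl, h⟩

theorem mem_awake_congr {L' : Branch ι → Label U} {k : ℕ}
    (h : idealHistory f g L k = idealHistory f g L' k) : awake f g L k = awake f g L' k := by
  rw [awake, awake, h]

theorem idealSend_congr {L' : Branch ι → Label U} {k : ℕ} {u : Address ι}
    (h : idealHistory f g L k u = idealHistory f g L' k u)
    (hL : ∀ z, u = .inr z → (L z).1 = (L' z).1) :
    idealSend f g L k u = idealSend f g L' k u := by
  rcases u with r | z
  · rw [idealSend, idealSend, h]
    rfl
  · rw [idealSend, idealSend, h, idealAct, idealAct, hL z rfl]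

theorem labelExitPort_congr {L' : Branch ι → Label U} {z : Branch ι}
    (hL : ∀ z', parent z = .inr z' → (L z').2.1 = (L' z').2.1) :
    labelExitPort L z = labelExitPort L' z := by
  obtain ⟨r, j, _ | ⟨b, l⟩⟩ := z
  · rfl
  · simp only [labelExitPort, exitPort]
    rw [hL _ rfl]

/-- The ideal run up to round `r` depends only on the identifiers and ports of the awake nodes. -/
theorem idealHistory_congr {L' : Branch ι → Label U} {r : ℕ}
    (hL : ∀ z, Sum.inr z ∈ awake f g L r → (L z).1 = (L' z).1 ∧ (L z).2.1 = (L' z).2.1) :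
    ∀ k ≤ r, idealHistory f g L k = idealHistory f g L' k := by
  intro k
  induction k with
  | zero => exact fun _ => rfl
  | succ k ih =>
    intro hk
    have ihk := ih (by omega)
    have hawake := mem_awake_congr ihk
    have hsub : awake f g L k ⊆ awake f g L r := awake_mono (by omega)
    have hsend : ∀ u, idealSend f g L k u = idealSend f g L' k u := by
      intro u
      by_cases hu : u ∈ awake f g L k
      · refine idealSend_congr (congrFun ihk u) ?_
        rintro z rfl
        exact (hL z (hsub hu)).1
      · have hu' := hu
        rw [hawake] at hu'
        rw [idealSend, idealSend, idealHistory_of_notMem hu, idealHistory_of_notMem hu',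
          idealAct_replicate_of_notMem hu, idealAct_replicate_of_notMem hu']
    have hquiet : ∀ u ∉ awake f g L k, idealSend f g L k u = silence := by
      intro u hu
      rw [idealSend, idealHistory_of_notMem hu, idealAct_replicate_of_notMem hu]
    funext u
    by_cases hu : u ∈ awake f g L (k + 1)
    · change _ :: _ = _ :: _
      refine congrArg₂ _ ?_ (congrFun ihk u)
      funext j
      change idealSend f g L k ((forest fun z => (L z).2.1).nbr u j)
          ((forest fun z => (L z).2.1).back u j) =
        idealSend f g L' k ((forest fun z => (L' z).2.1).nbr u j)
          ((forest fun z => (L' z).2.1).back u j)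
      rw [← hsend]
      rcases u with r' | z
      · change idealSend f g L k (.inr (r', j, [])) _ = idealSend f g L k (.inr (r', j, [])) _
        by_cases hw : Sum.inr (r', j, []) ∈ awake f g L k
        · change _ = idealSend f g L k (.inr (r', j, [])) (L' (r', j, [])).2.1
          rw [← (hL _ (hsub hw)).2]
          rfl
        · rw [hquiet _ hw]
          rfl
      · have hz := hL z (awake_mono hk hu)
        rcases forest_nbr_inr (fun z => (L z).2.1) z j with ⟨h1, h2, h3⟩ | ⟨z', h2, h3, h4, h5⟩
        · have hp := parent_mem_awake hu
          have h1' : j = (L' z).2.1 := h1.trans hz.2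
          have h6 : (forest fun z => (L' z).2.1).nbr (.inr z) j = parent z ∧
              (forest fun z => (L' z).2.1).back (.inr z) j = labelExitPort L' z := by
            simp [forest, h1', labelExitPort]
          rw [h2, h3, h6.1, h6.2, ← labelExitPort_congr (L := L)]
          · rfl
          · intro z' hz'
            rw [hz'] at hp
            exact (hL z' (awake_mono hk hp)).2
        · have h6 : (forest fun z => (L' z).2.1).nbr (.inr z) j =
              (forest fun z => (L z).2.1).nbr (.inr z) j := by
            simp only [forest, hz.2]
          rw [h6, h2, h4]
          by_cases hw : Sum.inr z' ∈ awake f g L k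
          · have h7 : (forest fun z => (L' z).2.1).back (.inr z) j = (L' z').2.1 := by
              have h8 := (forest fun z => (L' z).2.1).nbr_back (.inr z) j
              rw [h6, h2] at h8
              rcases forest_nbr_inr (fun z => (L' z).2.1) z j with ⟨h1, h2', -⟩ | ⟨z'', h2', -, h4', -⟩
              · rw [h6, h2] at h2'
                obtain ⟨r₁, j₁, l₁⟩ := z
                obtain ⟨r₂, j₂, l₂⟩ := z'
                rcases l₁ with _ | ⟨b₁, l₁⟩ <;> rcases l₂ with _ | ⟨b₂, l₂⟩ <;>
                  simp [parent] at h2' h3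
                have e1 := congrArg List.length h2'.2.2
                have e2 := congrArg List.length h3.2.2
                simp at e1 e2
                omega
              · rw [h6, h2, Sum.inr.injEq] at h2'
                rw [h4', h2']
            rw [h7, (hL _ (hsub hw)).2]
          · rw [hquiet _ hw]
            rfl
    · rw [idealHistory_of_notMem hu]
      symm
      refine idealHistory_of_notMem fun hu' => hu ?_
      rcases u with r' | z
      · exact inl_mem_awake _ _
      · rcases mem_awake_succ_iff.1 hu' with h | h
        · rw [← hawake] at h
          exact awake_mono (Nat.le_succ k) h
        · rw [← hsend] at h
          have hp := mem_awake_of_idealSend_ne h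
          refine mem_awake_succ_iff.2 (Or.inr ?_)
          rwa [labelExitPort_congr (L' := L')]
          intro z' hz'
          rw [hz'] at hp
          exact (hL z' (hsub hp)).2

theorem idealSend_eq_of_agree {L' : Branch ι → Label U} {r : ℕ}
    (hL : ∀ z, Sum.inr z ∈ awake f g L r → (L z).1 = (L' z).1 ∧ (L z).2.1 = (L' z).2.1)
    (u : Address ι) : idealSend f g L r u = idealSend f g L' r u := by
  have hh := idealHistory_congr hL r le_rfl
  by_cases hu : u ∈ awake f g L r
  · refine idealSend_congr (congrFun hh u) ?_
    rintro z rfl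
    exact (hL z hu).1
  · have hu' := hu
    rw [mem_awake_congr hh] at hu'
    rw [idealSend, idealSend, idealHistory_of_notMem hu, idealHistory_of_notMem hu',
      idealAct_replicate_of_notMem hu, idealAct_replicate_of_notMem hu']

/-- Which nodes are awake after one more round depends only on the labels of the nodes that are
awake now. -/
theorem awake_succ_congr {L' : Branch ι → Label U} {r : ℕ}
    (hL : ∀ z, Sum.inr z ∈ awake f g L r → (L z).1 = (L' z).1 ∧ (L z).2.1 = (L' z).2.1) :
    awake f g L (r + 1) = awake f g L' (r + 1) := by
  have hh := idealHistory_congr hL r le_rfl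
  have ha := mem_awake_congr hh
  ext u
  rcases u with r' | z
  · simp [inl_mem_awake]
  · rw [mem_awake_succ_iff, mem_awake_succ_iff, ← ha, ← idealSend_eq_of_agree hL]
    refine or_congr_right ?_
    by_cases hp : parent z ∈ awake f g L r
    · rw [labelExitPort_congr (L' := L')]
      intro z' hz'
      rw [hz'] at hp
      exact (hL z' hp).2
    · have : ∀ j, ¬ idealSend f g L r (parent z) j ≠ [] := fun j h =>
        hp (mem_awake_of_idealSend_ne h)
      simp only [this]

/-- The run in the tree of the root `t` does not depend on what the other roots do. -/
theorem idealHistory_congr_root {f' : ι → List Row → Row} {t : ι} (ht : f t = f' t) (k : ℕ) :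
    idealHistory f g L k (.inl t) = idealHistory f' g L k (.inl t) ∧
      ∀ x, idealHistory f g L k (.inr (t, x)) = idealHistory f' g L k (.inr (t, x)) := by
  have hact : ∀ u : Address ι, u = .inl t ∨ (∃ x, u = .inr (t, x)) →
      idealAct f g L u = idealAct f' g L u := by
    rintro u (rfl | ⟨x, rfl⟩)
    · exact ht
    · rfl
  suffices h : ∀ u : Address ι, u = .inl t ∨ (∃ x, u = .inr (t, x)) →
      idealHistory f g L k u = idealHistory f' g L k u from
    ⟨h _ (Or.inl rfl), fun x => h _ (Or.inr ⟨x, rfl⟩)⟩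
  induction k with
  | zero => exact fun _ _ => rfl
  | succ k ih =>
    intro u hu
    change _ :: _ = _ :: _
    refine congrArg₂ _ ?_ (ih u hu)
    funext j
    have hn : (forest fun z => (L z).2.1).nbr u j = .inl t ∨
        ∃ x, (forest fun z => (L z).2.1).nbr u j = .inr (t, x) := by
      rcases hu with rfl | ⟨x, rfl⟩
      · exact Or.inr ⟨_, rfl⟩
      · obtain ⟨j', _ | ⟨b, l⟩⟩ := x <;> simp only [forest, parent] <;> split_ifs <;> simp
    change idealAct f g L _ (idealHistory f g L k _) _ = idealAct f' g L _ (idealHistory f' g L k _) _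
    rw [ih _ hn, hact _ hn]

end IdealRun

/-! ### Mapping the ideal forest into a cubic graph -/

/-- A cubic graph without multiple edges, with two adjacent distinguished nodes, the poles, which
are joined by an edge that has port number `2` at both ends. -/
structure PolarRotation (V : Type*) extends Rotation V where
  nbr_injective : ∀ v, Function.Injective (nbr v)
  pole : Bool → V
  pole_injective : Function.Injective pole
  nbr_pole : ∀ b, nbr (pole b) 2 = pole (!b)

/-- The renumberings `j ↦ c + j` and `j ↦ c - j` of three ports; all permutations of `Fin 3` are of
this form. -/
def portPerm (x : Fin 3 × Bool) : Equiv.Perm (Fin 3) where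
  toFun j := if x.2 then x.1 - j else x.1 + j
  invFun j := if x.2 then x.1 - j else j - x.1
  left_inv j := by cases h : x.2 <;> simp
  right_inv j := by cases h : x.2 <;> simp

theorem portPerm_zero (j : Fin 3) : portPerm (0, false) j = j := by simp [portPerm]

/-- The renumbering with direction `d` that sends port `p` to port `e`. -/
def portShift (e p : Fin 3) (d : Bool) : Fin 3 × Bool := (if d then e + p else e - p, d)

theorem portShift_symm (e : Fin 3) (x : Fin 3 × Bool) :
    portShift e ((portPerm x).symm e) x.2 = x := by
  revert e x
  decide

theorem turn_injective : Function.Injective turn := by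
  intro a b
  revert a b
  decide

/-- What the ideal run does not see: the positions of the roots, other than the poles, and the
orientation of their ports, and for each branch a bit that tells which of its children is which
neighbour in the real network. -/
structure Layout (κ V : Type*) where
  pos : κ → V
  dir : κ → Fin 3 × Bool
  bit : Branch (Bool ⊕ κ) → Bool

section Place

variable {κ V : Type*} (R : PolarRotation V) (Y : Layout κ V)

/-- The position of a root. -/
def Layout.rootPos : Bool ⊕ κ → V
  | .inl b => R.pole b
  | .inr i => Y.pos i

/-- The orientation of the ports of a root. -/
def Layout.rootDir : Bool ⊕ κ → Fin 3 × Bool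
  | .inl _ => (0, false)
  | .inr i => Y.dir i

/-- The position of a branch, and the port through which it was entered. -/
def dartList (r : Bool ⊕ κ) (j : Fin 3) : List Bool → V × Fin 3
  | [] => (R.nbr (Y.rootPos R r) (portPerm (Y.rootDir r) j),
      R.back (Y.rootPos R r) (portPerm (Y.rootDir r) j))
  | b :: l => (R.nbr (dartList r j l).1 ((dartList r j l).2 + turn (xor b (Y.bit (r, j, l)))),
      R.back (dartList r j l).1 ((dartList r j l).2 + turn (xor b (Y.bit (r, j, l)))))

/-- The position of a branch, and the port through which it was entered. -/
def dart (z : Branch (Bool ⊕ κ)) : V × Fin 3 := dartList R Y z.1 z.2.1 z.2.2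

/-- The position of a node of the ideal forest. -/
def place : Address (Bool ⊕ κ) → V
  | .inl r => Y.rootPos R r
  | .inr z => (dart R Y z).1

variable {R Y}

/-- The ports towards the parent and the child of a branch. -/
theorem place_parent (z : Branch (Bool ⊕ κ)) :
    R.nbr (dart R Y z).1 (dart R Y z).2 = place R Y (parent z) ∧
      ∃ i, dart R Y z = (R.nbr (place R Y (parent z)) i, R.back (place R Y (parent z)) i) ∧
        R.back (dart R Y z).1 (dart R Y z).2 = i := by
  obtain ⟨r, j, _ | ⟨b, l⟩⟩ := z
  · exact ⟨R.nbr_back _ _, _, rfl, R.back_back _ _⟩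
  · exact ⟨R.nbr_back _ _, _, rfl, R.back_back _ _⟩

theorem rot_injective {v v' : V} {i i' : Fin 3}
    (h : (R.nbr v i, R.back v i) = (R.nbr v' i', R.back v' i')) : v = v' ∧ i = i' := by
  rw [Prod.mk.injEq] at h
  have h1 := R.nbr_back v i
  have h2 := R.back_back v i
  rw [h.1, h.2] at h1 h2
  rw [R.nbr_back] at h1
  rw [R.back_back] at h2
  exact ⟨h1.symm, h2.symm⟩

/-- The branches that do not start through the edge between the poles. -/
def Branch.Valid (z : Branch (Bool ⊕ κ)) : Prop := ∀ b, z.1 = .inl b → z.2.1 ≠ 2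

/-- The valid part of the ideal forest, where the trees of the two poles are joined. -/
def joinedForest (κ : Type*) : SimpleGraph (Address (Bool ⊕ κ)) where
  Adj u v := (∃ z : Branch (Bool ⊕ κ), z.Valid ∧
    ((u = .inr z ∧ v = parent z) ∨ (v = .inr z ∧ u = parent z))) ∨
    ∃ b, u = .inl (.inl b) ∧ v = .inl (.inl !b)
  symm := ⟨by
    rintro u v (⟨z, hz, h | h⟩ | ⟨b, h, h'⟩)
    · exact Or.inl ⟨z, hz, Or.inr h⟩
    · exact Or.inl ⟨z, hz, Or.inl h⟩
    · exact Or.inr ⟨!b, h', by simpa using h⟩⟩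
  loopless := ⟨by
    have hp : ∀ z : Branch (Bool ⊕ κ), Sum.inr z ≠ parent z := by
      rintro ⟨r, j, _ | ⟨b, l⟩⟩ h
      · simp [parent] at h
      · simp only [parent, Sum.inr.injEq, Prod.mk.injEq] at h
        have := congrArg List.length h.2.2
        simp at this
    rintro u (⟨z, -, ⟨h, h'⟩ | ⟨h, h'⟩⟩ | ⟨b, h, h'⟩)
    · exact hp z (h ▸ h')
    · exact hp z (h ▸ h')
    · rw [h] at h'
      simp at h'⟩

theorem eq_of_parent_eq {z z' : Branch (Bool ⊕ κ)} (h : parent z = parent z')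
    (hd : dart R Y z = dart R Y z') : z = z' := by
  obtain ⟨r, j, _ | ⟨b, l⟩⟩ := z <;> obtain ⟨r', j', _ | ⟨b', l'⟩⟩ := z'
  · simp only [parent, Sum.inl.injEq] at h
    subst h
    have : j = j' := (portPerm _).injective (rot_injective hd).2
    rw [this]
  · simp [parent] at h
  · simp [parent] at h
  · simp only [parent, Sum.inr.injEq, Prod.mk.injEq] at h
    obtain ⟨rfl, rfl, rfl⟩ := h
    have h2 := turn_injective (add_left_cancel (rot_injective hd).2)
    have : b = b' := by
      revert h2
      cases b <;> cases b' <;> cases Y.bit (r, j, l) <;> simp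
    rw [this]

/-- The ideal forest is mapped to the cubic graph by a local isomorphism. -/
theorem place_adj {u v : Address (Bool ⊕ κ)} (h : (joinedForest κ).Adj u v) :
    ∃ i, place R Y v = R.nbr (place R Y u) i := by
  rcases h with ⟨z, hz, ⟨rfl, rfl⟩ | ⟨rfl, rfl⟩⟩ | ⟨b, rfl, rfl⟩
  · exact ⟨_, (place_parent z).1.symm⟩
  · obtain ⟨i, hi, -⟩ := (place_parent (R := R) (Y := Y) z).2
    exact ⟨i, congrArg Prod.fst hi⟩
  · exact ⟨2, (R.nbr_pole b).symm⟩

theorem place_locally_injective {u v v' : Address (Bool ⊕ κ)} (h : (joinedForest κ).Adj u v)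
    (h' : (joinedForest κ).Adj u v') (hvv : v ≠ v') : place R Y v ≠ place R Y v' := by
  have hpar : ∀ z z' : Branch (Bool ⊕ κ), Sum.inr z = parent z' →
      place R Y (parent z) ≠ place R Y (.inr z') := by
    rintro z ⟨r, j, _ | ⟨b, l⟩⟩ hzz' heq
    · simp [parent] at hzz'
    · simp only [parent, Sum.inr.injEq] at hzz'
      subst hzz'
      rw [← (place_parent (R := R) (Y := Y) _).1] at heq
      have := R.nbr_injective _ heq
      exact turn_ne_zero _ (left_eq_add.1 this)
  have hpol : ∀ b (z : Branch (Bool ⊕ κ)), z.Valid → .inl (.inl b) = parent z →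
      place R Y (.inl (.inl !b)) ≠ place R Y (.inr z) := by
    rintro b ⟨r, j, _ | ⟨b', l⟩⟩ hz hzp heq
    · simp only [parent, Sum.inl.injEq] at hzp
      subst hzp
      change R.pole (!b) = R.nbr (R.pole b) (portPerm (0, false) j) at heq
      rw [portPerm_zero, ← R.nbr_pole] at heq
      exact hz b rfl (R.nbr_injective _ heq).symm
    · simp [parent] at hzp
  have hchild : ∀ z z' : Branch (Bool ⊕ κ), parent z = parent z' → z ≠ z' →
      place R Y (.inr z) ≠ place R Y (.inr z') := by
    intro z z' hp hne heq
    refine hne (eq_of_parent_eq (R := R) (Y := Y) hp ?_)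
    obtain ⟨i, hi, -⟩ := (place_parent (R := R) (Y := Y) z).2
    obtain ⟨i', hi', -⟩ := (place_parent (R := R) (Y := Y) z').2
    change (dart R Y z).1 = (dart R Y z').1 at heq
    rw [hi, hi', ← hp] at heq ⊢
    rw [R.nbr_injective _ heq]
  rcases h with ⟨z, hz, ⟨h1, h2⟩ | ⟨h1, h2⟩⟩ | ⟨b, h1, h2⟩ <;>
    rcases h' with ⟨z', hz', ⟨h1', h2'⟩ | ⟨h1', h2'⟩⟩ | ⟨b', h1', h2'⟩
  · rw [h1, Sum.inr.injEq] at h1'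
    rw [h2, h2', h1'] at hvv
    exact absurd rfl hvv
  · rw [h2, h1']
    exact hpar z z' (h1 ▸ h2')
  · rw [h1] at h1'
    simp at h1'
  · rw [h1, h2']
    exact (hpar z' z (h1' ▸ h2)).symm
  · rw [h1, h1']
    refine hchild z z' (h2 ▸ h2') ?_
    rintro rfl
    exact hvv (h1.trans h1'.symm)
  · rw [h1, h2']
    exact (hpol b' z hz (h1' ▸ h2)).symm
  · rw [h1'] at h1
    simp at h1
  · rw [h2, h1']
    exact hpol b z' hz' (h1 ▸ h2')
  · rw [h1, Sum.inl.injEq, Sum.inl.injEq] at h1'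
    rw [h2, h2', h1'] at hvv
    exact absurd rfl hvv

/-- The adjacency relation of a cubic graph. -/
def Rotation.Adj {V : Type*} (R : Rotation V) (v w : V) : Prop := ∃ i, w = R.nbr v i

/-- Nodes of the ideal forest at distance less than the girth have different positions. -/
theorem place_ne_of_walk {g : ℕ} (hg : GirthAtLeast R.Adj g) {u v : Address (Bool ⊕ κ)}
    (p : (joinedForest κ).Walk u v) (hp : p.length < g) (huv : u ≠ v) :
    place R Y u ≠ place R Y v := by
  classical
  have hlen := p.length_bypass_le_length
  have hpath := p.bypass_isPath
  generalize p.bypass = q at hlen hpath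
  have hpos : 0 < q.length := by
    rw [Nat.pos_iff_ne_zero]
    exact fun h => huv (SimpleGraph.Walk.eq_of_length_eq_zero h)
  have := hg (fun i => place R Y (q.getVert i)) q.length hpos (by omega)
    (fun i hi => place_adj (q.adj_getVert_succ hi)) (fun i hi => ?_)
  · simpa using this
  · refine place_locally_injective (q.adj_getVert_succ (by omega)).symm
      (q.adj_getVert_succ (i := i + 1) (by omega)) fun h => ?_
    have := hpath.getVert_injOn (by simp; omega) (by simp; omega) h
    omega

theorem exists_walk_append {r : Bool ⊕ κ} {j : Fin 3} (hv : ∀ b, r = .inl b → j ≠ 2)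
    (l₁ l : List Bool) : ∃ p : (joinedForest κ).Walk (.inr (r, j, l₁ ++ l)) (.inr (r, j, l)),
      p.length = l₁.length := by
  induction l₁ with
  | nil => exact ⟨.nil, rfl⟩
  | cons b l₁ ih =>
    obtain ⟨p, hp⟩ := ih
    have hadj : (joinedForest κ).Adj (.inr (r, j, b :: l₁ ++ l)) (.inr (r, j, l₁ ++ l)) :=
      Or.inl ⟨(r, j, b :: l₁ ++ l), hv, Or.inl ⟨rfl, rfl⟩⟩
    exact ⟨.cons hadj p, by simp [hp]⟩

theorem exists_walk_suffix {r : Bool ⊕ κ} {j : Fin 3} (hv : ∀ b, r = .inl b → j ≠ 2)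
    {l m : List Bool} (hm : m <:+ l) : ∃ p : (joinedForest κ).Walk (.inr (r, j, l)) (.inr (r, j, m)),
      p.length + m.length = l.length := by
  obtain ⟨x, rfl⟩ := hm
  obtain ⟨p, hp⟩ := exists_walk_append hv x m
  exact ⟨p, by simp [hp]⟩

/-- The number of edges between a node of the ideal forest and its root. -/
def addressDepth : Address (Bool ⊕ κ) → ℕ
  | .inl _ => 0
  | .inr z => z.2.2.length + 1

/-- The root of the tree of a node. -/
def addressRoot : Address (Bool ⊕ κ) → Bool ⊕ κ
  | .inl r => r
  | .inr z => z.1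

/-- The node is not reached through the edge between the poles. -/
def AddressValid (u : Address (Bool ⊕ κ)) : Prop := ∀ z, u = .inr z → z.Valid

theorem exists_walk_root {u : Address (Bool ⊕ κ)} (hu : AddressValid u) :
    ∃ p : (joinedForest κ).Walk u (.inl (addressRoot u)), p.length = addressDepth u := by
  rcases u with r | ⟨r, j, l⟩
  · exact ⟨.nil, rfl⟩
  · have hv : Branch.Valid (r, j, l) := hu _ rfl
    have hadj : (joinedForest κ).Adj (.inr (r, j, [])) (.inl r) :=
      Or.inl ⟨(r, j, []), hv, Or.inl ⟨rfl, rfl⟩⟩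
    have h := exists_walk_append (κ := κ) hv l []
    rw [List.append_nil] at h
    obtain ⟨p, hp⟩ := h
    exact ⟨p.concat hadj, (SimpleGraph.Walk.length_concat p hadj).trans (congrArg (· + 1) hp)⟩

/-- Two nodes in the same tree, or in the trees of the two poles. -/
def SameComponent (u v : Address (Bool ⊕ κ)) : Prop :=
  addressRoot u = addressRoot v ∨ ∃ b b', addressRoot u = .inl b ∧ addressRoot v = .inl b'

theorem place_ne_of_depth {g : ℕ} (hg : GirthAtLeast R.Adj g) {u v : Address (Bool ⊕ κ)}
    (hu : AddressValid u) (hv : AddressValid v) (huv : u ≠ v) (hc : SameComponent u v)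
    (hd : addressDepth u + addressDepth v + 1 < g) : place R Y u ≠ place R Y v := by
  obtain ⟨p, hp⟩ := exists_walk_root hu
  obtain ⟨q, hq⟩ := exists_walk_root hv
  obtain ⟨c, hc⟩ : ∃ c : (joinedForest κ).Walk (.inl (addressRoot u)) (.inl (addressRoot v)),
      c.length ≤ 1 := by
    by_cases h : addressRoot u = addressRoot v
    · rw [h]
      exact ⟨.nil, by simp⟩
    · obtain ⟨b, b', h1, h2⟩ := hc.resolve_left h
      have : b' = !b := by
        revert h
        rw [h1, h2]
        cases b <;> cases b' <;> simp
      have hadj : (joinedForest κ).Adj (.inl (addressRoot u)) (.inl (addressRoot v)) := by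
        rw [h1, h2, this]
        exact Or.inr ⟨b, rfl, rfl⟩
      exact ⟨.cons hadj .nil, by simp⟩
  refine place_ne_of_walk hg ((p.append c).append q.reverse) ?_ huv
  simp only [SimpleGraph.Walk.length_append, SimpleGraph.Walk.length_reverse]
  omega

/-- The position of a branch depends on its root and on the bits of its proper ancestors. -/
theorem dart_congr {Y' : Layout κ V} {r : Bool ⊕ κ} {j : Fin 3} {l : List Bool}
    (hpos : Y.rootPos R r = Y'.rootPos R r) (hdir : Y.rootDir r = Y'.rootDir r)
    (hbit : ∀ b m, b :: m <:+ l → Y.bit (r, j, m) = Y'.bit (r, j, m)) :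
    dart R Y (r, j, l) = dart R Y' (r, j, l) := by
  induction l with
  | nil => simp only [dart, dartList, hpos, hdir]
  | cons b l ih =>
    have h1 := ih fun b' m hm => hbit b' m (hm.trans (List.suffix_cons b l))
    have h2 := hbit b l (List.suffix_refl _)
    simp only [dart, dartList] at h1 ⊢
    rw [h1, h2]

/-- The position of a root is determined by the dart of a branch and the bits of the branches. -/
theorem rootPos_eq_of_dart_eq {Y' : Layout κ V} {r : Bool ⊕ κ} {j : Fin 3} {l : List Bool}
    (hbit : Y.bit = Y'.bit)
    (h : dart R Y (r, j, l) = dart R Y' (r, j, l)) : Y.rootPos R r = Y'.rootPos R r := by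
  induction l with
  | nil => exact (rot_injective h).1
  | cons b l ih =>
    have h1 := rot_injective h
    refine ih (Prod.ext h1.1 ?_)
    have h2 := h1.2
    rw [hbit] at h2
    exact add_right_cancel h2

/-- The position of a branch determines the bits of its last ancestors, if the rest is
fixed: otherwise there would be a short cycle. -/
theorem bit_eq_of_place_eq {g : ℕ} (hg : GirthAtLeast R.Adj g) {Y' : Layout κ V}
    {r : Bool ⊕ κ} {j : Fin 3} (hv : ∀ b, r = .inl b → j ≠ 2) {l₁ l : List Bool}
    (hl : 2 * l₁.length < g) (hdart : dart R Y (r, j, l) = dart R Y' (r, j, l))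
    (h : place R Y (.inr (r, j, l₁ ++ l)) = place R Y' (.inr (r, j, l₁ ++ l))) :
    ∀ b m, b :: m <:+ l₁ → Y.bit (r, j, m ++ l) = Y'.bit (r, j, m ++ l) := by
  induction l₁ using List.reverseRecOn generalizing l with
  | nil => intro b m hm; simp at hm
  | append_singleton l₁ b₀ ih =>
    have hbit : Y.bit (r, j, l) = Y'.bit (r, j, l) := by
      by_contra hne
      set a := l₁.length + 1 with ha
      -- two walks that separate at the branch `(r, j, l)` and meet again
      set p : Layout κ V → ℕ → V := fun Y t =>
        place R Y (.inr (r, j, (l₁ ++ [b₀]).drop (a - t) ++ l)) with hp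
      have hlen : (l₁ ++ [b₀]).length = a := by simp [ha]
      have hdrop : ∀ t < a, ∃ b, (l₁ ++ [b₀]).drop (a - (t + 1)) =
          b :: (l₁ ++ [b₀]).drop (a - t) := by
        intro t ht
        have h1 : a - (t + 1) < (l₁ ++ [b₀]).length := by omega
        rw [List.drop_eq_getElem_cons h1, show a - (t + 1) + 1 = a - t by omega]
        exact ⟨_, rfl⟩
      have hadj : ∀ t < a, (joinedForest κ).Adj
          (.inr (r, j, (l₁ ++ [b₀]).drop (a - t) ++ l))
          (.inr (r, j, (l₁ ++ [b₀]).drop (a - (t + 1)) ++ l)) := by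
        intro t ht
        obtain ⟨b, hb⟩ := hdrop t ht
        rw [hb]
        exact Or.inl ⟨(r, j, b :: (l₁ ++ [b₀]).drop (a - t) ++ l), hv, Or.inr ⟨rfl, rfl⟩⟩
      have hstep : ∀ Y : Layout κ V, ∀ t < a, R.Adj (p Y t) (p Y (t + 1)) :=
        fun Y t ht => place_adj (hadj t ht)
      have hstep' : ∀ Y : Layout κ V, ∀ t < a, R.Adj (p Y (t + 1)) (p Y t) :=
        fun Y t ht => place_adj (hadj t ht).symm
      have hnb : ∀ Y : Layout κ V, ∀ t, t + 2 ≤ a → p Y t ≠ p Y (t + 2) := by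
        intro Y t ht
        refine place_locally_injective (hadj t (by omega)).symm (hadj (t + 1) (by omega)) ?_
        intro heq
        obtain ⟨b, hb⟩ := hdrop t (by omega)
        obtain ⟨b', hb'⟩ := hdrop (t + 1) (by omega)
        rw [hb', hb] at heq
        simp only [Sum.inr.injEq, Prod.mk.injEq, true_and] at heq
        have := congrArg List.length heq
        simp at this
        omega
      have h0 : ∀ Y : Layout κ V, p Y 0 = (dart R Y (r, j, l)).1 := by
        intro Y
        simp only [hp, Nat.sub_zero, ← hlen, List.drop_length, List.nil_append]
        rfl
      have h1 : ∀ Y : Layout κ V, p Y 1 = R.nbr (dart R Y (r, j, l)).1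
          ((dart R Y (r, j, l)).2 + turn (xor b₀ (Y.bit (r, j, l)))) := by
        intro Y
        have : (l₁ ++ [b₀]).drop (a - 1) = [b₀] := by
          rw [show a - 1 = l₁.length by omega, List.drop_left]
        simp only [hp, this]
        rfl
      have hend : p Y a = p Y' a := by
        simp only [hp, Nat.sub_self, List.drop_zero]
        exact h
      have hsep : p Y 1 ≠ p Y' 1 := by
        rw [h1, h1, hdart]
        intro heq
        have h2 := turn_injective (add_left_cancel (R.nbr_injective _ heq))
        exact hne (by
          revert h2
          cases b₀ <;> cases Y.bit (r, j, l) <;> cases Y'.bit (r, j, l) <;> simp)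
      refine hg (fun t => if t ≤ a then p Y (a - t) else p Y' (t - a)) (2 * a) (by omega)
        (by rw [← hlen]; exact hl) ?_ ?_ ?_
      · intro t ht
        rcases lt_trichotomy t a with hta | rfl | hta
        · simp only [hta.le, show t + 1 ≤ a by omega, if_true]
          have := hstep' Y (a - (t + 1)) (by omega)
          rwa [show a - (t + 1) + 1 = a - t by omega] at this
        · have h3 := hstep Y' 0 (by omega)
          rw [h0, ← hdart, ← h0] at h3
          simpa using h3
        · simp only [show ¬ t ≤ a by omega, show ¬ t + 1 ≤ a by omega, if_false]
          have := hstep Y' (t - a) (by omega)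
          rwa [show t - a + 1 = t + 1 - a by omega] at this
      · intro t ht
        rcases Nat.lt_or_ge a (t + 2) with hta | hta
        · rcases Nat.lt_or_ge a (t + 1) with hta' | hta'
          · rcases Nat.eq_or_lt_of_le (show a ≤ t by omega) with rfl | hta''
            · have h3 := hnb Y' 0 (by omega)
              rw [h0, ← hdart, ← h0] at h3
              simpa using h3
            · simp only [show ¬ t ≤ a by omega, show ¬ t + 2 ≤ a by omega, if_false]
              have := hnb Y' (t - a) (by omega)
              rwa [show t - a + 2 = t + 2 - a by omega] at this
          · simp only [show t ≤ a by omega, show ¬ t + 2 ≤ a by omega, if_true, if_false]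
            rw [show a - t = 1 by omega, show t + 2 - a = 1 by omega]
            exact hsep
        · simp only [show t ≤ a by omega, hta, if_true]
          have := hnb Y (a - (t + 2)) (by omega)
          rw [show a - (t + 2) + 2 = a - t by omega] at this
          exact this.symm
      · simp only [Nat.zero_le, if_true, Nat.sub_zero, show ¬ 2 * a ≤ a by omega, if_false]
        rw [hend]
        congr 1
        omega
    have hdart' : dart R Y (r, j, b₀ :: l) = dart R Y' (r, j, b₀ :: l) := by
      simp only [dart, dartList] at hdart ⊢
      rw [hdart, hbit]
    have hl' : l₁ ++ [b₀] ++ l = l₁ ++ b₀ :: l := by simp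
    intro b m hm
    rcases m.eq_nil_or_concat with rfl | ⟨m', b', rfl⟩
    · exact hbit
    · rw [List.concat_eq_append] at hm ⊢
      rw [← List.cons_append] at hm
      obtain ⟨hm1, hm2⟩ : b :: m' <:+ l₁ ∧ b' = b₀ := by
        obtain ⟨x, hx⟩ := hm
        rw [← List.append_assoc] at hx
        have := List.append_inj' hx rfl
        exact ⟨⟨x, this.1⟩, by simpa using this.2⟩
      rw [hm2, List.append_assoc]
      exact ih (l := b₀ :: l) (by simp at hl; omega) hdart' (by rw [← hl']; exact h) b m' hm1

end Place

/-! ### Collisions in a random image of the ideal forest -/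

/-- The nodes of a polar rotation other than the poles. -/
abbrev PolarRotation.Inner {V : Type*} (R : PolarRotation V) : Type _ :=
  {v : V // ∀ b, v ≠ R.pole b}

/-- The union of those sets of an increasing sequence that have at most `M` elements has at most
`M` elements. -/
theorem encard_iUnion_small_le {α : Type*} {A : ℕ → Set α} (hA : Monotone A) (M : ℕ) :
    {a | ∃ k, (A k).encard ≤ M ∧ a ∈ A k}.encard ≤ M := by
  classical
  by_contra hcon
  rw [not_le] at hcon
  obtain ⟨t, ht, htc⟩ := Set.exists_subset_encard_eq (Order.add_one_le_of_lt hcon)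
  have htf : t.Finite := Set.finite_of_encard_eq_coe (k := M + 1) (by rw [htc]; rfl)
  obtain ⟨k, hk, htk⟩ : ∃ k, (t.Nonempty → (A k).encard ≤ M) ∧ t ⊆ A k := by
    clear htc
    induction t, htf using Set.Finite.induction_on with
    | empty => exact ⟨0, by simp, by simp⟩
    | @insert a t _ _ ih =>
      obtain ⟨k, hk, htk⟩ := ih (fun x hx => ht (Set.mem_insert_of_mem a hx))
      obtain ⟨k', hk', hak'⟩ := ht (Set.mem_insert a t)
      by_cases hkk : k ≤ k'
      · refine ⟨k', fun _ => hk', Set.insert_subset hak' (htk.trans (hA hkk))⟩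
      · rcases t.eq_empty_or_nonempty with rfl | hne
        · exact ⟨k', fun _ => hk', Set.insert_subset hak' (by simp)⟩
        · exact ⟨k, fun _ => hk hne, Set.insert_subset (hA (by omega) hak') htk⟩
  have hne : t.Nonempty := by
    rw [← Set.encard_ne_zero, htc]
    simp
  have h1 := (Set.encard_le_encard htk).trans (hk hne)
  rw [htc] at h1
  have h2 : ((M + 1 : ℕ) : ℕ∞) ≤ (M : ℕ) := by exact_mod_cast h1
  have := Nat.cast_le.1 h2
  omega

section Awake

variable {ι U : Type*} {f : ι → List Row → Row} {g : U → List Row → Row} {L : Branch ι → Label U}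

variable (f g L) in
/-- The awake nodes that are not roots. -/
def awakeBranches (k : ℕ) : Set (Branch ι) := {z | Sum.inr z ∈ awake f g L k}

variable (f g L) in
/-- The nodes, other than the roots, that are awake while at most `M` of them are. -/
def seen (M : ℕ) : Set (Branch ι) :=
  {z | ∃ k, (awakeBranches f g L k).encard ≤ M ∧ z ∈ awakeBranches f g L k}

theorem awakeBranches_mono : Monotone (awakeBranches f g L) := fun _ _ hkl _ hz => awake_mono hkl hz

theorem encard_seen_le (M : ℕ) : (seen f g L M).encard ≤ M :=
  encard_iUnion_small_le awakeBranches_mono M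

theorem parent_mem_awake_of_succ {k : ℕ} {z : Branch ι} (h : Sum.inr z ∈ awake f g L (k + 1)) :
    parent z ∈ awake f g L k := by
  obtain ⟨m, hm, h⟩ := exists_idealSend_ne h
  exact awake_mono hm (mem_awake_of_idealSend_ne h)

theorem suffix_mem_awake {k : ℕ} {r : ι} {j : Fin 3} {l m : List Bool}
    (h : Sum.inr (r, j, l) ∈ awake f g L k) (hm : m <:+ l) : Sum.inr (r, j, m) ∈ awake f g L k := by
  induction l with
  | nil =>
    rw [List.suffix_nil] at hm
    rwa [hm]
  | cons b l ih =>
    rcases List.suffix_cons_iff.1 hm with rfl | hm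
    · exact h
    · exact ih (parent_mem_awake h) hm

theorem suffix_mem_awake_of_succ {k : ℕ} {r : ι} {j : Fin 3} {l m : List Bool} {b : Bool}
    (h : Sum.inr (r, j, l) ∈ awake f g L (k + 1)) (hm : b :: m <:+ l) :
    Sum.inr (r, j, m) ∈ awake f g L k :=
  parent_mem_awake_of_succ (suffix_mem_awake h hm)

theorem length_lt_of_mem {k M : ℕ} {z : Branch ι} (hM : (awakeBranches f g L k).encard ≤ M)
    (hz : z ∈ awakeBranches f g L k) : z.2.2.length < M := by
  obtain ⟨r, j, l⟩ := z
  have hinj : Function.Injective fun t : Fin (l.length + 1) => ((r, j, l.drop t) : Branch ι) := by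
    intro t t' h
    simp only [Prod.mk.injEq, true_and] at h
    have := congrArg List.length h
    simp only [List.length_drop] at this
    omega
  have hsub : Set.range (fun t : Fin (l.length + 1) => ((r, j, l.drop t) : Branch ι)) ⊆
      awakeBranches f g L k := by
    rintro _ ⟨t, rfl⟩
    exact suffix_mem_awake hz (List.drop_suffix _ _)
  have h := (Set.encard_le_encard hsub).trans hM
  rw [← Set.image_univ, hinj.encard_image] at h
  simp only [Set.encard_univ, ENat.card_eq_coe_fintype_card, Fintype.card_fin] at h
  have := Nat.cast_le.1 h
  change l.length < M
  omega

theorem length_lt_of_mem_seen {M : ℕ} {z : Branch ι} (hz : z ∈ seen f g L M) :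
    z.2.2.length < M := by
  obtain ⟨k, hk, hz⟩ := hz
  exact length_lt_of_mem hk hz

theorem seen_congr {L' : Branch ι → Label U}
    (hL : ∀ z, (L z).1 = (L' z).1 ∧ (L z).2.1 = (L' z).2.1) (M : ℕ) :
    seen f g L M = seen f g L' M := by
  have h : awakeBranches f g L = awakeBranches f g L' := by
    funext k
    have := mem_awake_congr (idealHistory_congr (f := f) (g := g) (L := L) (L' := L') (r := k)
      (fun z _ => hL z) k le_rfl)
    rw [awakeBranches, awakeBranches, this]
  rw [seen, seen, h]

end Awake

theorem valid_of_mem_awake {κ U : Type*} {f : Bool ⊕ κ → List Row → Row} {g : U → List Row → Row}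
    {L : Branch (Bool ⊕ κ) → Label U} (hf : ∀ b h, f (.inl b) h 2 = []) {k : ℕ}
    {z : Branch (Bool ⊕ κ)} (hz : Sum.inr z ∈ awake f g L k) : z.Valid := by
  obtain ⟨r, j, l⟩ := z
  rintro b rfl rfl
  have h := suffix_mem_awake hz (List.nil_suffix (l := l))
  cases k with
  | zero => exact inr_notMem_awake_zero _ h
  | succ k =>
    obtain ⟨m, -, h⟩ := exists_idealSend_ne h
    exact h (hf b _)

/-- The branches with at most `M` turns. -/
noncomputable def shortBranches (κ : Type*) [Finite κ] (M : ℕ) : Finset (Branch (Bool ⊕ κ)) :=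
  Set.Finite.toFinset (s := {z | z.2.2.length ≤ M})
    (((Set.finite_univ (α := Bool ⊕ κ)).prod
      ((Set.finite_univ (α := Fin 3)).prod (List.finite_length_le Bool M))).subset
        fun _ hz => ⟨trivial, trivial, hz⟩)

theorem mem_shortBranches {κ : Type*} [Finite κ] {M : ℕ} {z : Branch (Bool ⊕ κ)} :
    z ∈ shortBranches κ M ↔ z.2.2.length ≤ M := by
  simp [shortBranches]

section Sample

variable {V κ : Type*} (R : PolarRotation V) [Fintype κ] (M : ℕ) (u₀ : R.Inner)

/-- A random image of the ideal forest: the position and the orientation of each root other than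
the poles, and the label of each short branch. -/
abbrev Sample : Type _ := κ ⊕ shortBranches κ M → Label R.Inner

variable {R M}

open Classical in
/-- The labels of a sample; `u₀` is the identifier of the branches that are not short. -/
noncomputable def sampleLabel (X : Sample (κ := κ) R M) (z : Branch (Bool ⊕ κ)) : Label R.Inner :=
  if h : z ∈ shortBranches κ M then X (.inr ⟨z, h⟩) else (u₀, 0, false)

/-- The layout of a sample. -/
noncomputable def sampleLayout (X : Sample (κ := κ) R M) : Layout κ V where
  pos i := (X (.inl i)).1.1
  dir i := (X (.inl i)).2
  bit z := (sampleLabel u₀ X z).2.2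

variable (f : Bool ⊕ κ → List Row → Row) (g : R.Inner → List Row → Row)

/-- The nodes of the ideal forest that are seen in a sample, including the roots. -/
def seenAddress (X : Sample (κ := κ) R M) : Set (Address (Bool ⊕ κ)) :=
  {u | ∀ z, u = .inr z → z ∈ seen f g (sampleLabel u₀ X) M}

/-- The place of a node of the ideal forest in a sample. -/
noncomputable def samplePlace (X : Sample (κ := κ) R M) : Address (Bool ⊕ κ) → V :=
  place R (sampleLayout u₀ X)

variable {f g u₀}

theorem seenAddress_congr {X X' : Sample (κ := κ) R M}
    (h : ∀ z, (X (.inr z)).1 = (X' (.inr z)).1 ∧ (X (.inr z)).2.1 = (X' (.inr z)).2.1) :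
    seenAddress u₀ f g X = seenAddress u₀ f g X' := by
  have : seen f g (sampleLabel u₀ X) M = seen f g (sampleLabel u₀ X') M := by
    refine seen_congr (fun z => ?_) M
    by_cases hz : z ∈ shortBranches κ M
    · simpa [sampleLabel, hz] using h ⟨z, hz⟩
    · simp [sampleLabel, hz]
  rw [seenAddress, seenAddress, this]

theorem addressValid_of_mem_seenAddress (hf : ∀ b h, f (.inl b) h 2 = [])
    {X : Sample (κ := κ) R M} {u : Address (Bool ⊕ κ)} (hu : u ∈ seenAddress u₀ f g X) :
    AddressValid u := by
  intro z hz
  obtain ⟨k, -, hk⟩ := hu z hz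
  exact valid_of_mem_awake hf hk

variable [Fintype V]

open Classical in
/-- Varying the position of the root of `u` moves `u` to nearly all nodes of the graph, while a
node `w` in another tree stays where it is. -/
theorem card_collision_mul_le_of_root {i : κ} {u w : Address (Bool ⊕ κ)}
    (hu : addressRoot u = .inr i) (hw : addressRoot w ≠ .inr i) :
    (Finset.univ.filter fun X : Sample (κ := κ) R M => u ∈ seenAddress u₀ f g X ∧
        w ∈ seenAddress u₀ f g X ∧ samplePlace u₀ X u = samplePlace u₀ X w).card *
      Fintype.card R.Inner ≤
    (Finset.univ.filter fun X : Sample (κ := κ) R M => u ∈ seenAddress u₀ f g X ∧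
        w ∈ seenAddress u₀ f g X).card * 3 := by
  set act : Sample (κ := κ) R M → R.Inner → Sample (κ := κ) R M := fun X y =>
    Function.update X (.inl i) (y, (X (.inl i)).2) with hact
  set port : Sample (κ := κ) R M → Fin 3 := fun X =>
    match u with
    | .inl _ => 0
    | .inr z => (dart R (sampleLayout u₀ X) z).2 with hport
  have hinr : ∀ X y z, act X y (.inr z) = X (.inr z) := fun X y z => by simp [hact]
  have hseen : ∀ X y, seenAddress u₀ f g (act X y) = seenAddress u₀ f g X := fun X y =>
    seenAddress_congr fun z => by rw [hinr]; exact ⟨rfl, rfl⟩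
  have hlabel : ∀ X X' : Sample (κ := κ) R M, (∀ z, X (.inr z) = X' (.inr z)) →
      sampleLabel u₀ X = sampleLabel u₀ X' := by
    intro X X' h
    funext z
    by_cases hz : z ∈ shortBranches κ M <;> simp [sampleLabel, hz, h]
  suffices key : ((Finset.univ.filter fun X : Sample (κ := κ) R M => u ∈ seenAddress u₀ f g X ∧
        w ∈ seenAddress u₀ f g X ∧ samplePlace u₀ X u = samplePlace u₀ X w) ×ˢ
        (Finset.univ : Finset R.Inner)).card ≤
      ((Finset.univ.filter fun X : Sample (κ := κ) R M => u ∈ seenAddress u₀ f g X ∧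
        w ∈ seenAddress u₀ f g X) ×ˢ (Finset.univ : Finset (Fin 3))).card by
    rwa [Finset.card_product, Finset.card_product, Finset.card_univ, Finset.card_univ,
      Fintype.card_fin] at key
  refine Finset.card_le_card_of_injOn (fun x => (act x.1 x.2, port x.1)) ?_ ?_
  · rintro ⟨X, y⟩ hX
    simp only [Finset.coe_product, Set.mem_prod, Finset.mem_coe, Finset.mem_filter,
      Finset.mem_univ, true_and, and_true, hseen] at hX ⊢
    exact ⟨hX.1, hX.2.1⟩
  · rintro ⟨X, y⟩ hX ⟨X', y'⟩ hX' heq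
    simp only [Finset.coe_product, Set.mem_prod, Finset.mem_coe, Finset.mem_filter,
      Finset.mem_univ, true_and, and_true] at hX hX'
    simp only [Prod.mk.injEq] at heq
    obtain ⟨h1, h2⟩ := heq
    have hi := congrFun h1 (.inl i)
    simp only [hact, Function.update_self, Prod.mk.injEq] at hi
    have hoff : ∀ x, x ≠ .inl i → X x = X' x := by
      intro x hx
      have := congrFun h1 x
      simpa [hact, hx] using this
    have hl := hlabel X X' fun z => hoff _ (by simp)
    have hbit : (sampleLayout u₀ X).bit = (sampleLayout u₀ X').bit := by
      funext z
      simp only [sampleLayout, hl]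
    have hplw : samplePlace u₀ X w = samplePlace u₀ X' w := by
      have hroot : (sampleLayout u₀ X).rootPos R (addressRoot w) =
          (sampleLayout u₀ X').rootPos R (addressRoot w) ∧
          (sampleLayout u₀ X).rootDir (addressRoot w) =
          (sampleLayout u₀ X').rootDir (addressRoot w) := by
        rcases hwr : addressRoot w with b | i'
        · exact ⟨rfl, rfl⟩
        · have : X (.inl i') = X' (.inl i') := hoff _ fun h => hw (by
            rw [hwr]
            exact congrArg Sum.inr (Sum.inl.inj h))
          simp [Layout.rootPos, Layout.rootDir, sampleLayout, this]
      rcases w with r | ⟨r, j, l⟩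
      · exact hroot.1
      · exact congrArg Prod.fst (dart_congr hroot.1 hroot.2 fun b m _ => by rw [hbit])
    have hplu : samplePlace u₀ X u = samplePlace u₀ X' u := by
      rw [hX.2.2, hX'.2.2, hplw]
    have hpos : (sampleLayout u₀ X).rootPos R (addressRoot u) =
        (sampleLayout u₀ X').rootPos R (addressRoot u) := by
      rcases u with r | ⟨r, j, l⟩
      · exact hplu
      · exact rootPos_eq_of_dart_eq hbit (Prod.ext hplu h2)
    rw [hu] at hpos
    have hpos' : (X (.inl i)).1 = (X' (.inl i)).1 := Subtype.ext hpos
    have hXX : X = X' := by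
      funext x
      by_cases hx : x = .inl i
      · rw [hx]
        exact Prod.ext hpos' hi.2
      · exact hoff x hx
    rw [hXX, hi.1]

open Classical in
/-- Varying the bits of the last `h` proper ancestors of a branch `z` moves `z` to `2 ^ h` different
nodes, as the girth is large, and keeps `v` in its place. -/
theorem card_collision_mul_le_of_girth {γ h : ℕ} (hg : GirthAtLeast R.Adj γ) (hh : 2 * h + 1 < γ)
    (hf : ∀ b h, f (.inl b) h 2 = []) {z : Branch (Bool ⊕ κ)} {v : Address (Bool ⊕ κ)}
    (hzv : Sum.inr z ≠ v) (hc : SameComponent (.inr z) v)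
    (hd : addressDepth v ≤ addressDepth (Sum.inr z : Address (Bool ⊕ κ))) :
    (Finset.univ.filter fun X : Sample (κ := κ) R M => Sum.inr z ∈ seenAddress u₀ f g X ∧
        v ∈ seenAddress u₀ f g X ∧ samplePlace u₀ X (.inr z) = samplePlace u₀ X v).card * 2 ^ h ≤
    (Finset.univ.filter fun X : Sample (κ := κ) R M => Sum.inr z ∈ seenAddress u₀ f g X ∧
        v ∈ seenAddress u₀ f g X).card := by
  rcases Finset.eq_empty_or_nonempty (Finset.univ.filter fun X : Sample (κ := κ) R M =>
    Sum.inr z ∈ seenAddress u₀ f g X ∧ v ∈ seenAddress u₀ f g X ∧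
      samplePlace u₀ X (.inr z) = samplePlace u₀ X v) with hemp | ⟨X₀, hX₀⟩
  · rw [hemp]
    simp
  obtain ⟨r, j, l⟩ := z
  simp only [Finset.mem_filter, Finset.mem_univ, true_and] at hX₀
  have hval : Branch.Valid (r, j, l) := addressValid_of_mem_seenAddress hf hX₀.1 _ rfl
  have hvalv := addressValid_of_mem_seenAddress hf hX₀.2.1
  have hlM : l.length < M := length_lt_of_mem_seen (hX₀.1 _ rfl)
  have hhl : h ≤ l.length := by
    by_contra hlt
    refine place_ne_of_depth (Y := sampleLayout u₀ X₀) hg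
      (addressValid_of_mem_seenAddress hf hX₀.1) hvalv hzv hc ?_ hX₀.2.2
    have : addressDepth (Sum.inr (r, j, l) : Address (Bool ⊕ κ)) = l.length + 1 := rfl
    omega
  -- the branches whose bits are varied
  set W : Fin h → Branch (Bool ⊕ κ) := fun t => (r, j, l.drop (t + 1)) with hW
  have hWT : ∀ t, W t ∈ shortBranches κ M := by
    intro t
    rw [mem_shortBranches]
    simp only [hW, List.length_drop]
    omega
  have hWinj : ∀ t t', W t = W t' → t = t' := by
    intro t t' h
    simp only [hW, Prod.mk.injEq, true_and] at h
    have := congrArg List.length h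
    simp only [List.length_drop] at this
    omega
  have hWv : ∀ r' j' l' b m, v = .inr (r', j', l') → b :: m <:+ l' → ∀ t, (r', j', m) ≠ W t := by
    rintro r' j' l' b m rfl hm t heq
    simp only [hW, Prod.mk.injEq] at heq
    obtain ⟨rfl, rfl, rfl⟩ := heq
    obtain ⟨p, hp⟩ := exists_walk_suffix (κ := κ) hval (List.drop_suffix (t + 1) l)
    obtain ⟨q, hq⟩ := exists_walk_suffix (κ := κ) hval ((List.suffix_cons b _).trans hm)
    refine place_ne_of_walk hg (p.append q.reverse) ?_ hzv hX₀.2.2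
    have h1 : l'.length + 1 ≤ l.length + 1 := hd
    have h2 : (l.drop (t + 1)).length = l.length - (t + 1) := List.length_drop
    rw [SimpleGraph.Walk.length_append, SimpleGraph.Walk.length_reverse]
    omega
  set mask : (Fin h → Bool) → Branch (Bool ⊕ κ) → Bool := fun δ w =>
    decide (∃ t, w = W t ∧ δ t = true) with hmask
  have hmaskW : ∀ δ t, mask δ (W t) = δ t := by
    intro δ t
    cases hδ : δ t
    · simp only [hmask, decide_eq_false_iff_not]
      rintro ⟨t', h1, h2⟩
      rw [← hWinj _ _ h1, hδ] at h2
      simp at h2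
    · simp only [hmask, decide_eq_true_eq]
      exact ⟨t, rfl, hδ⟩
  have hmask0 : ∀ δ w, (∀ t, w ≠ W t) → mask δ w = false := by
    intro δ w hw
    simp only [hmask, decide_eq_false_iff_not]
    rintro ⟨t', h1, -⟩
    exact hw t' h1
  set act : Sample (κ := κ) R M → (Fin h → Bool) → Sample (κ := κ) R M := fun X δ x =>
    match x with
    | .inl i => X (.inl i)
    | .inr w => ((X (.inr w)).1, (X (.inr w)).2.1, xor (X (.inr w)).2.2 (mask δ w)) with hact
  have hseen : ∀ X δ, seenAddress u₀ f g (act X δ) = seenAddress u₀ f g X := fun X δ =>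
    seenAddress_congr fun z => ⟨rfl, rfl⟩
  suffices key : ((Finset.univ.filter fun X : Sample (κ := κ) R M =>
        Sum.inr (r, j, l) ∈ seenAddress u₀ f g X ∧ v ∈ seenAddress u₀ f g X ∧
          samplePlace u₀ X (.inr (r, j, l)) = samplePlace u₀ X v) ×ˢ
        (Finset.univ : Finset (Fin h → Bool))).card ≤
      (Finset.univ.filter fun X : Sample (κ := κ) R M =>
        Sum.inr (r, j, l) ∈ seenAddress u₀ f g X ∧ v ∈ seenAddress u₀ f g X).card by
    rw [Finset.card_product, Finset.card_univ, Fintype.card_fun, Fintype.card_bool,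
      Fintype.card_fin] at key
    exact key
  refine Finset.card_le_card_of_injOn (fun x => act x.1 x.2) ?_ ?_
  · rintro ⟨X, δ⟩ hX
    simp only [Finset.coe_product, Set.mem_prod, Finset.mem_coe, Finset.mem_filter,
      Finset.mem_univ, true_and, and_true, hseen] at hX ⊢
    exact ⟨hX.1, hX.2.1⟩
  rintro ⟨X, δ⟩ hX ⟨X', δ'⟩ hX' heq
  simp only [Finset.coe_product, Set.mem_prod, Finset.mem_coe, Finset.mem_filter,
    Finset.mem_univ, true_and, and_true] at hX hX'
  change act X δ = act X' δ' at heq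
  have hinl : ∀ i, X (.inl i) = X' (.inl i) := fun i => congrFun heq (.inl i)
  have hinr : ∀ w, (X (.inr w)).1 = (X' (.inr w)).1 ∧ (X (.inr w)).2.1 = (X' (.inr w)).2.1 ∧
      xor (X (.inr w)).2.2 (mask δ w) = xor (X' (.inr w)).2.2 (mask δ' w) := by
    intro w
    have := congrFun heq (.inr w)
    simpa only [hact, Prod.mk.injEq] using this
  have hoff : ∀ w, (∀ t, w ≠ W t) → (sampleLayout u₀ X).bit w = (sampleLayout u₀ X').bit w := by
    intro w hw
    by_cases hwT : w ∈ shortBranches κ M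
    · have := (hinr ⟨w, hwT⟩).2.2
      rw [hmask0 _ _ hw, hmask0 _ _ hw] at this
      simpa [sampleLayout, sampleLabel, hwT] using this
    · simp [sampleLayout, sampleLabel, hwT]
  have hroot : ∀ r, (sampleLayout u₀ X).rootPos R r = (sampleLayout u₀ X').rootPos R r ∧
      (sampleLayout u₀ X).rootDir r = (sampleLayout u₀ X').rootDir r := by
    rintro (b | i)
    · exact ⟨rfl, rfl⟩
    · simp [Layout.rootPos, Layout.rootDir, sampleLayout, hinl i]
  have hplv : samplePlace u₀ X v = samplePlace u₀ X' v := by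
    rcases v with r' | ⟨r', j', l'⟩
    · exact (hroot r').1
    · exact congrArg Prod.fst (dart_congr (hroot r').1 (hroot r').2 fun b m hm =>
        hoff _ (hWv r' j' l' b m rfl hm))
  have hplz : samplePlace u₀ X (.inr (r, j, l)) = samplePlace u₀ X' (.inr (r, j, l)) := by
    rw [hX.2.2, hX'.2.2, hplv]
  have hdart : dart R (sampleLayout u₀ X) (r, j, l.drop h) =
      dart R (sampleLayout u₀ X') (r, j, l.drop h) := by
    refine dart_congr (hroot r).1 (hroot r).2 fun b m hm => hoff _ fun t heq => ?_
    have h1 := hm.length_le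
    have h2 : m = l.drop (t + 1) := by
      simp only [hW, Prod.mk.injEq, true_and] at heq
      exact heq
    rw [h2] at h1
    simp only [List.length_cons, List.length_drop] at h1
    omega
  have hbits := bit_eq_of_place_eq (l₁ := l.take h) (l := l.drop h) hg hval (by
    rw [List.length_take]
    omega) hdart (by rw [List.take_append_drop]; exact hplz)
  have hon : ∀ t, (sampleLayout u₀ X).bit (W t) = (sampleLayout u₀ X').bit (W t) := by
    intro t
    have ht : (t : ℕ) < (l.take h).length := by
      rw [List.length_take]
      omega
    have h1 := hbits _ ((l.take h).drop (t + 1)) (by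
      rw [← List.drop_eq_getElem_cons ht]
      exact List.drop_suffix _ _)
    have h2 : (l.take h).drop (t + 1) ++ l.drop h = l.drop (t + 1) := by
      conv_rhs => rw [← List.take_append_drop h l]
      rw [List.drop_append_of_le_length (by omega)]
    rw [h2] at h1
    exact h1
  have hbit : ∀ w, (sampleLayout u₀ X).bit w = (sampleLayout u₀ X').bit w := by
    intro w
    by_cases hw : ∃ t, w = W t
    · obtain ⟨t, rfl⟩ := hw
      exact hon t
    · exact hoff w fun t ht => hw ⟨t, ht⟩
  have hXbit : ∀ w : shortBranches κ M, (X (.inr w)).2.2 = (X' (.inr w)).2.2 := by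
    intro w
    have := hbit w
    simpa [sampleLayout, sampleLabel] using this
  have hXX : X = X' := by
    funext x
    rcases x with i | w
    · exact hinl i
    · exact Prod.ext (hinr w).1 (Prod.ext (hinr w).2.1 (hXbit w))
  rw [Prod.mk.injEq]
  refine ⟨hXX, funext fun t => ?_⟩
  have h1 := (hinr ⟨W t, hWT t⟩).2.2
  rw [hXX] at h1
  rw [hmaskW, hmaskW] at h1
  generalize (X' (.inr ⟨W t, hWT t⟩)).2.2 = e at h1
  revert h1
  cases e <;> cases δ t <;> cases δ' t <;> simp

open Classical in
/-- A union bound over the pairs of nodes that are seen. -/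
theorem card_collision_le {γ h : ℕ} (hg : GirthAtLeast R.Adj γ) (hh : 2 * h + 1 < γ)
    (hf : ∀ b h, f (.inl b) h 2 = []) :
    ((Finset.univ.filter fun X : Sample (κ := κ) R M => ∃ u v, u ≠ v ∧ (∃ z, u = .inr z) ∧
        u ∈ seenAddress u₀ f g X ∧ v ∈ seenAddress u₀ f g X ∧
        samplePlace u₀ X u = samplePlace u₀ X v).card : ℝ) ≤
      (1 / 2 ^ h + 3 / Fintype.card R.Inner) * (M * (M + (2 + Fintype.card κ))) *
        Fintype.card (Sample (κ := κ) R M) := by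
  set ε : ℝ := 1 / 2 ^ h + 3 / Fintype.card R.Inner with hε
  set T := shortBranches κ M with hT
  set T' : Finset (Address (Bool ⊕ κ)) := Finset.univ.disjSum T with hT'
  set A : Branch (Bool ⊕ κ) → Address (Bool ⊕ κ) → Finset (Sample (κ := κ) R M) := fun z v =>
    Finset.univ.filter fun X => Sum.inr z ∈ seenAddress u₀ f g X ∧ v ∈ seenAddress u₀ f g X
    with hA
  set B : Branch (Bool ⊕ κ) → Address (Bool ⊕ κ) → Finset (Sample (κ := κ) R M) := fun z v =>
    Finset.univ.filter fun X => Sum.inr z ∈ seenAddress u₀ f g X ∧ v ∈ seenAddress u₀ f g X ∧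
      samplePlace u₀ X (.inr z) = samplePlace u₀ X v with hB
  have hm : (0 : ℝ) < Fintype.card R.Inner := by
    exact_mod_cast Fintype.card_pos_iff.2 ⟨u₀⟩
  have hcase : ∀ z v, Sum.inr z ≠ v → (SameComponent (.inr z) v →
      addressDepth v ≤ addressDepth (Sum.inr z : Address (Bool ⊕ κ))) →
      ((B z v).card : ℝ) ≤ ε * (A z v).card := by
    intro z v hzv hd
    have hA0 : (0 : ℝ) ≤ (A z v).card := Nat.cast_nonneg _
    by_cases hc : SameComponent (.inr z) v
    · have h1 := card_collision_mul_le_of_girth (u₀ := u₀) (f := f) (g := g) (M := M) hg hh hf hzv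
        hc (hd hc)
      have h2 : ((B z v).card : ℝ) * 2 ^ h ≤ (A z v).card := by exact_mod_cast h1
      rw [← le_div_iff₀ (by positivity)] at h2
      refine h2.trans ?_
      rw [hε, div_eq_mul_one_div, mul_comm]
      gcongr
      simp only [le_add_iff_nonneg_right]
      positivity
    · have h1 : (B z v).card * Fintype.card R.Inner ≤ (A z v).card * 3 := by
        have hsc := not_or.1 hc
        rcases hrz : addressRoot (Sum.inr z : Address (Bool ⊕ κ)) with b | i
        · rcases hrv : addressRoot v with b' | i
          · exact absurd ⟨b, b', hrz, hrv⟩ hsc.2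
          · have h := card_collision_mul_le_of_root (u₀ := u₀) (f := f) (g := g) (M := M) hrv
              (w := .inr z) (fun h => hsc.1 (h.trans hrv.symm))
            have e1 : (Finset.univ.filter fun X : Sample (κ := κ) R M => v ∈ seenAddress u₀ f g X ∧
                Sum.inr z ∈ seenAddress u₀ f g X ∧ samplePlace u₀ X v =
                  samplePlace u₀ X (.inr z)) = B z v := by
              ext X
              simp only [hB, Finset.mem_filter, Finset.mem_univ, true_and]
              tauto
            have e2 : (Finset.univ.filter fun X : Sample (κ := κ) R M => v ∈ seenAddress u₀ f g X ∧
                Sum.inr z ∈ seenAddress u₀ f g X) = A z v := by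
              ext X
              simp only [hA, Finset.mem_filter, Finset.mem_univ, true_and]
              tauto
            rwa [e1, e2] at h
        · exact card_collision_mul_le_of_root (u₀ := u₀) (f := f) (g := g) (M := M) hrz
            (fun h => hsc.1 (hrz.trans h.symm))
      have h2 : ((B z v).card : ℝ) * Fintype.card R.Inner ≤ (A z v).card * 3 := by exact_mod_cast h1
      rw [← le_div_iff₀ hm, mul_div_assoc, mul_comm] at h2
      refine h2.trans ?_
      rw [hε]
      gcongr
      simp only [le_add_iff_nonneg_left]
      positivity
  have hseenT : ∀ X : Sample (κ := κ) R M, ∀ z, Sum.inr z ∈ seenAddress u₀ f g X → z ∈ T := by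
    intro X z hz
    rw [hT, mem_shortBranches]
    exact (length_lt_of_mem_seen (hz z rfl)).le
  have hseenT' : ∀ X : Sample (κ := κ) R M, ∀ v ∈ seenAddress u₀ f g X, v ∈ T' := by
    intro X v hv
    rcases v with r | z
    · simp [hT']
    · simpa [hT'] using hseenT X z hv
  set P := (T ×ˢ T').filter fun x => Sum.inr x.1 ≠ x.2 ∧ (SameComponent (.inr x.1) x.2 →
      addressDepth x.2 ≤ addressDepth (Sum.inr x.1 : Address (Bool ⊕ κ))) with hP
  have hsub : (Finset.univ.filter fun X : Sample (κ := κ) R M => ∃ u v, u ≠ v ∧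
      (∃ z, u = .inr z) ∧ u ∈ seenAddress u₀ f g X ∧ v ∈ seenAddress u₀ f g X ∧
      samplePlace u₀ X u = samplePlace u₀ X v) ⊆ P.biUnion fun x => B x.1 x.2 := by
    intro X hX
    simp only [Finset.mem_filter, Finset.mem_univ, true_and] at hX
    obtain ⟨_, v, hne, ⟨z, rfl⟩, hz, hv, heq⟩ := hX
    simp only [Finset.mem_biUnion, hP, hB, Finset.mem_filter, Finset.mem_product, Finset.mem_univ,
      true_and]
    by_cases hd : SameComponent (.inr z) v →
        addressDepth v ≤ addressDepth (Sum.inr z : Address (Bool ⊕ κ))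
    · exact ⟨(z, v), ⟨⟨hseenT X z hz, hseenT' X v hv⟩, hne, hd⟩, hz, hv, heq⟩
    · push Not at hd
      rcases v with r | z'
      · exact absurd hd.2 (by simp [addressDepth])
      · exact ⟨(z', .inr z), ⟨⟨hseenT X z' hv, hseenT' X _ hz⟩, hne.symm, fun _ => hd.2.le⟩, hv, hz,
          heq.symm⟩
  have hcount : ∀ X : Sample (κ := κ) R M,
      ((P.filter fun x => X ∈ A x.1 x.2).card : ℝ) ≤ M * (M + (2 + Fintype.card κ)) := by
    intro X
    set F := T.filter fun z => Sum.inr z ∈ seenAddress u₀ f g X with hF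
    have hFM : F.card ≤ M := by
      have h1 := encard_seen_le (f := f) (g := g) (L := sampleLabel u₀ X) M
      have h2 : (F : Set (Branch (Bool ⊕ κ))) ⊆ seen f g (sampleLabel u₀ X) M := by
        intro z hz
        simp only [hF, Finset.coe_filter, Set.mem_ofPred_eq] at hz
        exact hz.2 z rfl
      have h3 := (Set.encard_le_encard h2).trans h1
      rw [Set.encard_coe_eq_coe_finsetCard] at h3
      exact_mod_cast h3
    have hsubP : (P.filter fun x => X ∈ A x.1 x.2) ⊆ F ×ˢ (Finset.univ.disjSum F) := by
      rintro ⟨z, v⟩ hx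
      simp only [hP, hA, Finset.mem_filter, Finset.mem_product, Finset.mem_univ, true_and] at hx
      rw [Finset.mem_product]
      refine ⟨Finset.mem_filter.2 ⟨hx.1.1.1, hx.2.1⟩, ?_⟩
      rcases v with r | z'
      · simp
      · rw [Finset.inr_mem_disjSum]
        exact Finset.mem_filter.2 ⟨hseenT X z' hx.2.2, hx.2.2⟩
    have h1 := Finset.card_le_card hsubP
    rw [Finset.card_product, Finset.card_disjSum, Finset.card_univ, Fintype.card_sum,
      Fintype.card_bool] at h1
    have h2 : F.card * (2 + Fintype.card κ + F.card) ≤ M * (M + (2 + Fintype.card κ)) :=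
      Nat.mul_le_mul hFM (by omega)
    exact_mod_cast h1.trans h2
  calc _ ≤ ((P.biUnion fun x => B x.1 x.2).card : ℝ) := by exact_mod_cast Finset.card_le_card hsub
    _ ≤ ∑ x ∈ P, ((B x.1 x.2).card : ℝ) := by exact_mod_cast Finset.card_biUnion_le
    _ ≤ ∑ x ∈ P, ε * ((A x.1 x.2).card : ℝ) := by
        refine Finset.sum_le_sum fun x hx => ?_
        rw [hP, Finset.mem_filter] at hx
        exact hcase _ _ hx.2.1 hx.2.2
    _ = ε * ∑ X : Sample (κ := κ) R M, ((P.filter fun x => X ∈ A x.1 x.2).card : ℝ) := by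
        rw [← Finset.mul_sum]
        congr 1
        have := Finset.sum_card_bipartiteAbove_eq_sum_card_bipartiteBelow
          (s := P) (t := (Finset.univ : Finset (Sample (κ := κ) R M))) (fun x X => X ∈ A x.1 x.2)
        simp only [Finset.bipartiteAbove, Finset.bipartiteBelow] at this
        rw [← Nat.cast_sum, ← Nat.cast_sum, ← this]
        simp
    _ ≤ ε * ∑ X : Sample (κ := κ) R M, ((M : ℝ) * (M + (2 + Fintype.card κ))) := by
        gcongr with X
        exact hcount X
    _ = _ := by
        rw [Finset.sum_const, Finset.card_univ, nsmul_eq_mul]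
        ring

end Sample

/-! ### Random networks -/

section Net

variable {V κ : Type*} (R : PolarRotation V)

/-- A random network on a polar rotation: a permutation, which gives the identifiers of the nodes
other than the poles, and renumberings of the ports of these nodes. -/
abbrev NetSample : Type _ := Equiv.Perm R.Inner × (R.Inner → Fin 3 × Bool)

variable {R} (e : κ → R.Inner) (u₀ : R.Inner) (N : NetSample R)

open Classical in
/-- The renumbering of the ports of a node; the ports of the poles are not renumbered. -/
noncomputable def netPort (v : V) : Fin 3 × Bool :=
  if h : ∀ b, v ≠ R.pole b then N.2 ⟨v, h⟩ else (0, false)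

/-- The positions of the nodes with identifiers `e i`, as roots of an ideal forest. -/
def netRoots : Layout κ V where
  pos i := (N.1.symm (e i)).1
  dir i := N.2 (N.1.symm (e i))
  bit _ := false

/-- The darts of the ideal forest if the hidden bit of a branch is read off the network, at the
position of the branch. -/
noncomputable def netDartList (r : Bool ⊕ κ) (j : Fin 3) : List Bool → V × Fin 3
  | [] => dartList R (netRoots e N) r j []
  | b :: l => (R.nbr (netDartList r j l).1
        ((netDartList r j l).2 + turn (xor b (netPort N (netDartList r j l).1).2)),
      R.back (netDartList r j l).1
        ((netDartList r j l).2 + turn (xor b (netPort N (netDartList r j l).1).2)))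

/-- The layout of the ideal forest that is read off a network. -/
noncomputable def netLayout : Layout κ V where
  pos := (netRoots e N).pos
  dir := (netRoots e N).dir
  bit z := (netPort N (netDartList e N z.1 z.2.1 z.2.2).1).2

theorem netDartList_eq (r : Bool ⊕ κ) (j : Fin 3) (l : List Bool) :
    netDartList e N r j l = dart R (netLayout e N) (r, j, l) := by
  induction l with
  | nil => cases r <;> rfl
  | cons b l ih =>
    have h : (netLayout e N).bit (r, j, l) = (netPort N (dart R (netLayout e N) (r, j, l)).1).2 := by
      rw [← ih]
      rfl
    simp only [dart, dartList, netDartList] at ih h ⊢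
    rw [ih, h]

open Classical in
/-- The label of the branches that enter the node `d.1` through its port `d.2`; the identifier is
`u₀` if this node is a pole. -/
noncomputable def netLabelAt (d : V × Fin 3) : Label R.Inner :=
  (if h : ∀ b, d.1 ≠ R.pole b then N.1 ⟨d.1, h⟩ else u₀,
    (portPerm (netPort N d.1)).symm d.2, (netPort N d.1).2)

/-- The labels of the ideal forest that are read off a network. -/
noncomputable def netLabel (z : Branch (Bool ⊕ κ)) : Label R.Inner :=
  netLabelAt u₀ N (dart R (netLayout e N) z)

theorem netLayout_bit (z : Branch (Bool ⊕ κ)) :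
    (netLayout e N).bit z = (netLabel e u₀ N z).2.2 := by
  change (netPort N (netDartList e N z.1 z.2.1 z.2.2).1).2 = _
  rw [netDartList_eq]
  rfl

open Classical in
/-- The behaviour of the nodes of a network, if the poles behave according to `f` and the node with
identifier `i` behaves according to `g i`. -/
noncomputable def netAct (f : Bool ⊕ κ → List Row → Row) (g : R.Inner → List Row → Row) (v : V) :
    List Row → Row :=
  if h : ∀ b, v ≠ R.pole b then g (N.1 ⟨v, h⟩) else f (.inl (decide (v = R.pole true)))

theorem netAct_pole (f : Bool ⊕ κ → List Row → Row) (g : R.Inner → List Row → Row) (b : Bool) :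
    netAct N f g (R.pole b) = f (.inl b) := by
  have h : ¬ ∀ b', R.pole b ≠ R.pole b' := fun h => h b rfl
  rw [netAct, dif_neg h]
  cases b
  · have : R.pole false ≠ R.pole true := fun h => by simpa using R.pole_injective h
    simp [this]
  · simp

variable {e u₀ N}

theorem netPort_of_inner (v : R.Inner) : netPort N v = N.2 v := by
  rw [netPort, dif_pos v.2]

theorem netPort_pole (b : Bool) : netPort N (R.pole b) = (0, false) := by
  rw [netPort, dif_neg]
  exact fun h => h b rfl

theorem netPort_root (r : Bool ⊕ κ) :
    netPort N ((netLayout e N).rootPos R r) = (netLayout e N).rootDir r := by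
  rcases r with b | i
  · exact netPort_pole b
  · exact netPort_of_inner _

variable {f : Bool ⊕ κ → List Row → Row} {g : R.Inner → List Row → Row}

/-- The poles are taken by roots, so that no other node is mapped to them before a collision. -/
theorem ne_pole_of_injOn {L : Branch (Bool ⊕ κ) → Label R.Inner} {Y : Layout κ V} {r : ℕ}
    (hinj : Set.InjOn (place R Y) (awake f g L r)) {z : Branch (Bool ⊕ κ)}
    (hz : Sum.inr z ∈ awake f g L r) (b : Bool) : (dart R Y z).1 ≠ R.pole b := fun h => by
  have : Sum.inr z = Sum.inl (Sum.inl b) := hinj hz (inl_mem_awake r (Sum.inl b)) h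
  simp at this

/-- A branch is entered through the link that leaves its parent through the exit port. -/
theorem dart_netLayout (z : Branch (Bool ⊕ κ)) :
    let w := place R (netLayout e N) (parent z)
    let i := portPerm (netPort N w) (labelExitPort (netLabel e u₀ N) z)
    dart R (netLayout e N) z = (R.nbr w i, R.back w i) := by
  obtain ⟨r, j, _ | ⟨b, l⟩⟩ := z
  · simp only [parent, place, netPort_root]
    rfl
  · have h1 : ∀ (x : Fin 3 × Bool) (i : Fin 3) (b : Bool),
        portPerm x ((portPerm x).symm i + turn b) = i + turn (xor b x.2) := by decide
    have h2 := netLayout_bit e u₀ N (r, j, l)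
    have h3 : labelExitPort (netLabel e u₀ N) (r, j, b :: l) =
        (netLabel e u₀ N (r, j, l)).2.1 + turn b := rfl
    simp only [parent, place, h3, netLabel, netLabelAt, h1]
    simp only [netLabel, netLabelAt] at h2
    rw [← h2]
    rfl

variable (e u₀) in
/-- The map from the ideal forest to a network is a local isomorphism. -/
theorem twist_nbr_place (u : Address (Bool ⊕ κ)) (j : Fin 3) :
    (R.twist fun v => portPerm (netPort N v)).nbr (place R (netLayout e N) u) j =
        place R (netLayout e N) ((forest fun z => (netLabel e u₀ N z).2.1).nbr u j) ∧
      (R.twist fun v => portPerm (netPort N v)).back (place R (netLayout e N) u) j =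
        (forest fun z => (netLabel e u₀ N z).2.1).back u j := by
  set P := R.twist fun v => portPerm (netPort N v) with hP
  have hchild : ∀ z, P.nbr (place R (netLayout e N) (parent z)) (labelExitPort (netLabel e u₀ N) z) =
      place R (netLayout e N) (.inr z) ∧
      P.back (place R (netLayout e N) (parent z)) (labelExitPort (netLabel e u₀ N) z) =
        (netLabel e u₀ N z).2.1 := by
    intro z
    have h := dart_netLayout (e := e) (u₀ := u₀) (N := N) z
    refine ⟨(congrArg Prod.fst h).symm, ?_⟩
    rw [netLabel, h]
    rfl
  have hchild' : ∀ z, (forest fun z => (netLabel e u₀ N z).2.1).nbr u j = .inr z →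
      parent z = u → (forest fun z => (netLabel e u₀ N z).2.1).back u j =
        (netLabel e u₀ N z).2.1 → labelExitPort (netLabel e u₀ N) z = j →
      P.nbr (place R (netLayout e N) u) j =
          place R (netLayout e N) ((forest fun z => (netLabel e u₀ N z).2.1).nbr u j) ∧
        P.back (place R (netLayout e N) u) j =
          (forest fun z => (netLabel e u₀ N z).2.1).back u j := by
    rintro z h1 rfl h3 rfl
    rw [h1, h3]
    exact hchild z
  rcases u with r | z
  · exact hchild' (r, j, []) rfl rfl rfl rfl
  · rcases forest_nbr_inr (fun z => (netLabel e u₀ N z).2.1) z j with ⟨rfl, h2, h3⟩ | ⟨z', h⟩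
    · obtain ⟨h4, h5⟩ := hchild z
      have h6 := P.nbr_back (place R (netLayout e N) (parent z)) (labelExitPort (netLabel e u₀ N) z)
      have h7 := P.back_back (place R (netLayout e N) (parent z)) (labelExitPort (netLabel e u₀ N) z)
      rw [h4, h5] at h6 h7
      exact ⟨h6.trans (by rw [h2]), h7.trans h3.symm⟩
    · exact hchild' z' h.1 h.2.1 h.2.2.1 h.2.2.2

theorem netAct_place {r k : ℕ} (he : ∀ i, f (.inr i) = g (e i))
    (hinj : Set.InjOn (place R (netLayout e N)) (awake f g (netLabel e u₀ N) r))
    {u : Address (Bool ⊕ κ)} (hur : u ∈ awake f g (netLabel e u₀ N) r)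
    (hu : u ∈ awake f g (netLabel e u₀ N) k) :
    netAct N f g (place R (netLayout e N) u) (idealHistory f g (netLabel e u₀ N) k u) =
      idealAct f g (netLabel e u₀ N) u (idealHistory f g (netLabel e u₀ N) k u) := by
  rcases u with r' | z
  · rcases r' with b | i
    · exact congrFun (netAct_pole N f g b) _
    · have : netAct N f g (place R (netLayout e N) (.inl (.inr i))) = g (e i) := by
        change netAct N f g (N.1.symm (e i)).1 = _
        rw [netAct, dif_pos (N.1.symm (e i)).2]
        simp
      rw [this, ← he]
      rfl
  · have h1 := ne_pole_of_injOn hinj hur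
    change _ = idealAct f g _ (.inr z) (idealHistory f g (netLabel e u₀ N) k (.inr z))
    rw [idealAct_inr_of_mem hu]
    change netAct N f g (dart R (netLayout e N) z).1 _ = g (netLabelAt u₀ N _).1 _
    rw [netAct, dif_pos h1, netLabelAt, dif_pos h1]

/-- As long as the nodes that are reached have distinct positions, the run on the network is the
image of the ideal run. -/
theorem twist_history_eq {r : ℕ} (he : ∀ i, f (.inr i) = g (e i))
    (hinj : Set.InjOn (place R (netLayout e N)) (awake f g (netLabel e u₀ N) r))
    (hspont : ∀ k < r, ∀ u ∉ Set.range e, g u (List.replicate k silence) = silence) :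
    ∀ k ≤ r, (∀ u ∈ awake f g (netLabel e u₀ N) k,
      (R.twist fun v => portPerm (netPort N v)).history (netAct N f g) k
        (place R (netLayout e N) u) = idealHistory f g (netLabel e u₀ N) k u) ∧
      ∀ v ∉ place R (netLayout e N) '' awake f g (netLabel e u₀ N) k,
        (R.twist fun v => portPerm (netPort N v)).history (netAct N f g) k v =
          List.replicate k silence := by
  refine Rotation.history_eq_of_injOn _ _ awake_mono
    (fun k u hu => idealHistory_of_notMem hu)
    (fun k u hu => idealAct_replicate_of_notMem hu k)
    (fun k u j h => nbr_mem_awake h) hinj (fun u _ j => (twist_nbr_place e u₀ u j).1)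
    (fun u _ j _ => (twist_nbr_place e u₀ u j).2) ?_ ?_
  · exact fun k hk u hu => netAct_place he hinj (awake_mono hk.le hu) hu
  · intro k hk v hv
    have h1 : ∀ b, v ≠ R.pole b := fun b hb =>
      hv ⟨.inl (.inl b), inl_mem_awake _ _, hb.symm⟩
    rw [netAct, dif_pos h1]
    refine hspont k hk _ ?_
    rintro ⟨i, hi⟩
    refine hv ⟨.inl (.inr i), inl_mem_awake _ _, ?_⟩
    change (N.1.symm (e i)).1 = v
    rw [hi, Equiv.symm_apply_apply]

end Net

/-! ### From random labels to random networks -/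

/-- A prescribed outcome of `j` draws from `m` values without repetition is at most twice as likely as
the same outcome of independent draws. -/
theorem pow_mul_factorial_sub_le {m j : ℕ} (h : 2 * j ^ 2 ≤ m) :
    m ^ j * (m - j).factorial ≤ 2 * m.factorial := by
  rcases Nat.eq_zero_or_pos j with rfl | hj
  · simp
    omega
  have hjm : j ≤ m := by nlinarith
  have hm : (0 : ℝ) < m := by exact_mod_cast (by omega : 0 < m)
  have hd : (m - j).factorial * m.descFactorial j = m.factorial := Nat.factorial_mul_descFactorial hjm
  have h1 : (m - j) ^ j ≤ m.descFactorial j :=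
    (Nat.pow_le_pow_left (by omega) j).trans (Nat.pow_sub_le_descFactorial m j)
  have h2 : m ^ j ≤ 2 * (m - j) ^ j := by
    have h3 : (j : ℝ) * (j / m) ≤ 1 / 2 := by
      rw [← mul_div_assoc, div_le_iff₀ hm]
      have : (2 * j ^ 2 : ℝ) ≤ m := by exact_mod_cast h
      nlinarith
    have h4 : (j : ℝ) / m ≤ 1 := by
      rw [div_le_one hm]
      exact_mod_cast hjm
    have h5 : (1 : ℝ) / 2 ≤ (1 - j / m) ^ j := by
      have := one_add_mul_le_pow (a := -((j : ℝ) / m)) (by linarith) j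
      rw [← sub_eq_add_neg] at this
      linarith
    have h6 : ((m - j : ℕ) : ℝ) ^ j = (m : ℝ) ^ j * (1 - j / m) ^ j := by
      rw [← mul_pow, mul_sub, mul_one, mul_div_cancel₀ _ hm.ne', Nat.cast_sub hjm]
    have h7 : (m : ℝ) ^ j ≤ 2 * ((m - j : ℕ) : ℝ) ^ j := by
      rw [h6]
      have : (0 : ℝ) < (m : ℝ) ^ j := pow_pos hm j
      nlinarith
    exact_mod_cast h7
  calc m ^ j * (m - j).factorial ≤ 2 * (m - j) ^ j * (m - j).factorial := by gcongr
    _ ≤ 2 * m.descFactorial j * (m - j).factorial := by gcongr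
    _ = 2 * ((m - j).factorial * m.descFactorial j) := by ring
    _ = 2 * m.factorial := by rw [hd]

theorem card_perm_eqOn_le {α : Type*} [Fintype α] [DecidableEq α] (S : Finset α)
    (σ₀ : Equiv.Perm α) :
    (Finset.univ.filter fun σ : Equiv.Perm α => ∀ s ∈ S, σ s = σ₀ s).card ≤
      (Fintype.card α - S.card).factorial := by
  have h1 : Fintype.card {τ : Equiv.Perm α // ∀ a, ¬ a ∉ S → τ a = a} =
      (Fintype.card α - S.card).factorial := by
    rw [← Fintype.card_congr (Equiv.Perm.subtypeEquivSubtypePerm (fun a => a ∉ S)),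
      Fintype.card_perm]
    congr 1
    rw [Fintype.card_subtype_compl, Fintype.card_coe]
  rw [← h1, ← Fintype.card_coe]
  refine Fintype.card_le_of_injective (fun σ => ⟨σ₀⁻¹ * σ.1, fun a ha => ?_⟩) ?_
  · have := (Finset.mem_filter.1 σ.2).2 a (not_not.1 ha)
    simp [this]
  · intro σ σ' h
    exact Subtype.ext (mul_left_cancel (congrArg Subtype.val h))

theorem card_fun_eqOn {α β : Type*} [Fintype α] [DecidableEq α] [Fintype β] (S : Finset α)
    (ν₀ : α → β) [DecidablePred fun ν : α → β => ∀ s ∈ S, ν s = ν₀ s] :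
    (Finset.univ.filter fun ν : α → β => ∀ s ∈ S, ν s = ν₀ s).card =
      Fintype.card β ^ (Fintype.card α - S.card) := by
  have : (Finset.univ.filter fun ν : α → β => ∀ s ∈ S, ν s = ν₀ s) =
      Fintype.piFinset fun a => if a ∈ S then {ν₀ a} else Finset.univ := by
    ext ν
    simp only [Finset.mem_filter, Finset.mem_univ, true_and, Fintype.mem_piFinset]
    refine forall_congr' fun a => ?_
    by_cases ha : a ∈ S <;> simp [ha]
  rw [this, Fintype.card_piFinset, ← Finset.prod_mul_prod_compl S,
    Finset.prod_eq_one fun a ha => by simp [ha], one_mul, ← Finset.card_compl, ← Finset.prod_const]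
  refine Finset.prod_congr rfl fun a ha => ?_
  rw [if_neg (Finset.mem_compl.1 ha), Finset.card_univ]

/-- Weighted double counting. -/
theorem card_le_of_weights {α β : Type*} (A : Finset α) (B : Finset β) (r : α → β → Prop)
    [∀ a b, Decidable (r a b)] (w : β → ℝ) {c : ℝ} (hA : ∀ a ∈ A, 1 ≤ ∑ b ∈ B with r a b, w b)
    (hB : ∀ b ∈ B, ((A.filter fun a => r a b).card : ℝ) * w b ≤ c) :
    (A.card : ℝ) ≤ c * B.card := by
  calc (A.card : ℝ) = ∑ _a ∈ A, (1 : ℝ) := by simp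
    _ ≤ ∑ a ∈ A, ∑ b ∈ B with r a b, w b := Finset.sum_le_sum hA
    _ = ∑ b ∈ B, ∑ a ∈ A with r a b, w b := by
        simp only [Finset.sum_filter]
        exact Finset.sum_comm
    _ = ∑ b ∈ B, ((A.filter fun a => r a b).card : ℝ) * w b := by simp
    _ ≤ ∑ _b ∈ B, c := Finset.sum_le_sum hB
    _ = c * B.card := by simp [mul_comm]

section Transfer

variable {V κ : Type*} (R : PolarRotation V) (f : Bool ⊕ κ → List Row → Row)
  (g : R.Inner → List Row → Row) (L L' : Branch (Bool ⊕ κ) → Label R.Inner) (Y Y' : Layout κ V)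
  (M : ℕ)

/-- Round `r` is the first one after which two of the nodes that have been reached have the same
position, and at most `M` nodes have been reached by then. -/
def FirstCollision (r : ℕ) : Prop :=
  Set.InjOn (place R Y) (awake f g L r) ∧ ¬ Set.InjOn (place R Y) (awake f g L (r + 1)) ∧
    (awakeBranches f g L (r + 1)).encard ≤ M

variable {R f g L L' Y Y' M}

theorem FirstCollision.unique {r r' : ℕ} (h : FirstCollision R f g L Y M r)
    (h' : FirstCollision R f g L Y M r') : r = r' := by
  rcases lt_trichotomy r r' with hlt | heq | hlt
  · exact absurd (h'.1.mono (awake_mono hlt)) h.2.1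
  · exact heq
  · exact absurd (h.1.mono (awake_mono hlt)) h'.2.1

theorem dart_congr_of_awake {r : ℕ} (hpos : Y.pos = Y'.pos) (hdir : Y.dir = Y'.dir)
    (hL : ∀ z ∈ awakeBranches f g L r, L z = L' z) (hY : ∀ z, Y.bit z = (L z).2.2)
    (hY' : ∀ z, Y'.bit z = (L' z).2.2) {z : Branch (Bool ⊕ κ)}
    (hz : Sum.inr z ∈ awake f g L (r + 1)) : dart R Y z = dart R Y' z := by
  obtain ⟨r', j, l⟩ := z
  refine dart_congr ?_ ?_ fun b m hm => ?_
  · cases r' <;> simp [Layout.rootPos, hpos]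
  · cases r' <;> simp [Layout.rootDir, hdir]
  · rw [hY, hY', hL _ (suffix_mem_awake_of_succ hz hm)]

theorem place_congr_of_awake {r : ℕ} (hpos : Y.pos = Y'.pos) (hdir : Y.dir = Y'.dir)
    (hL : ∀ z ∈ awakeBranches f g L r, L z = L' z) (hY : ∀ z, Y.bit z = (L z).2.2)
    (hY' : ∀ z, Y'.bit z = (L' z).2.2) :
    Set.EqOn (place R Y) (place R Y') (awake f g L (r + 1)) := by
  rintro (r' | z) hu
  · cases r' <;> simp [place, Layout.rootPos, hpos]
  · exact congrArg Prod.fst (dart_congr_of_awake hpos hdir hL hY hY' hu)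

theorem awake_congr_of_awake {r : ℕ} (hL : ∀ z ∈ awakeBranches f g L r, L z = L' z) :
    awake f g L r = awake f g L' r ∧ awake f g L (r + 1) = awake f g L' (r + 1) := by
  have h : ∀ z, Sum.inr z ∈ awake f g L r → (L z).1 = (L' z).1 ∧ (L z).2.1 = (L' z).2.1 :=
    fun z hz => by simp [hL z hz]
  exact ⟨mem_awake_congr (idealHistory_congr h r le_rfl), awake_succ_congr h⟩

/-- Whether a first collision happens in round `r` depends only on the roots and on the labels of
the nodes that have been reached before. -/
theorem FirstCollision.congr {r : ℕ} (h : FirstCollision R f g L Y M r) (hpos : Y.pos = Y'.pos)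
    (hdir : Y.dir = Y'.dir) (hL : ∀ z ∈ awakeBranches f g L r, L z = L' z)
    (hY : ∀ z, Y.bit z = (L z).2.2) (hY' : ∀ z, Y'.bit z = (L' z).2.2) :
    FirstCollision R f g L' Y' M r := by
  obtain ⟨h1, h2⟩ := awake_congr_of_awake hL
  have hp := place_congr_of_awake (R := R) hpos hdir hL hY hY'
  have h3 : awakeBranches f g L (r + 1) = awakeBranches f g L' (r + 1) := by
    rw [awakeBranches, h2, awakeBranches]
  obtain ⟨ha, hb, hc⟩ := h
  refine ⟨?_, ?_, h3 ▸ hc⟩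
  · rw [← h1]
    exact (hp.mono (awake_mono (Nat.le_succ r))).injOn_iff.1 ha
  · rwa [← h2, ← hp.injOn_iff]

end Transfer

section Transfer

variable {V κ : Type*} [Fintype κ] {R : PolarRotation V} (f : Bool ⊕ κ → List Row → Row)
  (g : R.Inner → List Row → Row) (M : ℕ) (e : κ → R.Inner) (u₀ : R.Inner)

/-- A sample and a network agree on the roots, and on the branches that are awake in round `r`. -/
def Agree (N : NetSample R) (X : Sample (κ := κ) R M) (r : ℕ) : Prop :=
  (∀ i, X (.inl i) = (N.1.symm (e i), N.2 (N.1.symm (e i)))) ∧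
    ∀ z ∈ awakeBranches f g (sampleLabel u₀ X) r, sampleLabel u₀ X z = netLabel e u₀ N z

open Classical in
/-- The roots, other than the poles, and the awake branches. -/
noncomputable def awakeIndices (L : Branch (Bool ⊕ κ) → Label R.Inner) (r : ℕ) :
    Finset (κ ⊕ shortBranches κ M) :=
  Finset.univ.filter fun x => ∀ z, x = .inr z → z.1 ∈ awakeBranches f g L r

variable {f g M e u₀}

theorem card_awakeIndices_le {L : Branch (Bool ⊕ κ) → Label R.Inner} {r : ℕ}
    (h : (awakeBranches f g L r).encard ≤ M) :
    (awakeIndices f g M L r).card ≤ M + Fintype.card κ := by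
  classical
  have h1 : (awakeIndices f g M L r).toRight.card ≤ M := by
    have h2 : ((awakeIndices f g M L r).toRight.map (Function.Embedding.subtype _) :
        Set (Branch (Bool ⊕ κ))) ⊆ awakeBranches f g L r := by
      intro z hz
      simp only [awakeIndices, Finset.coe_map, Set.mem_image, Finset.mem_coe,
        Finset.mem_toRight, Finset.mem_filter] at hz
      obtain ⟨z', ⟨-, h3⟩, rfl⟩ := hz
      exact h3 z' rfl
    have h3 := (Set.encard_le_encard h2).trans h
    rw [Set.encard_coe_eq_coe_finsetCard, Finset.card_map] at h3
    exact_mod_cast h3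
  have h2 : (awakeIndices f g M L r).toLeft.card ≤ Fintype.card κ := Finset.card_le_univ _
  have h3 := Finset.card_toLeft_add_card_toRight (u := awakeIndices f g M L r)
  omega

variable [Fintype V]

open Classical in
/-- The number of networks that agree with a sample up to its first collision: both components of
the network are prescribed at the positions of the nodes that are awake. -/
theorem card_agree_le {X : Sample (κ := κ) R M} {r : ℕ}
    (hX : FirstCollision R f g (sampleLabel u₀ X) (sampleLayout u₀ X) M r) :
    (Finset.univ.filter fun N : NetSample R => Agree f g M e u₀ N X r).card ≤
      (Fintype.card R.Inner - (awakeIndices f g M (sampleLabel u₀ X) r).card).factorial *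
        6 ^ (Fintype.card R.Inner - (awakeIndices f g M (sampleLabel u₀ X) r).card) := by
  set J := awakeIndices f g M (sampleLabel u₀ X) r with hJ
  have hlab : ∀ z : shortBranches κ M, sampleLabel u₀ X z.1 = X (.inr z) := fun z => by
    simp [sampleLabel]
  set v : κ ⊕ shortBranches κ M → R.Inner := fun x => match x with
    | .inl i => (X (.inl i)).1
    | .inr z => if h : ∀ b, (dart R (sampleLayout u₀ X) z.1).1 ≠ R.pole b then ⟨_, h⟩ else u₀
    with hv
  set addr : κ ⊕ shortBranches κ M → Address (Bool ⊕ κ) := Sum.map .inr Subtype.val with haddr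
  have hmem : ∀ x ∈ J, addr x ∈ awake f g (sampleLabel u₀ X) r := by
    rintro (i | z) hx
    · exact inl_mem_awake _ _
    · exact (Finset.mem_filter.1 hx).2 z rfl
  have hplace : ∀ x ∈ J, (v x : V) = place R (sampleLayout u₀ X) (addr x) := by
    rintro (i | z) hx
    · rfl
    · simp only [hv, dif_pos (ne_pole_of_injOn hX.1 (hmem _ hx))]
      rfl
  have hvinj : Set.InjOn v J := by
    intro x hx x' hx' h
    have h1 := hX.1 (hmem x hx) (hmem x' hx') (by rw [← hplace x hx, ← hplace x' hx', h])
    rcases x with i | z <;> rcases x' with i' | z'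
    · exact congrArg Sum.inl (Sum.inr.inj (Sum.inl.inj h1))
    · simp [haddr] at h1
    · simp [haddr] at h1
    · exact congrArg Sum.inr (Subtype.ext (Sum.inr.inj h1))
  -- the values of a network at the prescribed positions
  have hval : ∀ N, Agree f g M e u₀ N X r → ∀ x ∈ J,
      N.1 (v x) = (match x with | .inl i => e i | .inr z => (X (.inr z)).1) ∧
      N.2 (v x) = (match x with
        | .inl i => (X (.inl i)).2
        | .inr z => portShift (dart R (sampleLayout u₀ X) z.1).2 (X (.inr z)).2.1
            (X (.inr z)).2.2) := by
    rintro N ⟨hN1, hN2⟩ (i | z) hx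
    · simp [hv, hN1 i]
    · have hz := hmem _ hx
      have hd : dart R (sampleLayout u₀ X) z.1 = dart R (netLayout e N) z.1 := by
        refine dart_congr_of_awake (L := sampleLabel u₀ X) (L' := netLabel e u₀ N) (f := f) (g := g)
          (r := r) ?_ ?_ hN2 (fun z => rfl) (netLayout_bit e u₀ N) (awake_mono (Nat.le_succ r) hz)
        · funext i
          simp [sampleLayout, netLayout, netRoots, hN1 i]
        · funext i
          simp [sampleLayout, netLayout, netRoots, hN1 i]
      have hne : ∀ b, (dart R (sampleLayout u₀ X) z.1).1 ≠ R.pole b := ne_pole_of_injOn hX.1 hz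
      have h1 := hN2 z.1 hz
      rw [hlab] at h1
      simp only [netLabel, netLabelAt, ← hd] at h1
      simp only [hv, dif_pos hne, h1, portShift_symm, true_and]
      exact (netPort_of_inner (N := N) ⟨_, hne⟩).symm
  rcases Finset.eq_empty_or_nonempty
    (Finset.univ.filter fun N : NetSample R => Agree f g M e u₀ N X r) with hemp | ⟨N₀, hN₀⟩
  · rw [hemp]
    simp
  rw [Finset.mem_filter] at hN₀
  have hsub : (Finset.univ.filter fun N : NetSample R => Agree f g M e u₀ N X r) ⊆
      (Finset.univ.filter fun σ : Equiv.Perm R.Inner => ∀ s ∈ J.image v, σ s = N₀.1 s) ×ˢ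
      (Finset.univ.filter fun ν : R.Inner → Fin 3 × Bool => ∀ s ∈ J.image v, ν s = N₀.2 s) := by
    intro N hN
    simp only [Finset.mem_product, Finset.mem_filter, Finset.mem_univ, true_and,
      Finset.forall_mem_image] at hN ⊢
    refine ⟨fun x hx => ?_, fun x hx => ?_⟩
    · rw [(hval N hN x hx).1, (hval N₀ hN₀.2 x hx).1]
    · rw [(hval N hN x hx).2, (hval N₀ hN₀.2 x hx).2]
  refine (Finset.card_le_card hsub).trans ?_
  rw [Finset.card_product]
  have hcard : (J.image v).card = J.card := Finset.card_image_of_injOn hvinj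
  refine Nat.mul_le_mul ?_ (le_of_eq ?_)
  · rw [← hcard]
    exact card_perm_eqOn_le _ _
  · rw [card_fun_eqOn, hcard]
    rfl

open Classical in
/-- A first collision is about as likely in a random network as in a random sample. -/
theorem card_firstCollision_le
    (hm : 2 * (M + Fintype.card κ) ^ 2 ≤ Fintype.card R.Inner) :
    ((Finset.univ.filter fun N : NetSample R => ∃ r,
      FirstCollision R f g (netLabel e u₀ N) (netLayout e N) M r).card : ℝ) ≤
    2 * Fintype.card (NetSample R) / Fintype.card (Sample (κ := κ) R M) *
      (Finset.univ.filter fun X : Sample (κ := κ) R M => ∃ r,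
        FirstCollision R f g (sampleLabel u₀ X) (sampleLayout u₀ X) M r).card := by
  set m := Fintype.card R.Inner with hmdef
  set T := Fintype.card (κ ⊕ shortBranches κ M) with hT
  have hmpos : 0 < m := Fintype.card_pos_iff.2 ⟨u₀⟩
  have hlabel : Fintype.card (Label R.Inner) = 6 * m := by
    simp only [Label, Fintype.card_prod, Fintype.card_fin, Fintype.card_bool]
    ring
  have hsample : Fintype.card (Sample (κ := κ) R M) = (6 * m) ^ T := by
    rw [Fintype.card_fun, hlabel]
  have hnet : Fintype.card (NetSample R) = m.factorial * 6 ^ m := by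
    rw [Fintype.card_prod, Fintype.card_perm, Fintype.card_fun]
    rfl
  have hround : ∀ X : Sample (κ := κ) R M, ∃ r,
      (∃ r, FirstCollision R f g (sampleLabel u₀ X) (sampleLayout u₀ X) M r) →
        FirstCollision R f g (sampleLabel u₀ X) (sampleLayout u₀ X) M r := by
    intro X
    by_cases h : ∃ r, FirstCollision R f g (sampleLabel u₀ X) (sampleLayout u₀ X) M r
    · obtain ⟨r, hr⟩ := h
      exact ⟨r, fun _ => hr⟩
    · exact ⟨0, fun h' => absurd h' h⟩
  choose ρ hρ using hround
  -- a sample is weighted by the inverse of the number of samples that agree with it up to its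
  -- first collision
  refine card_le_of_weights _ _ (fun N X => Agree f g M e u₀ N X (ρ X))
    (fun X => ((6 * m : ℝ) ^ (awakeIndices f g M (sampleLabel u₀ X) (ρ X)).card) / (6 * m) ^ T)
    ?_ ?_
  · intro N hN
    obtain ⟨r, hr⟩ := (Finset.mem_filter.1 hN).2
    set J := awakeIndices f g M (netLabel e u₀ N) r with hJ
    obtain ⟨c, hc⟩ : ∃ c : Sample (κ := κ) R M, c = fun x => match x with
        | .inl i => (N.1.symm (e i), N.2 (N.1.symm (e i)))
        | .inr z => netLabel e u₀ N z.1 := ⟨_, rfl⟩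
    set S := Finset.univ.filter fun X : Sample (κ := κ) R M => ∀ x ∈ J, X x = c x with hS
    have hshort : ∀ z ∈ awakeBranches f g (netLabel e u₀ N) r, z ∈ shortBranches κ M := by
      intro z hz
      rw [mem_shortBranches]
      exact (length_lt_of_mem hr.2.2 (awakeBranches_mono (Nat.le_succ r) hz)).le
    have key : ∀ X ∈ S, FirstCollision R f g (sampleLabel u₀ X) (sampleLayout u₀ X) M r ∧
        Agree f g M e u₀ N X r ∧ awakeIndices f g M (sampleLabel u₀ X) r = J := by
      intro X hX
      have hX' := (Finset.mem_filter.1 hX).2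
      rw [hc] at hX'
      have h1 : ∀ i, X (.inl i) = (N.1.symm (e i), N.2 (N.1.symm (e i))) := fun i =>
        hX' (.inl i) (by simp [hJ, awakeIndices])
      have h2 : ∀ z ∈ awakeBranches f g (netLabel e u₀ N) r,
          netLabel e u₀ N z = sampleLabel u₀ X z := by
        intro z hz
        have h3 := hX' (.inr ⟨z, hshort z hz⟩) (by
          simp only [hJ, awakeIndices, Finset.mem_filter, Finset.mem_univ, true_and]
          rintro _ ⟨⟩
          exact hz)
        rw [sampleLabel, dif_pos (hshort z hz), h3]
      have h3 := (awake_congr_of_awake h2).1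
      have h4 : awakeBranches f g (netLabel e u₀ N) r = awakeBranches f g (sampleLabel u₀ X) r := by
        rw [awakeBranches, h3, awakeBranches]
      refine ⟨hr.congr ?_ ?_ h2 (netLayout_bit e u₀ N) (fun _ => rfl), ⟨h1, ?_⟩, ?_⟩
      · funext i
        simp [sampleLayout, netLayout, netRoots, h1 i]
      · funext i
        simp [sampleLayout, netLayout, netRoots, h1 i]
      · rw [← h4]
        exact fun z hz => (h2 z hz).symm
      · rw [hJ, awakeIndices, awakeIndices, h4]
    have hSsub : S ⊆ (Finset.univ.filter fun X : Sample (κ := κ) R M => ∃ r,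
        FirstCollision R f g (sampleLabel u₀ X) (sampleLayout u₀ X) M r).filter
          fun X => Agree f g M e u₀ N X (ρ X) := by
      intro X hX
      obtain ⟨h1, h2, -⟩ := key X hX
      have h3 : ρ X = r := (hρ X ⟨r, h1⟩).unique h1
      simp only [Finset.mem_filter, Finset.mem_univ, true_and]
      exact ⟨⟨r, h1⟩, h3 ▸ h2⟩
    have hScard : S.card = (6 * m) ^ (T - J.card) := by
      rw [hS, card_fun_eqOn, hlabel]
    have h6 : (0 : ℝ) < 6 * m := by positivity
    calc (1 : ℝ) = ∑ X ∈ S, (6 * m : ℝ) ^ J.card / (6 * m) ^ T := by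
          rw [Finset.sum_const, hScard, nsmul_eq_mul]
          push_cast
          rw [← mul_div_assoc, ← pow_add, Nat.sub_add_cancel (Finset.card_le_univ J),
            div_self (pow_pos h6 _).ne']
      _ = ∑ X ∈ S, (6 * m : ℝ) ^ (awakeIndices f g M (sampleLabel u₀ X) (ρ X)).card /
            (6 * m) ^ T := by
          refine Finset.sum_congr rfl fun X hX => ?_
          obtain ⟨h1, -, h2⟩ := key X hX
          rw [(hρ X ⟨r, h1⟩).unique h1, h2]
      _ ≤ _ := Finset.sum_le_sum_of_subset_of_nonneg hSsub fun _ _ _ => by positivity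
  · intro X hX
    have hX' := hρ X (Finset.mem_filter.1 hX).2
    set J := awakeIndices f g M (sampleLabel u₀ X) (ρ X) with hJ
    have hjle : J.card ≤ M + Fintype.card κ := card_awakeIndices_le
      ((Set.encard_le_encard (awakeBranches_mono (Nat.le_succ _))).trans hX'.2.2)
    have hj2 : 2 * J.card ^ 2 ≤ m := le_trans (by gcongr) hm
    have hjm : J.card ≤ m := by nlinarith [Nat.zero_le J.card]
    have h1 : ((Finset.univ.filter fun N : NetSample R => ∃ r, FirstCollision R f g
        (netLabel e u₀ N) (netLayout e N) M r).filter fun N => Agree f g M e u₀ N X (ρ X)).card ≤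
        (m - J.card).factorial * 6 ^ (m - J.card) :=
      (Finset.card_le_card fun N hN => by
        simp only [Finset.mem_filter, Finset.mem_univ, true_and] at hN ⊢
        exact hN.2).trans (card_agree_le hX')
    have h2 : (m - J.card).factorial * 6 ^ (m - J.card) * (6 * m) ^ J.card ≤
        2 * (m.factorial * 6 ^ m) := by
      calc _ = m ^ J.card * (m - J.card).factorial * (6 ^ (m - J.card) * 6 ^ J.card) := by
            rw [mul_pow]
            ring
        _ ≤ 2 * m.factorial * 6 ^ m := by
            rw [← pow_add, Nat.sub_add_cancel hjm]
            exact Nat.mul_le_mul_right _ (pow_mul_factorial_sub_le hj2)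
        _ = _ := by ring
    have h3 := (Nat.mul_le_mul_right ((6 * m) ^ J.card) h1).trans h2
    have h4 : (0 : ℝ) ≤ (6 * m) ^ T := by positivity
    rw [hsample, hnet]
    push_cast
    rw [← mul_div_assoc]
    refine div_le_div_of_nonneg_right ?_ h4
    exact_mod_cast h3

open Classical in
/-- A random network of large girth has a first collision with small probability. -/
theorem card_netSample_le {γ h : ℕ} (hg : GirthAtLeast R.Adj γ) (hh : 2 * h + 1 < γ)
    (hf : ∀ b h, f (.inl b) h 2 = [])
    (hm : 2 * (M + Fintype.card κ) ^ 2 ≤ Fintype.card R.Inner) :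
    ((Finset.univ.filter fun N : NetSample R => ∃ r,
      FirstCollision R f g (netLabel e u₀ N) (netLayout e N) M r).card : ℝ) ≤
    2 * ((1 / 2 ^ h + 3 / Fintype.card R.Inner) * (M * (M + (2 + Fintype.card κ)))) *
      Fintype.card (NetSample R) := by
  have h1 := card_firstCollision_le (f := f) (g := g) (e := e) (u₀ := u₀) hm
  have h2 : (Finset.univ.filter fun X : Sample (κ := κ) R M => ∃ r,
      FirstCollision R f g (sampleLabel u₀ X) (sampleLayout u₀ X) M r) ⊆
      Finset.univ.filter fun X : Sample (κ := κ) R M => ∃ u v, u ≠ v ∧ (∃ z, u = .inr z) ∧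
        u ∈ seenAddress u₀ f g X ∧ v ∈ seenAddress u₀ f g X ∧
        samplePlace u₀ X u = samplePlace u₀ X v := by
    intro X hX
    simp only [Finset.mem_filter, Finset.mem_univ, true_and] at hX ⊢
    obtain ⟨r, hr1, hr2, hr3⟩ := hX
    simp only [Set.InjOn, not_forall] at hr2
    obtain ⟨u, hu, v, hv, huv, hne⟩ := hr2
    have hseen : awake f g (sampleLabel u₀ X) (r + 1) ⊆ seenAddress u₀ f g X := by
      rintro w hw z rfl
      exact ⟨r + 1, hr3, hw⟩
    rcases u with i | z
    · rcases v with i' | z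
      · exact absurd (hr1 (inl_mem_awake r i) (inl_mem_awake r i') huv) hne
      · exact ⟨.inr z, _, fun h => hne h.symm, ⟨z, rfl⟩, hseen hv, hseen hu, huv.symm⟩
    · exact ⟨_, v, hne, ⟨z, rfl⟩, hseen hu, hseen hv, huv⟩
  have h3 := card_collision_le (M := M) (u₀ := u₀) (f := f) (g := g) hg hh hf
  have h4 : ((Finset.univ.filter fun X : Sample (κ := κ) R M => ∃ r,
      FirstCollision R f g (sampleLabel u₀ X) (sampleLayout u₀ X) M r).card : ℝ) ≤ _ :=
    le_trans (by exact_mod_cast Finset.card_le_card h2) h3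
  have h5 : (0 : ℝ) < Fintype.card (Sample (κ := κ) R M) := by
    have : Nonempty (Sample (κ := κ) R M) := ⟨fun _ => (u₀, 0, false)⟩
    exact_mod_cast Fintype.card_pos
  refine h1.trans ((mul_le_mul_of_nonneg_left h4 (by positivity)).trans (le_of_eq ?_))
  field_simp

end Transfer

/-! ### Algorithms on random networks -/

/-- A polar rotation from its neighbours; the ports that lead back are determined by these. -/
theorem exists_polarRotation {V : Type*} (nbr : V → Fin 3 → V)
    (hinj : ∀ v, Function.Injective (nbr v)) (hsymm : ∀ v i, ∃ j, nbr (nbr v i) j = v)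
    (pole : Bool → V) (hpole : Function.Injective pole) (hnbr : ∀ b, nbr (pole b) 2 = pole (!b)) :
    ∃ R : PolarRotation V, R.nbr = nbr ∧ R.pole = pole := by
  choose back hback using hsymm
  refine ⟨⟨⟨nbr, back, hback, fun v i => hinj v ?_⟩, hinj, pole, hpole, hnbr⟩, rfl, rfl⟩
  have h := hback (nbr v i) (back v i)
  rwa [hback v i] at h

/-- A tuple of messages, extended by empty messages. -/
def padRow {d : ℕ} (m : Fin d → Msg) : Row := fun i => if h : i.1 < d then m ⟨i, h⟩ else []

/-- The messages at the first `d` ports. -/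
def unpadRow (d : ℕ) (m : Row) : Fin d → Msg := fun j => if h : j.1 < 3 then m ⟨j, h⟩ else []

theorem padRow_castLE {d : ℕ} (hd : d ≤ 3) (m : Fin d → Msg) (j : Fin d) :
    padRow m (Fin.castLE hd j) = m j := by
  simp [padRow]

theorem unpadRow_apply {d : ℕ} (hd : d ≤ 3) (m : Row) (j : Fin d) :
    unpadRow d m j = m (Fin.castLE hd j) := by
  have : (j : ℕ) < 3 := by omega
  simp only [unpadRow, dif_pos this]
  rfl

theorem sum_length_padRow {d : ℕ} (hd : d ≤ 3) (m : Fin d → Msg) :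
    ∑ i, (padRow m i).length = ∑ j, (m j).length := by
  have h1 : ∑ j, (m j).length = ∑ i ∈ Finset.univ.map (Fin.castLEEmb hd), (padRow m i).length := by
    rw [Finset.sum_map]
    exact Finset.sum_congr rfl fun j _ => by
      rw [Fin.coe_castLEEmb, padRow_castLE]
  rw [h1]
  symm
  refine Finset.sum_subset (Finset.subset_univ _) fun i _ hi => ?_
  have : ¬ i.1 < d := fun h => hi (Finset.mem_map.2 ⟨⟨i, h⟩, Finset.mem_univ _, rfl⟩)
  simp [padRow, this]

section Realize

variable {V I : Type*} (R : PolarRotation V)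

open Classical in
/-- The degrees of the nodes if the edge between the poles is removed. -/
noncomputable def poleDeg (v : V) : ℕ := if ∀ b, v ≠ R.pole b then 3 else 2

theorem poleDeg_le (v : V) : poleDeg R v ≤ 3 := by
  rw [poleDeg]
  split_ifs <;> omega

variable {R} (N : NetSample R)

/-- The polar rotation with the port numbers of a network. -/
noncomputable def netRotation : Rotation V := R.twist fun v => portPerm (netPort N v)

theorem netRotation_nbr_injective (v : V) : Function.Injective ((netRotation N).nbr v) :=
  fun _ _ h => (portPerm _).injective (R.nbr_injective v h)

open Classical in
/-- The identifiers of a network, as a permutation of the nodes. -/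
noncomputable def netIdent : Equiv.Perm V := Equiv.Perm.ofSubtype N.1

theorem netIdent_inner (u : R.Inner) : netIdent N u = N.1 u := by
  simp [netIdent]

theorem netIdent_pole (b : Bool) : netIdent N (R.pole b) = R.pole b := by
  classical
  rw [netIdent, Equiv.Perm.ofSubtype_apply_of_not_mem]
  exact fun h => h b rfl

variable {G : SimpleGraph V}

theorem adj_netRotation
    (hG : ∀ u v, G.Adj u v ↔ R.Adj u v ∧ ¬ ∃ b, u = R.pole b ∧ v = R.pole !b)
    (v : V) (j : Fin (poleDeg R v)) :
    G.Adj v ((netRotation N).nbr v (Fin.castLE (poleDeg_le R v) j)) := by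
  rw [hG]
  refine ⟨⟨_, rfl⟩, ?_⟩
  rintro ⟨b, rfl, h⟩
  rw [← R.nbr_pole] at h
  have h1 : portPerm (netPort N (R.pole b)) _ = 2 := R.nbr_injective _ h
  rw [netPort_pole, portPerm_zero] at h1
  have h2 : poleDeg R (R.pole b) = 2 := by
    rw [poleDeg, if_neg]
    exact fun h => h b rfl
  have h3 := congrArg Fin.val h1
  have h4 := j.2
  simp at h3
  omega

theorem exists_port_of_adj
    (hG : ∀ u v, G.Adj u v ↔ R.Adj u v ∧ ¬ ∃ b, u = R.pole b ∧ v = R.pole !b)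
    {v w : V} (h : G.Adj v w) : ∃ j : Fin (poleDeg R v),
    (netRotation N).nbr v (Fin.castLE (poleDeg_le R v) j) = w := by
  obtain ⟨⟨i, rfl⟩, h2⟩ := (hG v w).1 h
  have h3 : ((portPerm (netPort N v)).symm i).1 < poleDeg R v := by
    by_cases hv : ∀ b, v ≠ R.pole b
    · rw [poleDeg, if_pos hv]
      exact Fin.is_lt _
    · rw [poleDeg, if_neg hv]
      push Not at hv
      obtain ⟨b, rfl⟩ := hv
      have h4 : i ≠ 2 := by
        rintro rfl
        exact h2 ⟨b, rfl, R.nbr_pole b⟩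
      have h5 : (portPerm (netPort N (R.pole b))).symm i = i := by
        rw [Equiv.symm_apply_eq, netPort_pole, portPerm_zero]
      rw [h5]
      omega
  refine ⟨⟨_, h3⟩, ?_⟩
  change R.nbr v (portPerm _ ((portPerm _).symm i)) = _
  rw [Equiv.apply_symm_apply]

variable (hG : ∀ u v, G.Adj u v ↔ R.Adj u v ∧ ¬ ∃ b, u = R.pole b ∧ v = R.pole !b)
  (ι : V ↪ I)

/-- The network given by a random permutation of the identifiers and random port numbers. -/
noncomputable def realize : Network V I where
  graph := G
  source := R.pole false
  target := R.pole true
  deg := poleDeg R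
  port v := Equiv.ofBijective
    (fun j => ⟨(netRotation N).nbr v (Fin.castLE (poleDeg_le R v) j), adj_netRotation N hG v j⟩)
    ⟨fun _ _ h => Fin.castLE_injective _ (netRotation_nbr_injective N v (congrArg Subtype.val h)),
      fun w => (exists_port_of_adj N hG w.2).imp fun _ h => Subtype.ext h⟩
  ident := (netIdent N).toEmbedding.trans ι

theorem castLE_realize_backPort (v : V) (j : Fin (poleDeg R v)) :
    Fin.castLE (poleDeg_le R ((netRotation N).nbr v (Fin.castLE (poleDeg_le R v) j)))
        ((realize N hG ι).backPort v j) =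
      (netRotation N).back v (Fin.castLE (poleDeg_le R v) j) := by
  refine netRotation_nbr_injective N ((netRotation N).nbr v (Fin.castLE (poleDeg_le R v) j)) ?_
  rw [(netRotation N).nbr_back]
  have := ((realize N hG ι).port ((realize N hG ι).nbr v j)).apply_symm_apply
    ⟨v, (realize N hG ι).adj_nbr v j⟩
  exact congrArg Subtype.val this

variable {Ω κ : Type*} [MeasurableSpace Ω] {b : ℕ} (A : DistAlg I b Ω) (s : Ω)
  (c : V → ℕ → Bool) (x : Bits b) (e : κ → R.Inner)

/-- The messages that a node sends, as a function of the messages it has received. -/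
def nodeAct (i : I) (ρ : Role b) (d : ℕ) (c : ℕ → Bool) (h : List Row) : Row :=
  padRow (A.act i ρ d s c (h.map (unpadRow d))).1

/-- The behaviour of the node with identifier `ι u`. -/
def innerAct (u : R.Inner) : List Row → Row := nodeAct A s (ι u) .plain 3 (c u)

/-- The behaviour of the roots of the ideal forest. -/
def rootAct : Bool ⊕ κ → List Row → Row
  | .inl b => nodeAct A s (ι (R.pole b)) (if b then .target else .source x) 2 (c (R.pole b))
  | .inr i => innerAct ι A s c (e i)

theorem rootAct_silent (b : Bool) (h : List Row) :
    rootAct ι A s c x e (.inl b) h 2 = [] := by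
  simp [rootAct, nodeAct, padRow]

variable [DecidableEq V]

theorem netAct_eq (v : V) (h : List Row) :
    netAct N (rootAct ι A s c x e) (innerAct ι A s c) v h =
      nodeAct A s ((realize N hG ι).ident v) ((realize N hG ι).role x v) (poleDeg R v)
        (c (netIdent N v)) h := by
  change _ = nodeAct A s (ι (netIdent N v)) _ _ _ h
  by_cases hv : ∀ b, v ≠ R.pole b
  · have h1 : netIdent N v = N.1 ⟨v, hv⟩ := netIdent_inner N ⟨v, hv⟩
    have h2 : (realize N hG ι).role x v = .plain := by
      exact (if_neg (hv false)).trans (if_neg (hv true))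
    rw [h1, h2, poleDeg, if_pos hv, netAct, dif_pos hv]
    rfl
  · have hv' := hv
    push Not at hv'
    obtain ⟨b, rfl⟩ := hv'
    have h2 : (realize N hG ι).role x (R.pole b) = if b then .target else .source x := by
      cases b
      · exact if_pos rfl
      · have : R.pole true ≠ R.pole false := fun h => by simpa using R.pole_injective h
        exact (if_neg this).trans (if_pos rfl)
    rw [netIdent_pole, h2, poleDeg, if_neg hv, netAct_pole]
    rfl

/-- The run of an algorithm on a network, where the random bits of a node are tied to its
identifier, as a run on a polar rotation. -/
theorem received_realize (k : ℕ) (v : V) :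
    A.received (realize N hG ι) x (s, fun v => c (netIdent N v)) k v =
      ((netRotation N).history (netAct N (rootAct ι A s c x e) (innerAct ι A s c)) k v).map
        (unpadRow (poleDeg R v)) := by
  induction k generalizing v with
  | zero => rfl
  | succ k ih =>
    rw [DistAlg.received, Rotation.history, List.map_cons, ih v]
    congr 1
    funext j
    refine Eq.trans ?_ (unpadRow_apply (poleDeg_le R v) _ j).symm
    rw [ih, netAct_eq N hG ι]
    refine Eq.trans ?_ (congrArg (padRow _) (castLE_realize_backPort N hG ι v j))
    exact (padRow_castLE (poleDeg_le R _) _ _).symm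

theorem netAct_history_eq_padRow (k : ℕ) (v : V) :
    netAct N (rootAct ι A s c x e) (innerAct ι A s c) v
      ((netRotation N).history (netAct N (rootAct ι A s c x e) (innerAct ι A s c)) k v) =
    padRow (A.step (realize N hG ι) x (s, fun v => c (netIdent N v)) k v).1 := by
  rw [netAct_eq N hG, nodeAct, DistAlg.step, received_realize]
  rfl

end Realize

/-! ### Executions with few messages -/

/-- In every execution on the network, at most `M` bits are sent before the algorithm stops. -/
def SendsAtMost {V I Ω : Type*} [DecidableEq V] [Fintype V] [MeasurableSpace Ω] {b : ℕ}
    (A : DistAlg I b Ω) (P : Network V I) (M : ℕ) : Prop :=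
  ∀ x ω r, A.Running P x ω r → ∑ k ∈ Finset.range (r + 1), A.sentBits P x ω k ≤ M

/-- At most `M` ports have been used. -/
theorem encard_sent_le {V I Ω : Type*} [DecidableEq V] [Fintype V] [MeasurableSpace Ω] {b : ℕ}
    {A : DistAlg I b Ω} {P : Network V I} {M : ℕ} (hM : SendsAtMost A P M)
    (hdeg : ∀ v, P.deg v ≤ 3) {x : Bits b} {ω : Ω × (V → ℕ → Bool)} {r : ℕ}
    (hrun : ∀ k < r, A.Running P x ω k) :
    {p : V × Fin 3 | ∃ k < r, padRow (A.step P x ω k p.1).1 p.2 ≠ []}.encard ≤ M := by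
  classical
  have hsum : ∑ k ∈ Finset.range r, A.sentBits P x ω k ≤ M := by
    rcases r with _ | r
    · simp
    · exact hM x ω r (hrun r (by omega))
  have hset : {p : V × Fin 3 | ∃ k < r, padRow (A.step P x ω k p.1).1 p.2 ≠ []} =
      ((Finset.univ.filter fun p : V × Fin 3 => ∃ k < r, padRow (A.step P x ω k p.1).1 p.2 ≠ [] :
        Finset (V × Fin 3)) : Set (V × Fin 3)) := by
    ext p
    simp
  rw [hset, Set.encard_coe_eq_coe_finsetCard, Nat.cast_le]
  refine le_trans ?_ hsum
  calc _ = ∑ p : V × Fin 3, if ∃ k < r, padRow (A.step P x ω k p.1).1 p.2 ≠ [] then 1 else 0 := by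
        rw [Finset.card_filter]
    _ ≤ ∑ p : V × Fin 3, ∑ k ∈ Finset.range r, (padRow (A.step P x ω k p.1).1 p.2).length := by
        refine Finset.sum_le_sum fun p _ => ?_
        split_ifs with h
        · obtain ⟨k, hk, h⟩ := h
          exact (List.length_pos_iff.2 h).trans_le (Finset.single_le_sum
            (f := fun k => (padRow (A.step P x ω k p.1).1 p.2).length)
            (fun _ _ => Nat.zero_le _) (Finset.mem_range.2 hk))
        · exact Nat.zero_le _
    _ = ∑ k ∈ Finset.range r, A.sentBits P x ω k := by
        rw [Finset.sum_comm]
        refine Finset.sum_congr rfl fun k _ => ?_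
        rw [Fintype.sum_prod_type]
        exact Finset.sum_congr rfl fun v _ => sum_length_padRow (hdeg v) _

namespace Rotation

theorem exists_message {V : Type*} (R : Rotation V) (f : V → List Row → Row) {k : ℕ} {v : V}
    (h : R.history f k v ≠ List.replicate k silence) :
    ∃ m < k, ∃ j, f (R.nbr v j) (R.history f m (R.nbr v j)) (R.back v j) ≠ [] := by
  induction k with
  | zero => exact absurd rfl h
  | succ k ih =>
    rw [Ne, history_succ_eq_replicate_iff, not_and_or, not_forall] at h
    rcases h with h | ⟨j, h⟩
    · obtain ⟨m, hm, h⟩ := ih h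
      exact ⟨m, by omega, h⟩
    · exact ⟨k, by omega, j, h⟩

end Rotation

/-- The nodes that would send a message in one of the first `k` rounds without having received
one. -/
def spontaneous {U : Type*} (g : U → List Row → Row) (k : ℕ) : Set U :=
  {u | ∃ m < k, g u (List.replicate m silence) ≠ silence}

theorem spontaneous_mono {U : Type*} (g : U → List Row → Row) : Monotone (spontaneous g) :=
  fun _ _ hkl _ ⟨m, hm, h⟩ => ⟨m, by omega, h⟩

section Execution

variable {V I : Type*} {R : PolarRotation V} {N : NetSample R} {G : SimpleGraph V}
  {hG : ∀ u v, G.Adj u v ↔ R.Adj u v ∧ ¬ ∃ b, u = R.pole b ∧ v = R.pole !b} {ι : V ↪ I}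
  {Ω κ : Type*} [MeasurableSpace Ω] {b : ℕ} {A : DistAlg I b Ω} {s : Ω}
  {c : V → ℕ → Bool} {x : Bits b} {e : κ → R.Inner} {u₀ : R.Inner} {M : ℕ} [DecidableEq V]

/-- What the target does in round `r` does not depend on the data, as long as there is no
collision. -/
theorem step_target_congr {x' : Bits b} {r : ℕ}
    (hspont : ∀ k < r, ∀ u ∉ Set.range e, innerAct ι A s c u (List.replicate k silence) = silence)
    (hinj : Set.InjOn (place R (netLayout e N))
      (awake (rootAct ι A s c x e) (innerAct ι A s c) (netLabel e u₀ N) r))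
    (hinj' : Set.InjOn (place R (netLayout e N))
      (awake (rootAct ι A s c x' e) (innerAct ι A s c) (netLabel e u₀ N) r)) :
    A.step (realize N hG ι) x (s, fun v => c (netIdent N v)) r (realize N hG ι).target =
      A.step (realize N hG ι) x' (s, fun v => c (netIdent N v)) r (realize N hG ι).target := by
  have hne : R.pole true ≠ R.pole false := fun h => by simpa using R.pole_injective h
  have hrole : ∀ x : Bits b, (realize N hG ι).role x (realize N hG ι).target = .target :=
    fun x => (if_neg hne).trans (if_pos rfl)
  have key : ∀ x : Bits b, Set.InjOn (place R (netLayout e N))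
      (awake (rootAct ι A s c x e) (innerAct ι A s c) (netLabel e u₀ N) r) →
      A.received (realize N hG ι) x (s, fun v => c (netIdent N v)) r (R.pole true) =
        (idealHistory (rootAct ι A s c x e) (innerAct ι A s c) (netLabel e u₀ N) r
          (.inl (.inl true))).map (unpadRow (poleDeg R (R.pole true))) := by
    intro x hinj
    rw [received_realize N hG ι A s c x e]
    congr 1
    exact (twist_history_eq (fun _ => rfl) hinj hspont r le_rfl).1 _ (inl_mem_awake r (Sum.inl true))
  have h1 := (idealHistory_congr_root (g := innerAct (R := R) ι A s c) (L := netLabel e u₀ N)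
    (f := rootAct ι A s c x e) (f' := rootAct ι A s c x' e) (t := Sum.inl true) rfl r).1
  have h2 : A.received (realize N hG ι) x (s, fun v => c (netIdent N v)) r
        (realize N hG ι).target =
      A.received (realize N hG ι) x' (s, fun v => c (netIdent N v)) r (realize N hG ι).target :=
    (key x hinj).trans ((congrArg _ h1).trans (key x' hinj').symm)
  rw [DistAlg.step, DistAlg.step, hrole, hrole, h2]

variable [Fintype V]

/-- Each node that sends spontaneously sends or receives a message. -/
theorem encard_spontaneous_le (hM : SendsAtMost A (realize N hG ι) M) {r : ℕ}
    (hrun : ∀ k < r, A.Running (realize N hG ι) x (s, fun v => c (netIdent N v)) k) :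
    (spontaneous (innerAct (R := R) ι A s c) r).encard ≤ (2 * M : ℕ) := by
  have hP := encard_sent_le hM (poleDeg_le R) hrun
  simp only [← netAct_history_eq_padRow N hG ι A s c x (Subtype.val : {_u : R.Inner // False} → _)]
    at hP
  set f := rootAct ι A s c x (Subtype.val : {_u : R.Inner // False} → _) with hf
  set g := innerAct (R := R) ι A s c with hg
  set P := {p : V × Fin 3 | ∃ k < r, netAct N f g p.1
    ((netRotation N).history (netAct N f g) k p.1) p.2 ≠ []} with hPdef
  have hinj : Function.Injective fun u : R.Inner => (N.1.symm u : V) := fun _ _ h =>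
    N.1.symm.injective (Subtype.ext h)
  have hsub : (fun u : R.Inner => (N.1.symm u : V)) '' spontaneous g r ⊆
      Prod.fst '' P ∪ (fun p : V × Fin 3 => (netRotation N).nbr p.1 p.2) '' P := by
    rintro _ ⟨u, ⟨m, hm, hu⟩, rfl⟩
    have hact : netAct N f g (N.1.symm u : V) = g u := by
      rw [netAct, dif_pos (N.1.symm u).2]
      simp
    by_cases hh : (netRotation N).history (netAct N f g) m (N.1.symm u : V) =
        List.replicate m silence
    · left
      rw [← hact, ← hh] at hu
      obtain ⟨i, hi⟩ := Function.ne_iff.1 hu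
      exact ⟨(_, i), ⟨m, hm, hi⟩, rfl⟩
    · right
      obtain ⟨m', hm', j, hj⟩ := (netRotation N).exists_message _ hh
      exact ⟨(_, _), ⟨m', by omega, hj⟩, (netRotation N).nbr_back _ _⟩
  rw [← hinj.encard_image]
  refine (Set.encard_le_encard hsub).trans ((Set.encard_union_le _ _).trans ?_)
  have h1 := (Set.encard_image_le Prod.fst P).trans hP
  have h2 := (Set.encard_image_le (fun p : V × Fin 3 => (netRotation N).nbr p.1 p.2) P).trans hP
  refine (add_le_add h1 h2).trans (le_of_eq ?_)
  push_cast
  ring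

/-- Each node of the ideal forest that has been reached stands for a link that has carried a
message. -/
theorem encard_awakeBranches_succ_le (hM : SendsAtMost A (realize N hG ι) M) {r : ℕ}
    (hrun : ∀ k < r + 1, A.Running (realize N hG ι) x (s, fun v => c (netIdent N v)) k)
    (hspont : ∀ k < r, ∀ u ∉ Set.range e, innerAct ι A s c u (List.replicate k silence) = silence)
    (hinj : Set.InjOn (place R (netLayout e N))
      (awake (rootAct ι A s c x e) (innerAct ι A s c) (netLabel e u₀ N) r)) :
    (awakeBranches (rootAct ι A s c x e) (innerAct ι A s c) (netLabel e u₀ N) (r + 1)).encard ≤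
      M := by
  have hP := encard_sent_le hM (poleDeg_le R) hrun
  simp only [← netAct_history_eq_padRow N hG ι A s c x e] at hP
  have hhist := twist_history_eq (f := rootAct ι A s c x e) (g := innerAct ι A s c)
    (fun _ => rfl) hinj hspont
  have hparent : ∀ z ∈ awakeBranches (rootAct ι A s c x e) (innerAct ι A s c) (netLabel e u₀ N)
      (r + 1), parent z ∈ awake (rootAct ι A s c x e) (innerAct ι A s c) (netLabel e u₀ N) r :=
    fun z hz => parent_mem_awake_of_succ hz
  set f := rootAct ι A s c x e with hf
  set g := innerAct (R := R) ι A s c with hg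
  set L := netLabel e u₀ N with hL
  have hinj' : Set.InjOn (fun z => (place R (netLayout e N) (parent z), labelExitPort L z))
      (awakeBranches f g L (r + 1)) := by
    intro z hz z' hz' h
    simp only [Prod.mk.injEq] at h
    have h1 := hinj (hparent z hz) (hparent z' hz') h.1
    have h2 := forest_nbr_parent (fun z => (L z).2.1) z
    have h3 := forest_nbr_parent (fun z => (L z).2.1) z'
    have h4 : exitPort (fun z => (L z).2.1) z = exitPort (fun z => (L z).2.1) z' := h.2
    rw [h1, h4, h3] at h2
    exact (Sum.inr.inj h2).symm
  rw [← hinj'.encard_image]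
  refine (Set.encard_le_encard ?_).trans hP
  rintro _ ⟨z, hz, rfl⟩
  obtain ⟨m, hm, hsend⟩ := exists_idealSend_ne hz
  have hmem := mem_awake_of_idealSend_ne hsend
  refine ⟨m, by omega, ?_⟩
  have h1 := (hhist m hm).1 _ hmem
  change netAct N f g (place R (netLayout e N) (parent z)) ((netRotation N).history _ m _) _ ≠ []
  have h2 : netAct N f g (place R (netLayout e N) (parent z)) (idealHistory f g L m (parent z)) =
      idealAct f g L (parent z) (idealHistory f g L m (parent z)) :=
    netAct_place (fun _ => rfl) hinj (awake_mono hm hmem) hmem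
  rw [netRotation, h1, h2]
  exact hsend

/-- As long as the algorithm runs and no first collision happens, the nodes that have been reached
have distinct positions. -/
theorem injOn_place_awake (he : Function.Injective e) (hM : SendsAtMost A (realize N hG ι) M)
    (hno : ∀ r, ¬ FirstCollision R (rootAct ι A s c x e) (innerAct ι A s c) (netLabel e u₀ N)
      (netLayout e N) M r) {r : ℕ}
    (hspont : ∀ k < r, ∀ u ∉ Set.range e, innerAct ι A s c u (List.replicate k silence) = silence)
    (hrun : ∀ k < r, A.Running (realize N hG ι) x (s, fun v => c (netIdent N v)) k) :
    Set.InjOn (place R (netLayout e N))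
      (awake (rootAct ι A s c x e) (innerAct ι A s c) (netLabel e u₀ N) r) := by
  induction r with
  | zero =>
    have hne : ∀ (i : κ) b, (N.1.symm (e i) : V) ≠ R.pole b := fun i => (N.1.symm (e i)).2
    rintro ((b | i) | z) hu ((b' | i') | z') hv h
    · exact congrArg (fun b => Sum.inl (Sum.inl b)) (R.pole_injective h)
    · exact absurd h.symm (hne i' b)
    · exact absurd hv (inr_notMem_awake_zero z')
    · exact absurd h (hne i b')
    · exact congrArg (fun i => Sum.inl (Sum.inr i)) (he (N.1.symm.injective (Subtype.ext h)))
    · exact absurd hv (inr_notMem_awake_zero z')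
    all_goals exact absurd hu (inr_notMem_awake_zero z)
  | succ r ih =>
    have hinj := ih (fun k hk => hspont k (by omega)) fun k hk => hrun k (by omega)
    by_contra hcon
    exact hno r ⟨hinj, hcon, encard_awakeBranches_succ_le hM hrun
      (fun k hk => hspont k (by omega)) hinj⟩

/-- Without collisions, at most one piece of data can be delivered. -/
theorem eq_of_delivers {x' : Bits b} (he : Function.Injective e)
    (hM : SendsAtMost A (realize N hG ι) M)
    (hspont : ∀ r, (spontaneous (innerAct (R := R) ι A s c) r).encard ≤ (2 * M : ℕ) →
      spontaneous (innerAct (R := R) ι A s c) r ⊆ Set.range e)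
    (hno : ∀ r, ¬ FirstCollision R (rootAct ι A s c x e) (innerAct ι A s c) (netLabel e u₀ N)
      (netLayout e N) M r)
    (hno' : ∀ r, ¬ FirstCollision R (rootAct ι A s c x' e) (innerAct ι A s c) (netLabel e u₀ N)
      (netLayout e N) M r)
    (hx : A.Delivers (realize N hG ι) x (s, fun v => c (netIdent N v)))
    (hx' : A.Delivers (realize N hG ι) x' (s, fun v => c (netIdent N v))) : x = x' := by
  have hsp : ∀ x r, (∀ k < r, A.Running (realize N hG ι) x (s, fun v => c (netIdent N v)) k) →
      ∀ k < r, ∀ u ∉ Set.range e, innerAct ι A s c u (List.replicate k silence) = silence := by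
    intro x r hrun k hk u hu
    by_contra hne
    exact hu (hspont r (encard_spontaneous_le hM hrun) ⟨k, hk, hne⟩)
  have key : ∀ x x' : Bits b, (∀ r, ¬ FirstCollision R (rootAct ι A s c x e) (innerAct ι A s c)
      (netLabel e u₀ N) (netLayout e N) M r) → (∀ r, ¬ FirstCollision R (rootAct ι A s c x' e)
      (innerAct ι A s c) (netLabel e u₀ N) (netLayout e N) M r) → ∀ r,
      (∀ k < r, A.Running (realize N hG ι) x (s, fun v => c (netIdent N v)) k) →
      (∀ k < r, A.Running (realize N hG ι) x' (s, fun v => c (netIdent N v)) k) →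
      A.step (realize N hG ι) x (s, fun v => c (netIdent N v)) r (realize N hG ι).target =
        A.step (realize N hG ι) x' (s, fun v => c (netIdent N v)) r (realize N hG ι).target :=
    fun x x' h h' r hrun hrun' => step_target_congr (hsp x r hrun)
      (injOn_place_awake he hM h (hsp x r hrun) hrun)
      (injOn_place_awake he hM h' (hsp x' r hrun') hrun')
  -- the round of the delivery is the same for both, as the algorithm stops then
  have hlt : ∀ x x' : Bits b, (∀ r, ¬ FirstCollision R (rootAct ι A s c x e) (innerAct ι A s c)
      (netLabel e u₀ N) (netLayout e N) M r) → (∀ r, ¬ FirstCollision R (rootAct ι A s c x' e)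
      (innerAct ι A s c) (netLabel e u₀ N) (netLayout e N) M r) → ∀ r r',
      (∀ k < r, A.Running (realize N hG ι) x (s, fun v => c (netIdent N v)) k) →
      (A.step (realize N hG ι) x (s, fun v => c (netIdent N v)) r (realize N hG ι).target).2 =
        some x →
      (∀ k < r', A.Running (realize N hG ι) x' (s, fun v => c (netIdent N v)) k) → ¬ r < r' := by
    intro x x' h h' r r' hr hrx hr' hlt
    have h1 := key x x' h h' r hr fun k hk => hr' k (by omega)
    rw [h1, hr' r hlt r le_rfl] at hrx
    simp at hrx
  obtain ⟨r, hr, hrx⟩ := hx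
  obtain ⟨r', hr', hrx'⟩ := hx'
  have h1 := hlt x x' hno hno' r r' hr hrx hr'
  have h2 := hlt x' x hno' hno r' r hr' hrx' hr
  obtain rfl : r = r' := by omega
  rw [key x x' hno hno' r hr hr', hrx'] at hrx
  exact (Option.some.inj hrx).symm

end Execution

/-! ### Averaging over networks and randomness -/

section Measurability

variable {V I Ω : Type*} [DecidableEq V] [MeasurableSpace Ω] {b : ℕ} (A : DistAlg I b Ω)
  (P : Network V I) (x : Bits b)

/-- What a node does takes countably many values, so that events can be split according to what the
node has received. -/
theorem measurableSet_act_received {k : ℕ} {u : V}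
    (hu : ∀ h, MeasurableSet {ω | A.received P x ω k u = h})
    (p : (Fin (P.deg u) → Msg) × Option (Bits b) → Prop) :
    MeasurableSet {ω | p (A.step P x ω k u)} := by
  have : {ω | p (A.step P x ω k u)} = ⋃ (h : List (Fin (P.deg u) → Msg))
      (a : (Fin (P.deg u) → Msg) × Option (Bits b)) (_ : p a), {ω | A.received P x ω k u = h} ∩
        (fun ω : Ω × (V → ℕ → Bool) => (ω.1, ω.2 u)) ⁻¹' {q |
          A.act (P.ident u) (P.role x u) (P.deg u) q.1 q.2 h = a} := by
    ext ω
    simp only [Set.mem_ofPred_eq, Set.mem_iUnion, Set.mem_inter_iff, Set.mem_preimage,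
      exists_prop]
    constructor
    · exact fun h => ⟨_, _, h, rfl, rfl⟩
    · rintro ⟨_, _, h, rfl, rfl⟩
      exact h
  rw [this]
  refine MeasurableSet.iUnion fun h => MeasurableSet.iUnion fun a => MeasurableSet.iUnion fun _ =>
    (hu h).inter ?_
  have hm : Measurable fun ω : Ω × (V → ℕ → Bool) => (ω.1, ω.2 u) :=
    measurable_fst.prodMk ((measurable_pi_apply u).comp measurable_snd)
  exact hm (A.measurableSet_act _ _ _ h a)

theorem measurableSet_received (k : ℕ) (v : V) (h : List (Fin (P.deg v) → Msg)) :
    MeasurableSet {ω | A.received P x ω k v = h} := by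
  induction k generalizing v with
  | zero =>
    by_cases hh : h = []
    · simp [DistAlg.received, hh]
    · simp [DistAlg.received, Ne.symm hh]
  | succ k ih =>
    rcases h with _ | ⟨m, h⟩
    · simp [DistAlg.received]
    · have : {ω | A.received P x ω (k + 1) v = m :: h} =
          (⋂ j, {ω | (A.step P x ω k (P.nbr v j)).1 (P.backPort v j) = m j}) ∩
            {ω | A.received P x ω k v = h} := by
        ext ω
        simp only [Set.mem_ofPred_eq, Set.mem_iInter, Set.mem_inter_iff, DistAlg.received,
          List.cons.injEq, funext_iff]
        rfl
      rw [this]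
      refine (MeasurableSet.iInter fun j => ?_).inter (ih v h)
      exact measurableSet_act_received A P x (ih _) fun a => a.1 (P.backPort v j) = m j

theorem measurableSet_delivers [Countable V] : MeasurableSet {ω | A.Delivers P x ω} := by
  have : {ω | A.Delivers P x ω} = ⋃ r, (⋂ k, ⋂ (_ : k < r), ⋂ m, ⋂ (_ : m ≤ k), ⋂ v,
      {ω | (A.step P x ω m v).2 = none}) ∩ {ω | (A.step P x ω r P.target).2 = some x} := by
    ext ω
    simp only [DistAlg.Delivers, DistAlg.Running, Set.mem_ofPred_eq, Set.mem_iUnion, Set.mem_iInter,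
      Set.mem_inter_iff]
  rw [this]
  have hstep : ∀ k v, ∀ a, MeasurableSet {ω | (A.step P x ω k v).2 = a} := fun k v a =>
    measurableSet_act_received A P x (measurableSet_received A P x k v) fun q => q.2 = a
  exact MeasurableSet.iUnion fun r => (MeasurableSet.iInter fun k => MeasurableSet.iInter fun _ =>
    MeasurableSet.iInter fun m => MeasurableSet.iInter fun _ => MeasurableSet.iInter fun v =>
      hstep m v none).inter (hstep r _ _)

end Measurability

theorem measurePreserving_coins_comp {V : Type*} [Fintype V] (σ : Equiv.Perm V) :
    MeasurePreserving (fun c : V → ℕ → Bool => fun v => c (σ v)) (DistAlg.coins V)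
      (DistAlg.coins V) := by
  exact measurePreserving_arrowCongr' _ _ σ.symm (MeasurableEquiv.refl (ℕ → Bool))
    fun _ => MeasurePreserving.id _

section Average

variable {V I Ω : Type*} [DecidableEq V] [Fintype V] {R : PolarRotation V} {G : SimpleGraph V}
  {hG : ∀ u v, G.Adj u v ↔ R.Adj u v ∧ ¬ ∃ b, u = R.pole b ∧ v = R.pole !b} {ι : V ↪ I}
  [MeasurableSpace Ω] {b : ℕ} {A : DistAlg I b Ω} {M : ℕ}

/-- The nodes that send spontaneously in the first `k` rounds, for those `k` for which there are
at most `K` of them. -/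
def starters {U : Type*} (g : U → List Row → Row) (K : ℕ) : Set U :=
  {u | ∃ k, (spontaneous g k).encard ≤ K ∧ u ∈ spontaneous g k}

open Classical in
/-- If, for all values of the randomness and the data, a random network has a first collision with
probability at most `δ`, then an algorithm that sends few messages does not route much better than
by guessing. -/
theorem le_of_solvesRouting (u₀ : R.Inner) {δ q : ℝ} (hδ : 0 ≤ δ)
    (hbad : ∀ (s : Ω) (c : V → ℕ → Bool) (x : Bits b),
      ((Finset.univ.filter fun N : NetSample R => ∃ r, FirstCollision R
        (rootAct ι A s c x (Subtype.val : starters (innerAct (R := R) ι A s c) (2 * M) → _))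
        (innerAct ι A s c) (netLabel Subtype.val u₀ N) (netLayout Subtype.val N) M r).card : ℝ) ≤
      δ * Fintype.card (NetSample R))
    (hM : ∀ N, SendsAtMost A (realize N hG ι) M) {μ : Measure Ω} [IsProbabilityMeasure μ]
    (hq : ∀ N x, ENNReal.ofReal q ≤
      (μ.prod (DistAlg.coins V)) {ω | A.Delivers (realize N hG ι) x ω}) :
    q ≤ 1 / 2 ^ b + δ := by
  have hcoins : IsProbabilityMeasure (DistAlg.coins V) := by
    rw [DistAlg.coins]
    infer_instance
  set E : NetSample R → Bits b → Set (Ω × (V → ℕ → Bool)) := fun N x =>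
    {ω | A.Delivers (realize N hG ι) x (ω.1, fun v => ω.2 (netIdent N v))} with hE
  have hpres : ∀ N : NetSample R, MeasurePreserving
      (fun ω : Ω × (V → ℕ → Bool) => (ω.1, fun v => ω.2 (netIdent N v)))
      (μ.prod (DistAlg.coins V)) (μ.prod (DistAlg.coins V)) := fun N =>
    (MeasurePreserving.id μ).prod (measurePreserving_coins_comp (netIdent N))
  have hmeas : ∀ N x, MeasurableSet (E N x) := fun N x =>
    (hpres N).measurable (measurableSet_delivers A (realize N hG ι) x)
  have hqE : ∀ N x, ENNReal.ofReal q ≤ (μ.prod (DistAlg.coins V)) (E N x) := fun N x =>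
    (hq N x).trans (le_of_eq ((hpres N).measure_preimage
      (measurableSet_delivers A (realize N hG ι) x).nullMeasurableSet).symm)
  -- for fixed randomness, at most one piece of data is delivered on a network without collisions
  have hpoint : ∀ ω, ∑ N, ∑ x, (E N x).indicator (1 : Ω × (V → ℕ → Bool) → ℝ≥0∞) ω ≤
      ENNReal.ofReal (Fintype.card (NetSample R) * (1 + 2 ^ b * δ)) := by
    rintro ⟨s, c⟩
    set e := (Subtype.val : starters (innerAct (R := R) ι A s c) (2 * M) → R.Inner) with he
    set B : Bits b → NetSample R → Prop := fun x N => ∃ r, FirstCollision R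
        (rootAct ι A s c x e) (innerAct ι A s c) (netLabel e u₀ N) (netLayout e N) M r with hB
    have hN : ∀ N, (Finset.univ.filter fun x => (s, c) ∈ E N x).card ≤
        1 + (Finset.univ.filter fun x => B x N).card := by
      intro N
      have hsub : (Finset.univ.filter fun x => (s, c) ∈ E N x) ⊆
          (Finset.univ.filter fun x => (s, c) ∈ E N x ∧ ¬ B x N) ∪
            Finset.univ.filter fun x => B x N := by
        intro x hx
        simp only [Finset.mem_union, Finset.mem_filter, Finset.mem_univ, true_and] at hx ⊢
        tauto
      refine (Finset.card_le_card hsub).trans ((Finset.card_union_le _ _).trans ?_)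
      refine Nat.add_le_add_right (Finset.card_le_one.2 fun x hx x' hx' => ?_) _
      simp only [Finset.mem_filter, Finset.mem_univ, true_and, hB, not_exists] at hx hx'
      refine eq_of_delivers Subtype.val_injective (hM N) ?_ hx.2 hx'.2 hx.1 hx'.1
      intro r hr u hu
      exact ⟨⟨u, r, hr, hu⟩, rfl⟩
    have hsum : ∑ N, ∑ x, (E N x).indicator (1 : Ω × (V → ℕ → Bool) → ℝ≥0∞) (s, c) =
        ((∑ N, (Finset.univ.filter fun x => (s, c) ∈ E N x).card : ℕ) : ℝ≥0∞) := by
      push_cast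
      refine Finset.sum_congr rfl fun N _ => ?_
      rw [Finset.card_filter]
      push_cast
      exact Finset.sum_congr rfl fun x _ => by simp [Set.indicator_apply]
    have hcount : ((∑ N, (Finset.univ.filter fun x => (s, c) ∈ E N x).card : ℕ) : ℝ) ≤
        Fintype.card (NetSample R) * (1 + 2 ^ b * δ) := by
      calc ((∑ N, (Finset.univ.filter fun x => (s, c) ∈ E N x).card : ℕ) : ℝ) ≤
          ((∑ N, (1 + (Finset.univ.filter fun x => B x N).card) : ℕ) : ℝ) := by
            exact_mod_cast Finset.sum_le_sum fun N _ => hN N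
        _ = Fintype.card (NetSample R) +
            ∑ x, ((Finset.univ.filter fun N => B x N).card : ℝ) := by
            rw [Finset.sum_add_distrib, Finset.sum_const, Finset.card_univ, smul_eq_mul, mul_one]
            have := Finset.sum_card_bipartiteAbove_eq_sum_card_bipartiteBelow
              (s := (Finset.univ : Finset (NetSample R))) (t := (Finset.univ : Finset (Bits b)))
              (r := fun N x => B x N)
            simp only [Finset.bipartiteAbove, Finset.bipartiteBelow] at this
            rw [this]
            push_cast
            rfl
        _ ≤ Fintype.card (NetSample R) + ∑ _x : Bits b, δ * Fintype.card (NetSample R) := by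
            gcongr with x
            exact hbad s c x
        _ = _ := by
            rw [Finset.sum_const, Finset.card_univ, Fintype.card_fun, Fintype.card_bool,
              Fintype.card_fin, nsmul_eq_mul]
            push_cast
            ring
    rw [hsum, ← ENNReal.ofReal_natCast]
    exact ENNReal.ofReal_le_ofReal hcount
  have hint : ∑ N, ∑ x, (μ.prod (DistAlg.coins V)) (E N x) ≤
      ENNReal.ofReal (Fintype.card (NetSample R) * (1 + 2 ^ b * δ)) := by
    calc ∑ N, ∑ x, (μ.prod (DistAlg.coins V)) (E N x) =
        ∫⁻ ω, ∑ N, ∑ x, (E N x).indicator (1 : Ω × (V → ℕ → Bool) → ℝ≥0∞) ω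
          ∂(μ.prod (DistAlg.coins V)) := by
          rw [lintegral_finsetSum _ fun N _ => Finset.measurable_sum _ fun x _ =>
            measurable_one.indicator (hmeas N x)]
          refine Finset.sum_congr rfl fun N _ => ?_
          rw [lintegral_finsetSum _ fun x _ => measurable_one.indicator (hmeas N x)]
          exact Finset.sum_congr rfl fun x _ => (lintegral_indicator_one (hmeas N x)).symm
      _ ≤ ∫⁻ _, ENNReal.ofReal (Fintype.card (NetSample R) * (1 + 2 ^ b * δ))
          ∂(μ.prod (DistAlg.coins V)) := lintegral_mono hpoint
      _ = _ := by simp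
  have hlow : ENNReal.ofReal (Fintype.card (NetSample R) * (2 ^ b * q)) ≤
      ∑ N, ∑ x, (μ.prod (DistAlg.coins V)) (E N x) := by
    calc ENNReal.ofReal (Fintype.card (NetSample R) * (2 ^ b * q)) =
        ∑ _N : NetSample R, ∑ _x : Bits b, ENNReal.ofReal q := by
          rw [ENNReal.ofReal_mul (by positivity), ENNReal.ofReal_mul (by positivity)]
          simp [ENNReal.ofReal_pow]
      _ ≤ _ := Finset.sum_le_sum fun N _ => Finset.sum_le_sum fun x _ => hqE N x
  have hpos : (0 : ℝ) < Fintype.card (NetSample R) := by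
    have : Nonempty (NetSample R) := ⟨1, fun _ => (0, false)⟩
    exact_mod_cast Fintype.card_pos
  have hfin := (ENNReal.ofReal_le_ofReal_iff (by positivity)).1 (hlow.trans hint)
  have h2 : (0 : ℝ) < 2 ^ b := by positivity
  have h3 : 2 ^ b * q ≤ 1 + 2 ^ b * δ := le_of_mul_le_mul_left hfin hpos
  have h4 : (2 : ℝ) ^ b * (1 / 2 ^ b + δ) = 1 + 2 ^ b * δ := by field_simp
  exact le_of_mul_le_mul_left (h3.trans h4.ge) h2

end Average

/-! ### The lower bound for welded trees -/

/-- If no messages are sent, then only the roots are awake, and they have distinct positions. -/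
theorem FirstCollision.pos {V κ : Type*} {R : PolarRotation V} {f : Bool ⊕ κ → List Row → Row}
    {g : R.Inner → List Row → Row} {L : Branch (Bool ⊕ κ) → Label R.Inner} {Y : Layout κ V}
    {M r : ℕ} (h : FirstCollision R f g L Y M r) : 0 < M := by
  rw [Nat.pos_iff_ne_zero]
  rintro rfl
  have h0 : awakeBranches f g L (r + 1) = ∅ := by simpa using h.2.2
  refine h.2.1 (h.1.mono ?_)
  rintro (i | z) hz
  · exact inl_mem_awake r i
  · have : z ∈ awakeBranches f g L (r + 1) := hz
    simp [h0] at this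

theorem PolarRotation.card_le_card_inner {V : Type*} [Fintype V] (R : PolarRotation V)
    [Fintype R.Inner] : Fintype.card V ≤ Fintype.card R.Inner + 2 := by
  classical
  have h : Function.Surjective (Sum.elim Subtype.val R.pole : R.Inner ⊕ Bool → V) := by
    intro v
    by_cases hv : ∀ b, v ≠ R.pole b
    · exact ⟨.inl ⟨v, hv⟩, rfl⟩
    · push Not at hv
      obtain ⟨b, hb⟩ := hv
      exact ⟨.inr b, hb.symm⟩
  have := Fintype.card_le_of_surjective _ h
  rwa [Fintype.card_sum, Fintype.card_bool] at this

theorem DistAlg.sendsAtMost_of_cost_le {V I Ω : Type*} [DecidableEq V] [Fintype V]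
    [MeasurableSpace Ω] {b : ℕ} {A : DistAlg I b Ω} {P : Network V I} {t : ℝ≥0∞} (ht : t ≠ ⊤)
    (h : ∀ x ω, A.cost P x ω ≤ t) : SendsAtMost A P ⌊t.toReal⌋₊ := by
  intro x ω r hr
  refine Nat.le_floor ?_
  have h1 : ((∑ k ∈ Finset.range (r + 1), A.sentBits P x ω k : ℕ) : ℝ≥0∞) ≤ t := by
    refine le_trans ?_ (h x ω)
    rw [DistAlg.cost]
    refine le_trans ?_ (le_of_eq (tsum_subtype {r | A.Running P x ω r}
      fun r => (A.sentBits P x ω r : ℝ≥0∞)).symm)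
    refine le_trans (le_of_eq ?_) (ENNReal.sum_le_tsum (Finset.range (r + 1)))
    push_cast
    refine Finset.sum_congr rfl fun k hk => ?_
    have hk' : k ∈ {r | A.Running P x ω r} := fun m hm v =>
      hr m (by have := Finset.mem_range.1 hk; omega) v
    rw [Set.indicator_of_mem hk']
  have h2 := ENNReal.toReal_mono ht h1
  rwa [ENNReal.toReal_natCast] at h2

open Classical in
/-- The advantage over guessing of an algorithm that sends few messages, on graphs of large
girth. -/
theorem le_of_girthAtLeast {V I Ω : Type*} [dV : DecidableEq V] [Fintype V] {R : PolarRotation V}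
    {G : SimpleGraph V} {hG : ∀ u v, G.Adj u v ↔ R.Adj u v ∧ ¬ ∃ b, u = R.pole b ∧ v = R.pole !b}
    {ι : V ↪ I} [MeasurableSpace Ω] {b M m γ h : ℕ} {A : DistAlg I b Ω} {q : ℝ} (u₀ : R.Inner)
    (hM : ∀ N, SendsAtMost A (realize N hG ι) M) {μ : Measure Ω} [IsProbabilityMeasure μ]
    (hq : ∀ N x, ENNReal.ofReal q ≤
      (μ.prod (DistAlg.coins V)) {ω | A.Delivers (realize N hG ι) x ω})
    (hg : GirthAtLeast R.Adj γ) (hh : 2 * h + 1 < γ) (hm0 : 0 < m)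
    (hmV : m + 2 ≤ Fintype.card V) (hm : 18 * M ^ 2 ≤ m) :
    q ≤ 1 / 2 ^ b + 2 * ((1 / 2 ^ h + 3 / m) * (M * (3 * M + 2))) := by
  obtain rfl : dV = fun _ _ => Classical.propDecidable _ := Subsingleton.elim _ _
  have hmI : m ≤ Fintype.card R.Inner := by
    have := R.card_le_card_inner
    omega
  refine le_of_solvesRouting u₀ (by positivity) (fun s c x => ?_) hM hq
  have hfin : Finite (starters (innerAct (R := R) ι A s c) (2 * M)) := inferInstance
  have : Fintype (starters (innerAct (R := R) ι A s c) (2 * M)) := Fintype.ofFinite _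
  have hcard : Fintype.card (starters (innerAct (R := R) ι A s c) (2 * M)) ≤ 2 * M := by
    have h1 := encard_iUnion_small_le (spontaneous_mono (innerAct (R := R) ι A s c)) (2 * M)
    change (starters (innerAct (R := R) ι A s c) (2 * M)).encard ≤ _ at h1
    rw [← Set.coe_fintypeCard] at h1
    exact_mod_cast h1
  have hm' : 2 * (M + Fintype.card (starters (innerAct (R := R) ι A s c) (2 * M))) ^ 2 ≤
      Fintype.card R.Inner := by
    calc _ ≤ 2 * (M + 2 * M) ^ 2 := by gcongr
      _ = 18 * M ^ 2 := by ring
      _ ≤ _ := hm.trans hmI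
  have h1 := card_netSample_le (f := rootAct ι A s c x Subtype.val)
    (g := innerAct (R := R) ι A s c) (e := Subtype.val) (u₀ := u₀) hg hh
    (fun b h => rootAct_silent ι A s c x _ b h) hm'
  refine h1.trans ?_
  have h2 : (Fintype.card (starters (innerAct (R := R) ι A s c) (2 * M)) : ℝ) ≤ 2 * M := by
    exact_mod_cast hcard
  have h3 : (m : ℝ) ≤ Fintype.card R.Inner := by exact_mod_cast hmI
  have h4 : (0 : ℝ) < m := by exact_mod_cast hm0
  have h5 : (M : ℝ) + (2 + Fintype.card (starters (innerAct (R := R) ι A s c) (2 * M))) ≤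
      3 * M + 2 := by linarith
  refine mul_le_mul_of_nonneg_right (mul_le_mul_of_nonneg_left (mul_le_mul ?_
    (mul_le_mul_of_nonneg_left h5 (by positivity)) (by positivity) (by positivity))
    (by norm_num)) (by positivity)
  gcongr

/-- The final computation; `d` is the advantage over guessing, and `2 * h + 2` is about half the
height. -/
theorem rpow_mul_rpow_le {n h m M : ℕ} {d : ℝ} (hd0 : 0 ≤ d) (hd1 : d ≤ 1) (hM : 1 ≤ M)
    (hm : 2 ^ (n + 1) ≤ m) (H : n < 7 ∨ m < 18 * M ^ 2 ∨
      n ≤ 4 * h + 10 ∧ d ≤ 2 * ((1 / 2 ^ h + 3 / m) * (M * (3 * M + 2)))) :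
    1 / 100 * d ^ ((1 : ℝ) / 5) * (2 : ℝ) ^ ((n : ℝ) / 20) ≤ M := by
  have ht0 : (0 : ℝ) ≤ d ^ ((1 : ℝ) / 5) := by positivity
  have ht1 : d ^ ((1 : ℝ) / 5) ≤ 1 := Real.rpow_le_one hd0 hd1 (by norm_num)
  have ht5 : (d ^ ((1 : ℝ) / 5)) ^ 5 = d := by
    rw [← Real.rpow_natCast, ← Real.rpow_mul hd0]
    norm_num
  have hx1 : (1 : ℝ) ≤ 2 ^ ((n : ℝ) / 20) := Real.one_le_rpow (by norm_num) (by positivity)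
  have hx20 : ((2 : ℝ) ^ ((n : ℝ) / 20)) ^ 20 = 2 ^ n := by
    rw [← Real.rpow_natCast, ← Real.rpow_mul (by norm_num), ← Real.rpow_natCast]
    congr 1
    push_cast
    ring
  have hM1 : (1 : ℝ) ≤ M := by exact_mod_cast hM
  have hmR : (2 : ℝ) ^ (n + 1) ≤ m := by exact_mod_cast hm
  generalize d ^ ((1 : ℝ) / 5) = t at *
  generalize (2 : ℝ) ^ ((n : ℝ) / 20) = x at *
  suffices htx : t * x ≤ 100 * M by linarith
  have hx0 : 0 ≤ x := by linarith
  have htxx : t * x ≤ x := mul_le_of_le_one_left hx0 ht1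
  rcases H with H | H | ⟨H1, H2⟩
  · have : x ^ 20 ≤ 2 ^ 20 := by
      rw [hx20]
      exact pow_le_pow_right₀ (by norm_num) (by omega)
    have := (pow_le_pow_iff_left₀ hx0 (by norm_num) (by norm_num)).1 this
    linarith
  · have h1 : (m : ℝ) < 18 * M ^ 2 := by exact_mod_cast H
    have h2 : x ^ 20 ≤ (18 * M) ^ 20 := by
      calc x ^ 20 = 2 ^ n := hx20
        _ ≤ 2 ^ (n + 1) := pow_le_pow_right₀ (by norm_num) (by omega)
        _ ≤ 18 * M ^ 2 := by linarith
        _ ≤ (18 * M) ^ 2 := by nlinarith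
        _ ≤ (18 * M) ^ 20 := pow_le_pow_right₀ (by linarith) (by norm_num)
    have := (pow_le_pow_iff_left₀ hx0 (by positivity) (by norm_num)).1 h2
    linarith
  · have hm0 : (0 : ℝ) < m := lt_of_lt_of_le (by positivity) hmR
    have h1 : x ^ 5 ≤ 8 * 2 ^ h := by
      refine (pow_le_pow_iff_left₀ (by positivity) (by positivity) (n := 4) (by norm_num)).1 ?_
      calc (x ^ 5) ^ 4 = 2 ^ n := by rw [← hx20]; ring
        _ ≤ 2 ^ (4 * h + 12) := pow_le_pow_right₀ (by norm_num) (by omega)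
        _ = (8 * 2 ^ h) ^ 4 := by rw [mul_pow, ← pow_mul, pow_add]; ring
    have h2 : x ^ 5 ≤ m := by
      calc x ^ 5 ≤ x ^ 20 := pow_le_pow_right₀ hx1 (by norm_num)
        _ = 2 ^ n := hx20
        _ ≤ 2 ^ (n + 1) := pow_le_pow_right₀ (by norm_num) (by omega)
        _ ≤ m := hmR
    have h3 : (1 / 2 ^ h + 3 / m) * x ^ 5 ≤ 11 := by
      have e1 : 1 / 2 ^ h * x ^ 5 ≤ 8 := by
        rw [one_div_mul_eq_div, div_le_iff₀ (by positivity)]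
        exact h1
      have e2 : 3 / m * x ^ 5 ≤ 3 := by
        rw [div_mul_eq_mul_div, div_le_iff₀ hm0]
        linarith
      linarith
    have h4 : (M : ℝ) * (3 * M + 2) ≤ 5 * M ^ 2 := by nlinarith
    refine (pow_le_pow_iff_left₀ (by positivity) (by positivity) (n := 5) (by norm_num)).1 ?_
    calc (t * x) ^ 5 = d * x ^ 5 := by rw [mul_pow, ht5]
      _ ≤ 2 * ((1 / 2 ^ h + 3 / m) * (M * (3 * M + 2))) * x ^ 5 := by gcongr
      _ = 2 * ((1 / 2 ^ h + 3 / m) * x ^ 5) * (M * (3 * M + 2)) := by ring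
      _ ≤ 2 * 11 * (5 * M ^ 2) := by gcongr
      _ ≤ 100 ^ 5 * M ^ 2 := by nlinarith
      _ ≤ 100 ^ 5 * M ^ 5 :=
          mul_le_mul_of_nonneg_left (pow_le_pow_right₀ hM1 (by norm_num)) (by norm_num)
      _ = (100 * M) ^ 5 := by rw [mul_pow]

namespace WeldedTrees

variable {n : ℕ}

theorem card_vertex : Fintype.card (Vertex n) = 2 ^ (n + 2) - 2 := by
  have h : ∀ n, ∑ k ∈ Finset.range (n + 1), 2 ^ k + 1 = 2 ^ (n + 1) := by
    intro n
    induction n with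
    | zero => simp
    | succ n ih =>
      rw [Finset.sum_range_succ]
      have : 2 ^ (n + 1 + 1) = 2 * 2 ^ (n + 1) := by ring
      omega
  rw [Fintype.card_prod, Fintype.card_bool, Fintype.card_sigma]
  simp only [Fintype.card_fin]
  rw [Fin.sum_univ_eq_sum_range (fun k => 2 ^ k)]
  have h1 := h n
  have : 2 ^ (n + 2) = 2 * 2 ^ (n + 1) := by ring
  omega

/-- Welded trees with an additional edge between the roots, as a polar rotation. -/
theorem exists_rotation (hn : 1 ≤ n) (α β : Equiv.Perm (Fin (2 ^ n))) :
    ∃ R : PolarRotation (Vertex n), R.pole = root n ∧ R.Adj = ClosedAdj α β := by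
  choose a b c hab hac hbc hadj hroot using exists_neighbours hn α β
  have hnbr : ∀ u v, ClosedAdj α β u v ↔ ∃ i : Fin 3, v = ![a u, b u, c u] i := by
    intro u v
    rw [hadj, Fin.exists_fin_succ, Fin.exists_fin_two]
    rfl
  obtain ⟨R, h1, h2⟩ := exists_polarRotation (fun u => ![a u, b u, c u])
    (fun u i j h => by
      fin_cases i <;> fin_cases j <;> first
        | rfl
        | exact absurd h (hab u)
        | exact absurd h (hac u)
        | exact absurd h (hbc u)
        | exact absurd h.symm (hab u)
        | exact absurd h.symm (hac u)
        | exact absurd h.symm (hbc u))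
    (fun u i => by
      obtain ⟨j, hj⟩ := (hnbr _ u).1 ((hnbr u _).2 ⟨i, rfl⟩).symm
      exact ⟨j, hj.symm⟩)
    (root n) (fun _ _ h => root_inj.1 h) (fun s => hroot _ s rfl)
  refine ⟨R, h2, ?_⟩
  funext u v
  rw [eq_iff_iff, hnbr, Rotation.Adj, h1]

end WeldedTrees

theorem theorem2 :
    ∃ c : ℝ, 0 < c ∧
      ∀ (n : ℕ), 1 ≤ n →
      ∀ (b : ℕ) (q : ℝ), q ∈ Set.Icc ((1 : ℝ) / 2 ^ b) 1 →
      -- the domain of the identifiers, large enough for all the nodes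
      ∀ (I : Type*) [Finite I], 2 ^ (n + 2) - 2 ≤ Nat.card I →
      -- the shared randomness
      ∀ (Ω : Type*) [MeasurableSpace Ω] (μ : Measure Ω) [IsProbabilityMeasure μ]
        (A : DistAlg I b Ω),
        A.SolvesRouting μ (WeldedTrees.family n I) q →
        ENNReal.ofReal (c * (q - 1 / 2 ^ b) ^ ((1 : ℝ) / 5) * (2 : ℝ) ^ ((n : ℝ) / 20)) ≤
          A.messageComplexity (WeldedTrees.family n I) := by
  refine ⟨1 / 100, by norm_num, ?_⟩
  intro n hn b q hq I _ hI Ω _ μ _ A hA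
  classical
  rcases eq_or_ne (A.messageComplexity (WeldedTrees.family n I)) ⊤ with htop | htop
  · rw [htop]
    exact le_top
  set t := A.messageComplexity (WeldedTrees.family n I) with ht
  refine ENNReal.ofReal_le_of_le_toReal ?_
  set M := ⌊t.toReal⌋₊ with hMdef
  refine le_trans ?_ (Nat.floor_le ENNReal.toReal_nonneg)
  have hpow : 2 ^ (n + 2) = 2 * 2 ^ (n + 1) := by ring
  have hpow4 : 4 ≤ 2 ^ (n + 1) := by
    calc 4 = 2 ^ 2 := rfl
      _ ≤ 2 ^ (n + 1) := Nat.pow_le_pow_right (by norm_num) (by omega)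
  obtain ⟨ι⟩ : Nonempty (WeldedTrees.Vertex n ↪ I) := by
    have := Fintype.ofFinite I
    rw [Nat.card_eq_fintype_card] at hI
    exact Function.Embedding.nonempty_of_card_le (by rw [WeldedTrees.card_vertex]; exact hI)
  -- the bounds that hold on all networks with a given weld
  have hrot : ∀ α β : Equiv.Perm (Fin (2 ^ n)), ∃ (R : PolarRotation (WeldedTrees.Vertex n))
      (hG : ∀ u v, (WeldedTrees.graph α β).Adj u v ↔ R.Adj u v ∧ ¬ ∃ s, u = R.pole s ∧ v = R.pole !s),
      R.Adj = WeldedTrees.ClosedAdj α β ∧ (∀ N, SendsAtMost A (realize N hG ι) M) ∧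
      (∀ N x, ENNReal.ofReal q ≤
        (μ.prod (DistAlg.coins (WeldedTrees.Vertex n))) {ω | A.Delivers (realize N hG ι) x ω}) := by
    intro α β
    obtain ⟨R, hpole, hadj⟩ := WeldedTrees.exists_rotation hn α β
    have hG : ∀ u v, (WeldedTrees.graph α β).Adj u v ↔
        R.Adj u v ∧ ¬ ∃ s, u = R.pole s ∧ v = R.pole !s := by
      intro u v
      rw [WeldedTrees.graph_adj_iff hn, hadj, hpole]
    have hmem : ∀ N, realize N hG ι ∈ WeldedTrees.family n I := fun N =>
      ⟨congrFun hpole false, congrFun hpole true, α, β, rfl⟩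
    refine ⟨R, hG, hadj, fun N => DistAlg.sendsAtMost_of_cost_le htop fun x ω => ?_,
      fun N x => hA _ (hmem N) x⟩
    rw [ht, DistAlg.messageComplexity]
    exact le_iSup₂_of_le _ (hmem N) (le_iSup₂_of_le x ω le_rfl)
  have hu₀ : ∀ R : PolarRotation (WeldedTrees.Vertex n), Nonempty R.Inner := by
    intro R
    have h1 := R.card_le_card_inner
    rw [WeldedTrees.card_vertex] at h1
    exact Fintype.card_pos_iff.1 (by omega)
  have hd0 : 0 ≤ q - 1 / 2 ^ b := sub_nonneg.2 hq.1
  have hd1 : q - 1 / 2 ^ b ≤ 1 := by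
    have : (0 : ℝ) ≤ 1 / 2 ^ b := by positivity
    linarith [hq.2]
  rcases Nat.eq_zero_or_pos M with hM0 | hMpos
  · -- without messages there are no collisions, whatever the girth
    obtain ⟨R, hG, -, hM, hqN⟩ := hrot 1 1
    obtain ⟨u₀⟩ := hu₀ R
    have hle : q ≤ 1 / 2 ^ b + 0 := le_of_solvesRouting u₀ le_rfl (fun s c x => by
      rw [Finset.filter_false_of_mem]
      · simp
      · rintro N - ⟨r, hr⟩
        exact hr.pos.ne' hM0) hM hqN
    have hd : q - 1 / 2 ^ b = 0 := by linarith
    rw [hd, Real.zero_rpow (by norm_num)]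
    simp
  · set m := 2 ^ (n + 2) - 4 with hm
    refine rpow_mul_rpow_le (h := ((n + 1) / 2 - 4) / 2) (m := m) hd0 hd1 hMpos (by omega) ?_
    -- the girth is useful only if `n` is not too small, and the transfer to random networks needs
    -- that `M` is small; in the other cases the bound is trivial
    by_cases h7 : n < 7
    · exact Or.inl h7
    by_cases hMm : m < 18 * M ^ 2
    · exact Or.inr (Or.inl hMm)
    refine Or.inr (Or.inr ⟨by omega, ?_⟩)
    obtain ⟨α, β, hgirth⟩ := WeldedTrees.exists_girthAtLeast (n := n) (g := (n + 1) / 2 - 2) (by omega)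
    obtain ⟨R, hG, hadj, hM, hqN⟩ := hrot α β
    obtain ⟨u₀⟩ := hu₀ R
    have hle := le_of_girthAtLeast (m := m) (h := ((n + 1) / 2 - 4) / 2) u₀ hM hqN
      (hadj ▸ hgirth) (by omega) (by omega) (by rw [WeldedTrees.card_vertex]; omega) (by omega)
    linarith
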